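/- **Setting.** Let $X$ be a finite state space partitioned into layers $X_0=\{x_0\},X_1,\dots,X_H=\{x_H\}$, $H\ge 1$, $A$ a finite nonempty action set, and $P$ an unknown transition function such that for $x\in X_h$, $h<H$, $P(\cdot|x,a)$ is a distribution supported on $X_{h+1}$. An oblivious adversary fixes losses $\ell_1,\dots,\ell_T: X\times A\to[0,1]$, $T\ge 1$. A policy $\pi$ assigns to every state $x$ a distribution $\pi(\cdot|x)$ on $A$. $V_t^\pi(x_0)$ is the expected total loss under $\ell_t$ of an episode that starts in $x_0$, follows $\pi$ and ends in $x_H$, and $q^{P,\pi}(x,a)=q^{P,\pi}(x)\pi(a|x)$, where $q^{P,\pi}(x)$ is the probability of visiting $x$ in an episode. In episode $t$ the learner executes a policy $\pi_t$ that depends on past observations, and observes only the trajectory $(x_{t,h},a_{t,h},\ell_t(x_{t,h},a_{t,h}))_{h<H}$ (ended by $x_{t,H}=x_H$). The regret is $\mathrm{Reg}=\sum_{t=1}^T V_t^{\pi_t}(x_0)-\min_\pi\sum_{t=1}^T V_t^{\pi}(x_0)$. **Algorithm (policy optimization with dilated bonuses).** Fix $\delta\in(0,1)$ and put $\iota=\ln(T|X||A|/\delta)$,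 $\eta=\min\{\frac1{24H^3},\frac1{\sqrt{|X||A|HT}}\}$, $\gamma=2\eta H$. Start with epoch $k=1$, $\mathcal P_1$ the set of all transition functions that respect the layers, and all counters $N_0,N_1$ equal to $0$. In episode $t=1,\dots,T$: 1. Execute $\pi_t(a|x)\propto\exp\bigl(-\eta\sum_{\tau<t}(\widehat Q_\tau(x,a)-B_\tau(x,a))\bigr)$. 2. Let $\overline q_t(x,a)=\max_{\widehat P\in\mathcal P_k}q^{\widehat P,\pi_t}(x,a)$, $\underline q_t(x,a)=\min_{\widehat P\in\mathcal P_k}q^{\widehat P,\pi_t}(x,a)$, and for $x\in X_h$, $h<H$, $\widehat Q_t(x,a)=\frac{\sum_{i=h}^{H-1}\ell_t(x_{t,i},a_{t,i})}{\overline q_t(x,a)+\gamma}\mathbf 1\{x_{t,h}=x,a_{t,h}=a\}$. 3. Let $b_t(x)=\sum_a\pi_t(a|x)\frac{3\gamma H+H(\overline q_t(x,a)-\underline q_t(x,a))}{\overline q_t(x,a)+\gamma}$ and $B_t(x,a)=b_t(x)+(1+\frac1H)\max_{\widehat P\in\mathcal P_k}\sum_{x'}\widehat P(x'|x,a)\sum_{a'}\pi_t(a'|x')B_t(x',a')$,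 with $B_t(x_H,a)=0$. 4. For all $h<H$ increment $N_k(x_{t,h},a_{t,h})$ and $N_k(x_{t,h},a_{t,h},x_{t,h+1})$. If $N_k(x_{t,h},a_{t,h})\ge\max\{1,2N_{k-1}(x_{t,h},a_{t,h})\}$ for some $h$, replace $k$ by $k+1$, let $N_k$ start as a copy of $N_{k-1}$, put $\overline P_k(x'|x,a)=N_k(x,a,x')/\max\{1,N_k(x,a)\}$, and let $\mathcal P_k$ be the set of layer-respecting $\widehat P$ with $|\widehat P(x'|x,a)-\overline P_k(x'|x,a)|\le 4\sqrt{\frac{\overline P_k(x'|x,a)\iota}{\max\{1,N_k(x,a)\}}}+\frac{28\iota}{3\max\{1,N_k(x,a)\}}$ for all $(x,a,x')\in X_h\times A\times X_{h+1}$, $h<H$. **Theorem.** There are absolute constants $C,c>0$ and $p\in\mathbb N$ such that for all such $X,A,H,P,T,\ell_1,\dots,\ell_T$ and $\delta\in(0,1)$ the algorithm satisfies, with probability at least $1-c\delta$, both $$\mathrm{Reg}\le C\,\iota^p\bigl(|X|H^2\sqrt{|A|T}+H^4\bigr)\qquad\text{if } T\ge|X|^4|A|\ \text{ or }\ T\le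 H^2|X|^2|A|,$$ and, without restriction on $T$, $$\mathrm{Reg}\le C\,\iota^p\bigl(|X|H^2\sqrt{|A|T}+H^4+H^2|X|^3|A|\bigr).$$ -/

import Mathlib

noncomputable section

namespace TabularMDP

open Finset

variable {X A : Type*} [Fintype X] [Fintype A] {H : ℕ}

/-- The layered state space known to the learner: layer `0` consists of the initial state and
layer `H` of the terminal state. -/
structure Layering (X : Type*) (H : ℕ) where
  layer : X → ℕ
  layer_le : ∀ x, layer x ≤ H
  init : X
  term : X
  layer_eq_zero_iff : ∀ x, layer x = 0 ↔ x = init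
  layer_eq_top_iff : ∀ x, layer x = H ↔ x = term

/-- `P x a x'` is the probability of moving to `x'` when taking action `a` in state `x`. -/
abbrev Transition (X A : Type*) [Fintype X] : Type _ := X → A → stdSimplex ℝ X

/-- `π x a` is the probability of choosing action `a` in state `x`. -/
abbrev Policy (X A : Type*) [Fintype A] : Type _ := X → stdSimplex ℝ A

/-- From a non-terminal layer one can only move to the next layer. -/
def Layering.Respects (L : Layering X H) (P : Transition X A) : Prop :=
  ∀ x a x', L.layer x < H → P x a x' ≠ 0 → L.layer x' = L.layer x + 1

/-! ### Value functions, occupancy measures -/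

/-- Expected total loss over the next `n` steps, started in state `x` (Bellman equation). -/
def valueToGo (P : Transition X A) (π : Policy X A) (ℓ : X → A → ℝ) : ℕ → X → ℝ
  | 0, _ => 0
  | n + 1, x => ∑ a, π x a * (ℓ x a + ∑ x', P x a x' * valueToGo P π ℓ n x')

/-- `V^π(x₀; ℓ)`, the expected total loss of an episode of length `H`. -/
def Layering.value (L : Layering X H) (P : Transition X A) (π : Policy X A)
    (ℓ : X → A → ℝ) : ℝ :=
  valueToGo P π ℓ H L.init

open Classical in
/-- Probability of being in a given state after `n` steps of an episode. -/
def Layering.stepOcc (L : Layering X H) (P : Transition X A) (π : Policy X A) : ℕ → X → ℝ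
  | 0, x => if x = L.init then 1 else 0
  | n + 1, x' => ∑ x, ∑ a, L.stepOcc P π n x * π x a * P x a x'

/-- Occupancy measure `q^{P,π}(x,a)`; the state `x` can only be visited at step `layer x`. -/
def Layering.occ (L : Layering X H) (P : Transition X A) (π : Policy X A) (x : X) (a : A) : ℝ :=
  L.stepOcc P π (L.layer x) x * π x a

/-! ### Trajectories, and the interaction of a learner with the MDP -/

/-- States `x_0, …, x_H` and actions `a_0, …, a_{H-1}` of an episode (or of its first `n` steps). -/
structure Trajectory (X A : Type*) (n : ℕ) where
  state : Fin (n + 1) → X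
  action : Fin n → A

/-- What the learner observes in an episode: the trajectory and the losses along it. -/
structure Observation (X A : Type*) (H : ℕ) extends Trajectory X A H where
  loss : Fin H → ℝ

/-- Bandit feedback. -/
def Trajectory.observe (ℓ : X → A → ℝ) (τ : Trajectory X A H) : Observation X A H :=
  { τ with loss := fun h => ℓ (τ.state h.castSucc) (τ.action h) }

/-- A point of the simplex, as a `PMF`. -/
def toPMF {ι : Type*} [Fintype ι] (p : stdSimplex ℝ ι) : PMF ι :=
  PMF.ofFintype (fun i => ENNReal.ofReal (p i)) (by
    have h : ∑ i, p i = 1 := p.2.2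
    rw [← ENNReal.ofReal_sum_of_nonneg (f := fun i => p i) (fun i _ => p.2.1 i), h,
      ENNReal.ofReal_one])

/-- Law of the first `n` steps of an episode that starts in `x₀`, with `a_h ∼ π(·|x_h)` and
`x_{h+1} ∼ P(·|x_h,a_h)`. -/
def trajectoryLaw (P : Transition X A) (π : Policy X A) (x₀ : X) :
    (n : ℕ) → PMF (Trajectory X A n)
  | 0 => PMF.pure ⟨fun _ => x₀, Fin.elim0⟩
  | n + 1 => (trajectoryLaw P π x₀ n).bind fun τ =>
      (toPMF (π (τ.state (Fin.last n)))).bind fun a =>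
        (toPMF (P (τ.state (Fin.last n)) a)).map fun x' =>
          ⟨Fin.snoc τ.state x', Fin.snoc τ.action a⟩

/-- A (deterministic) learner maps the observations of the past `n` episodes to the policy that
is executed in the next one. -/
abbrev Learner (X A : Type*) [Fintype A] (H : ℕ) : Type _ :=
  (n : ℕ) → (Fin n → Observation X A H) → Policy X A

/-- The policy executed after `n` episodes with trajectories `ω`, under the losses `ℓ 0, ℓ 1, …` -/
def Learner.policyAfter (𝔸 : Learner X A H) (ℓ : ℕ → X → A → ℝ) (n : ℕ)
    (ω : Fin n → Trajectory X A H) : Policy X A :=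
  𝔸 n fun s => (ω s).observe (ℓ s)

/-- Joint law of the trajectories of the first `n` episodes when the learner `𝔸` interacts with
the MDP. -/
def Layering.interactionLaw (L : Layering X H) (P : Transition X A) (ℓ : ℕ → X → A → ℝ)
    (𝔸 : Learner X A H) : (n : ℕ) → PMF (Fin n → Trajectory X A H)
  | 0 => PMF.pure Fin.elim0
  | n + 1 => (L.interactionLaw P ℓ 𝔸 n).bind fun ω =>
      (trajectoryLaw P (𝔸.policyAfter ℓ n ω) L.init H).map fun τ => Fin.snoc ω τ

/-- Probability of an event under a `PMF`. -/
def prob {Ω : Type*} (p : PMF Ω) (E : Set Ω) : ℝ := (p.toOuterMeasure E).toReal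

/-- The regret of the first `T` episodes, a function of the realized trajectories. -/
def Layering.regret (L : Layering X H) (P : Transition X A) (ℓ : ℕ → X → A → ℝ)
    (𝔸 : Learner X A H) (T : ℕ) (ω : Fin T → Trajectory X A H) : ℝ :=
  ∑ t : Fin T, L.value P (𝔸.policyAfter ℓ t (Fin.take t t.is_lt.le ω)) (ℓ t)
    - ⨅ π : Policy X A, ∑ t : Fin T, L.value P π (ℓ t)

/-! ### Policy optimization with dilated bonuses -/

/-- `ln (T |X| |A| / δ)` -/
def logTerm (X A : Type*) [Fintype X] [Fintype A] (T : ℕ) (δ : ℝ) : ℝ :=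
  Real.log (T * Fintype.card X * Fintype.card A / δ)

/-- The learning rate. -/
def eta (X A : Type*) [Fintype X] [Fintype A] (H T : ℕ) : ℝ :=
  min (1 / (24 * (H : ℝ) ^ 3)) (1 / √(Fintype.card X * Fintype.card A * H * T))

/-- The exploration parameter `γ = 2 η H`. -/
def gam (X A : Type*) [Fintype X] [Fintype A] (H T : ℕ) : ℝ := 2 * eta X A H T * H

/-- `π(a|x) ∝ exp (-η S(x,a))` -/
def expPolicy [Nonempty A] (η : ℝ) (S : X → A → ℝ) : Policy X A := fun x =>
  ⟨fun a => Real.exp (-η * S x a) / ∑ a', Real.exp (-η * S x a'), by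
    have h : 0 < ∑ a', Real.exp (-η * S x a') :=
      Finset.sum_pos (fun _ _ => Real.exp_pos _) Finset.univ_nonempty
    refine ⟨fun a => by positivity, ?_⟩
    rw [← Finset.sum_div, div_self h.ne']⟩

/-- All transition functions that respect the layers. -/
def Layering.allTransitions (L : Layering X H) (A : Type*) : Set (Transition X A) :=
  {P | L.Respects P}

/-- Empirical transition probability from the counters `N(x,a)` and `N(x,a,x')`. -/
def empirical (N₂ : X → A → ℕ) (N₃ : X → A → X → ℕ) (x : X) (a : A) (x' : X) : ℝ :=
  N₃ x a x' / max 1 (N₂ x a : ℝ)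

/-- Confidence width with log-term `ι`. -/
def confWidth (ι : ℝ) (N₂ : X → A → ℕ) (N₃ : X → A → X → ℕ) (x : X) (a : A) (x' : X) : ℝ :=
  4 * √(empirical N₂ N₃ x a x' * ι / max 1 (N₂ x a : ℝ)) + 28 * ι / (3 * max 1 (N₂ x a : ℝ))

/-- Confidence set built from the counters. -/
def Layering.confSet (L : Layering X H) (ι : ℝ) (N₂ : X → A → ℕ) (N₃ : X → A → X → ℕ) :
    Set (Transition X A) :=
  {P | L.Respects P ∧ ∀ x a x', L.layer x < H → L.layer x' = L.layer x + 1 →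
    |P x a x' - empirical N₂ N₃ x a x'| ≤ confWidth ι N₂ N₃ x a x'}

/-- Upper occupancy bound: maximum of `q^{P̂,π}(x,a)` over `P̂ ∈ K`. -/
def Layering.upperOcc (L : Layering X H) (K : Set (Transition X A)) (π : Policy X A)
    (x : X) (a : A) : ℝ :=
  sSup ((fun P => L.occ P π x a) '' K)

/-- Lower occupancy bound: minimum of `q^{P̂,π}(x,a)` over `P̂ ∈ K`. -/
def Layering.lowerOcc (L : Layering X H) (K : Set (Transition X A)) (π : Policy X A)
    (x : X) (a : A) : ℝ :=
  sInf ((fun P => L.occ P π x a) '' K)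

/-- `L_{t,h}`, the loss suffered from step `h` to the end of the episode. -/
def Observation.lossFrom (o : Observation X A H) (h : ℕ) : ℝ :=
  ∑ i : Fin H, if h ≤ (i : ℕ) then o.loss i else 0

/-- `1_t(x,a)`: the pair `(x,a)` is visited, at step `layer x`. -/
def Layering.Visits (L : Layering X H) (o : Observation X A H) (x : X) (a : A) : Prop :=
  ∃ h : Fin H, (h : ℕ) = L.layer x ∧ o.state h.castSucc = x ∧ o.action h = a

open Classical in
/-- The optimistic estimator of the `Q`-function. -/
def Layering.qHat (L : Layering X H) (γ : ℝ) (K : Set (Transition X A)) (π : Policy X A)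
    (o : Observation X A H) (x : X) (a : A) : ℝ :=
  if L.Visits o x a then o.lossFrom (L.layer x) / (L.upperOcc K π x a + γ) else 0

/-- The one-step bonus `b_t(x)`. -/
def Layering.bonus (L : Layering X H) (γ : ℝ) (K : Set (Transition X A)) (π : Policy X A)
    (x : X) : ℝ :=
  ∑ a, π x a * ((3 * γ * H + H * (L.upperOcc K π x a - L.lowerOcc K π x a))
    / (L.upperOcc K π x a + γ))

/-- Dilated bonus with `n` steps to go (dilated Bellman equation, optimistic over `K`). -/
def Layering.dilatedToGo (L : Layering X H) (γ : ℝ) (K : Set (Transition X A)) (π : Policy X A) :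
    ℕ → X → A → ℝ
  | 0, _, _ => 0
  | n + 1, x, a => L.bonus γ K π x + (1 + 1 / (H : ℝ)) *
      sSup ((fun P : Transition X A =>
        ∑ x', P x a x' * ∑ a', π x' a' * L.dilatedToGo γ K π n x' a') '' K)

/-- The dilated bonus `B_t(x,a)`; it vanishes in the terminal state. -/
def Layering.dilatedBonus (L : Layering X H) (γ : ℝ) (K : Set (Transition X A)) (π : Policy X A)
    (x : X) (a : A) : ℝ :=
  L.dilatedToGo γ K π (H - L.layer x) x a

/-- The learner's memory between two episodes, within epoch `k`. -/
structure AlgState (X A : Type*) [Fintype X] where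
  /-- `∑ (Q̂_τ - B_τ)` over the past episodes `τ` -/
  cumLoss : X → A → ℝ
  /-- the confidence set `P_k`, the argument `K` of the bonuses -/
  conf : Set (Transition X A)
  /-- `N_{k-1}(x,a)` -/
  prevCount : X → A → ℕ
  /-- `N_k(x,a)` -/
  count : X → A → ℕ
  /-- `N_k(x,a,x')` -/
  count₃ : X → A → X → ℕ

def Layering.initState (L : Layering X H) (A : Type*) : AlgState X A where
  cumLoss _ _ := 0
  conf := L.allTransitions A
  prevCount _ _ := 0
  count _ _ := 0
  count₃ _ _ _ := 0

open Classical in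
/-- The updates at the end of an episode, in which `expPolicy η s.cumLoss` has been executed and
`o` has been observed; `T` is the number of episodes and `δ` the confidence parameter. -/
def Layering.update [Nonempty A] (L : Layering X H) (T : ℕ) (δ : ℝ) (s : AlgState X A)
    (o : Observation X A H) : AlgState X A :=
  let γ := gam X A H T
  let π := expPolicy (eta X A H T) s.cumLoss
  let cum : X → A → ℝ := fun x a =>
    s.cumLoss x a + (L.qHat γ s.conf π o x a - L.dilatedBonus γ s.conf π x a)
  let N₂ : X → A → ℕ := fun x a =>
    s.count x a + #{h : Fin H | o.state h.castSucc = x ∧ o.action h = a}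
  let N₃ : X → A → X → ℕ := fun x a x' =>
    s.count₃ x a x' + #{h : Fin H | o.state h.castSucc = x ∧ o.action h = a ∧ o.state h.succ = x'}
  if ∃ h : Fin H, max 1 (2 * s.prevCount (o.state h.castSucc) (o.action h))
      ≤ N₂ (o.state h.castSucc) (o.action h) then
    { cumLoss := cum
      conf := L.confSet (logTerm X A T δ) N₂ N₃
      prevCount := N₂
      count := N₂
      count₃ := N₃ }
  else
    { cumLoss := cum
      conf := s.conf
      prevCount := s.prevCount
      count := N₂
      count₃ := N₃ }

/-- Memory after `n` episodes. -/
def Layering.stateAfter [Nonempty A] (L : Layering X H) (T : ℕ) (δ : ℝ) :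
    (n : ℕ) → (Fin n → Observation X A H) → AlgState X A
  | 0, _ => L.initState A
  | n + 1, o => L.update T δ (L.stateAfter T δ n (fun s => o s.castSucc)) (o (Fin.last n))

/-- Policy optimization with dilated bonuses, run with parameters `T` and `δ`. -/
def Layering.dilatedBonusPO [Nonempty A] (L : Layering X H) (T : ℕ) (δ : ℝ) : Learner X A H :=
  fun n o => expPolicy (eta X A H T) (L.stateAfter T δ n o).cumLoss

end TabularMDP

end

/-! Fix a comparator `π'`. By the performance difference lemma (`value_sub_value`) the regret in
episode t is the value, under `π'`, of the function x ↦ ∑_a (π_t - π')(a|x) Q_t(x,a), where Q_t is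
the action value of the learner's policy. Let m_t = q Q_t / (q̄_t + γ) be the conditional mean of
the estimator Q̂_t. At each state the sum splits into the bias ∑ π_t (Q_t - m_t), the fluctuation ∑
π_t (m_t - Q̂_t), the overestimation ∑ π' (Q̂_t - Q_t), the regret of exponential weights fed with
Q̂_t - B_t, and ∑ (π_t - π') B_t.

Put F_t(x) = H ∑_a π_t(a|x) γ / (q̄_t + γ). The numerator 3γH of the bonus is a budget of three
copies of F_t. The bias uses one, so it is at most b_t - 2 F_t. The second-moment term of
exponential weights uses another, along with (1/H) ∑ π_t B_t. The fluctuation, averaged over the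
visits of `π'`, uses the third. The overestimation costs only O(ι/η) because of the γ in the
denominator. What is left is the value under `π'` of b_t + (1 + 1/H) ∑ π_t B_t - ∑ π' B_t, and the
dilated Bellman recursion is designed so that this telescopes to (1 + 1/H) ∑ π_t B_t at x_0
(`value_dilated_le`). The unknown occupancy of `π'` has then disappeared (`sum_value_sub_value_le`).

A confidence set is compact and a product over state-action pairs, so one member attains all the
maxima in the recursion at once. Unrolling along it costs (1 + 1/H)^H ≤ 3. Its occupancy is at most
q̄_t and cancels the denominators, which leaves the sum over (x,a) of 3γH + H (q̄_t - q̲_t).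

The widths q̄_t - q̲_t give the leading term. The probabilities of reaching x under two members of
the confidence set are compared by a recursion in which the second-order error is absorbed, by
AM-GM, into a 1/H-fraction of the quantity being bounded (`abs_valueToGo_indicator_sub_le`). The
first-order error is weighted by true reaching probabilities, whose sum over x is at most H.
Cauchy-Schwarz over successors and over each layer then produces √(|X_m| |X_{m+1}|), which sums to
at most |X|. The widths thus add up to H|X|√(|A|T) plus H|X|³|A|, up to logarithms
(`sum_upperOcc_sub_lowerOcc_run_le`), and the bonus contributes one more H.

All concentration has one form: increments Z_t with E exp Z_t ≤ 1 for every memory state, followed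
by Markov's inequality (`expect_exp_runSum_le`). Increments that need the true transition function
in the confidence set are set to zero otherwise, so no conditioning on good events occurs. Seven
families of events fail with probability at most δ each (`prob_regret_gt_le`).

The resulting bound contains H²|X|³|A|. It is dominated by the leading term if T ≥ |X|⁴|A|, and for
T ≤ H²|X|²|A| the trivial bound HT is already good enough. -/

noncomputable section

set_option linter.unusedSectionVars false

namespace TabularMDP

open Finset

/-! ### Expectations under a `PMF` on a finite type -/

section Expect

variable {Ω Ω' : Type*} [Fintype Ω] [Fintype Ω']

/-- Expectation of a real function under a `PMF` on a finite type. -/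
def expect (p : PMF Ω) (f : Ω → ℝ) : ℝ := ∑ ω, (p ω).toReal * f ω

theorem sum_toReal_eq_one (p : PMF Ω) : ∑ ω, (p ω).toReal = 1 := by
  have h : ∑ ω, p ω = 1 := by
    have := p.tsum_coe
    rwa [tsum_fintype] at this
  rw [← ENNReal.toReal_sum (fun ω _ => p.apply_ne_top ω), h, ENNReal.toReal_one]

theorem expect_const (p : PMF Ω) (c : ℝ) : expect p (fun _ => c) = c := by
  rw [expect, ← Finset.sum_mul, sum_toReal_eq_one, one_mul]

theorem expect_add (p : PMF Ω) (f g : Ω → ℝ) :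
    expect p (fun ω => f ω + g ω) = expect p f + expect p g := by
  simp only [expect, mul_add, Finset.sum_add_distrib]

theorem expect_sub (p : PMF Ω) (f g : Ω → ℝ) :
    expect p (fun ω => f ω - g ω) = expect p f - expect p g := by
  simp only [expect, mul_sub, Finset.sum_sub_distrib]

theorem expect_const_mul (p : PMF Ω) (c : ℝ) (f : Ω → ℝ) :
    expect p (fun ω => c * f ω) = c * expect p f := by
  simp only [expect, Finset.mul_sum]
  exact Finset.sum_congr rfl fun ω _ => by ring

theorem expect_sum {ι : Type*} (s : Finset ι) (p : PMF Ω) (f : ι → Ω → ℝ) :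
    expect p (fun ω => ∑ i ∈ s, f i ω) = ∑ i ∈ s, expect p (f i) := by
  simp only [expect, Finset.mul_sum]
  exact Finset.sum_comm

theorem expect_mono (p : PMF Ω) {f g : Ω → ℝ} (h : ∀ ω ∈ p.support, f ω ≤ g ω) :
    expect p f ≤ expect p g := by
  refine Finset.sum_le_sum fun ω _ => ?_
  by_cases hω : p ω = 0
  · simp [hω]
  · exact mul_le_mul_of_nonneg_left (h ω ((p.mem_support_iff ω).2 hω)) ENNReal.toReal_nonneg

theorem expect_congr (p : PMF Ω) {f g : Ω → ℝ} (h : ∀ ω ∈ p.support, f ω = g ω) :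
    expect p f = expect p g :=
  le_antisymm (expect_mono p fun ω hω => (h ω hω).le) (expect_mono p fun ω hω => (h ω hω).ge)

theorem expect_pure (a : Ω) (f : Ω → ℝ) : expect (PMF.pure a) f = f a := by
  classical
  rw [expect, Finset.sum_eq_single a]
  · simp
  · intro b _ hb
    simp [PMF.pure_apply_of_ne _ _ hb]
  · simp

theorem expect_bind (p : PMF Ω) (q : Ω → PMF Ω') (f : Ω' → ℝ) :
    expect (p.bind q) f = expect p fun ω => expect (q ω) f := by
  have h : ∀ y, (p.bind q y).toReal = ∑ ω, (p ω).toReal * (q ω y).toReal := by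
    intro y
    rw [PMF.bind_apply, tsum_fintype, ENNReal.toReal_sum]
    · simp only [ENNReal.toReal_mul]
    · exact fun ω _ => ENNReal.mul_ne_top (p.apply_ne_top ω) ((q ω).apply_ne_top y)
  simp only [expect, h, Finset.sum_mul, Finset.mul_sum]
  rw [Finset.sum_comm]
  exact Finset.sum_congr rfl fun _ _ => Finset.sum_congr rfl fun _ _ => by ring

theorem expect_map (p : PMF Ω) (g : Ω → Ω') (f : Ω' → ℝ) :
    expect (p.map g) f = expect p fun ω => f (g ω) := by
  rw [PMF.map, expect_bind]
  simp only [Function.comp_apply, expect_pure]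

theorem expect_toPMF (p : stdSimplex ℝ Ω) (f : Ω → ℝ) : expect (toPMF p) f = ∑ i, p i * f i := by
  refine Finset.sum_congr rfl fun i _ => ?_
  have h : 0 ≤ p i := p.2.1 i
  rw [toPMF, PMF.ofFintype_apply, ENNReal.toReal_ofReal h]

theorem mem_support_toPMF {p : stdSimplex ℝ Ω} {i : Ω} : i ∈ (toPMF p).support ↔ p i ≠ 0 := by
  have h : 0 ≤ p i := p.2.1 i
  rw [PMF.mem_support_iff, toPMF, PMF.ofFintype_apply, ne_eq, ENNReal.ofReal_eq_zero, not_le]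
  exact ⟨fun h => h.ne', fun h' => lt_of_le_of_ne h h'.symm⟩

open Classical in
theorem prob_eq_expect (p : PMF Ω) (E : Set Ω) :
    prob p E = expect p fun ω => if ω ∈ E then 1 else 0 := by
  rw [prob, PMF.toOuterMeasure_apply_fintype, ENNReal.toReal_sum]
  · refine Finset.sum_congr rfl fun ω _ => ?_
    by_cases h : ω ∈ E <;> simp [h]
  · intro ω _
    by_cases h : ω ∈ E <;> simp [h, p.apply_ne_top]

/-- Markov's inequality for exponential moments. -/
theorem prob_le_exp_neg (p : PMF Ω) {S : Ω → ℝ} (hS : expect p (fun ω => Real.exp (S ω)) ≤ 1)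
    (c : ℝ) : prob p {ω | c < S ω} ≤ Real.exp (-c) := by
  classical
  rw [prob_eq_expect]
  calc _ ≤ expect p fun ω => Real.exp (-c) * Real.exp (S ω) := by
        refine expect_mono p fun ω _ => ?_
        split_ifs with h
        · rw [← Real.exp_add]
          exact Real.one_le_exp (by have : c < S ω := h; linarith)
        · positivity
    _ = Real.exp (-c) * expect p fun ω => Real.exp (S ω) := expect_const_mul _ _ _
    _ ≤ Real.exp (-c) := mul_le_of_le_one_right (Real.exp_pos _).le hS

/-- Union bound in which only outcomes of the support have to be covered. This lets the final
argument use that the realized trajectories follow the layers. -/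
theorem prob_le_sum {ι : Type*} (s : Finset ι) (p : PMF Ω) (E : Set Ω) (F : ι → Set Ω)
    (h : ∀ ω ∈ p.support, ω ∈ E → ∃ i ∈ s, ω ∈ F i) : prob p E ≤ ∑ i ∈ s, prob p (F i) := by
  classical
  simp only [prob_eq_expect]
  rw [← expect_sum]
  refine expect_mono p fun ω hω => ?_
  have h0 : ∀ i ∈ s, (0 : ℝ) ≤ if ω ∈ F i then 1 else 0 := fun i _ => by split_ifs <;> simp
  split_ifs with hE
  · obtain ⟨i, hi, hF⟩ := h ω hω hE
    calc (1 : ℝ) = if ω ∈ F i then 1 else 0 := by simp [hF]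
      _ ≤ _ := Finset.single_le_sum h0 hi
  · exact Finset.sum_nonneg h0

theorem one_sub_prob_compl (p : PMF Ω) (E : Set Ω) : prob p E = 1 - prob p Eᶜ := by
  classical
  rw [prob_eq_expect, prob_eq_expect, eq_sub_iff_add_eq, ← expect_add]
  conv_rhs => rw [← expect_const p 1]
  refine expect_congr p fun ω _ => ?_
  by_cases h : ω ∈ E <;> simp [h]

theorem prob_mono (p : PMF Ω) {E F : Set Ω} (h : ∀ ω ∈ p.support, ω ∈ E → ω ∈ F) :
    prob p E ≤ prob p F := by
  classical
  rw [prob_eq_expect, prob_eq_expect]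
  refine expect_mono p fun ω hω => ?_
  have := h ω hω
  by_cases h1 : ω ∈ E
  · simp [h1, this h1]
  · simp only [h1, if_false]
    split_ifs <;> simp

end Expect

/-! ### The law of a trajectory -/

variable {X A : Type*} [Fintype X] [Fintype A] {H : ℕ}

theorem transition_nonneg (P : Transition X A) (x : X) (a : A) (x' : X) : 0 ≤ P x a x' :=
  (P x a).2.1 x'

theorem sum_transition (P : Transition X A) (x : X) (a : A) : ∑ x', P x a x' = 1 := (P x a).2.2

theorem policy_nonneg (π : Policy X A) (x : X) (a : A) : 0 ≤ π x a := (π x).2.1 a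

theorem sum_policy (π : Policy X A) (x : X) : ∑ a, π x a = 1 := (π x).2.2

theorem transition_le_one (P : Transition X A) (x : X) (a : A) (x' : X) : P x a x' ≤ 1 :=
  (Finset.single_le_sum (fun y _ => transition_nonneg P x a y) (Finset.mem_univ x')).trans_eq
    (sum_transition P x a)

theorem policy_le_one (π : Policy X A) (x : X) (a : A) : π x a ≤ 1 :=
  (Finset.single_le_sum (fun y _ => policy_nonneg π x y) (Finset.mem_univ a)).trans_eq
    (sum_policy π x)

instance (n : ℕ) : Fintype (Trajectory X A n) :=
  Fintype.ofEquiv ((Fin (n + 1) → X) × (Fin n → A))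
    { toFun := fun p => ⟨p.1, p.2⟩
      invFun := fun τ => (τ.state, τ.action)
      left_inv := fun _ => rfl
      right_inv := fun _ => rfl }

/-- Extension of a trajectory by an action and a state. -/
def Trajectory.extend {n : ℕ} (τ : Trajectory X A n) (a : A) (x' : X) : Trajectory X A (n + 1) :=
  ⟨Fin.snoc τ.state x', Fin.snoc τ.action a⟩

/-- Final state of a trajectory. -/
abbrev Trajectory.final {n : ℕ} (τ : Trajectory X A n) : X := τ.state (Fin.last n)

theorem Trajectory.extend_final {n : ℕ} (τ : Trajectory X A n) (a : A) (x' : X) :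
    (τ.extend a x').final = x' := by
  simp [Trajectory.extend, Trajectory.final]

theorem Trajectory.extend_state {n : ℕ} (τ : Trajectory X A n) (a : A) (x' : X) (i : Fin (n + 1)) :
    (τ.extend a x').state i.castSucc = τ.state i := by
  simp [Trajectory.extend]

theorem Trajectory.extend_action {n : ℕ} (τ : Trajectory X A n) (a : A) (x' : X) (i : Fin n) :
    (τ.extend a x').action i.castSucc = τ.action i := by
  simp [Trajectory.extend]

theorem Trajectory.extend_action_last {n : ℕ} (τ : Trajectory X A n) (a : A) (x' : X) :
    (τ.extend a x').action (Fin.last n) = a := by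
  simp [Trajectory.extend]

theorem expect_trajectoryLaw_zero (P : Transition X A) (π : Policy X A) (x₀ : X)
    (f : Trajectory X A 0 → ℝ) :
    expect (trajectoryLaw P π x₀ 0) f = f ⟨fun _ => x₀, Fin.elim0⟩ :=
  expect_pure _ _

theorem expect_trajectoryLaw_succ (P : Transition X A) (π : Policy X A) (x₀ : X) (n : ℕ)
    (f : Trajectory X A (n + 1) → ℝ) :
    expect (trajectoryLaw P π x₀ (n + 1)) f = expect (trajectoryLaw P π x₀ n) fun τ =>
      ∑ a, π τ.final a * ∑ x', P τ.final a x' * f (τ.extend a x') := by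
  rw [trajectoryLaw, expect_bind]
  simp only [expect_bind, expect_map, expect_toPMF]
  rfl

theorem mem_support_trajectoryLaw_succ {P : Transition X A} {π : Policy X A} {x₀ : X} {n : ℕ}
    {τ : Trajectory X A (n + 1)} (h : τ ∈ (trajectoryLaw P π x₀ (n + 1)).support) :
    ∃ τ' ∈ (trajectoryLaw P π x₀ n).support, ∃ a x', P τ'.final a x' ≠ 0 ∧ τ = τ'.extend a x' := by
  rw [trajectoryLaw, PMF.mem_support_bind_iff] at h
  obtain ⟨τ', h', h⟩ := h
  rw [PMF.mem_support_bind_iff] at h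
  obtain ⟨a, _, h⟩ := h
  rw [PMF.mem_support_map_iff] at h
  obtain ⟨x', hx', rfl⟩ := h
  exact ⟨τ', h', a, x', mem_support_toPMF.1 hx', rfl⟩

theorem layer_init (L : Layering X H) : L.layer L.init = 0 := (L.layer_eq_zero_iff _).2 rfl

/-- A trajectory whose `h`-th state belongs to layer `h`. -/
def Layering.Follows (L : Layering X H) {n : ℕ} (τ : Trajectory X A n) : Prop :=
  ∀ h : Fin (n + 1), L.layer (τ.state h) = h

/-- `Respects` is silent about moves out of the terminal layer, whence the restriction to at most
`H` steps. -/
theorem follows_of_mem_support {L : Layering X H} {P : Transition X A} (hP : L.Respects P)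
    {π : Policy X A} {n : ℕ} (hn : n ≤ H) {τ : Trajectory X A n}
    (h : τ ∈ (trajectoryLaw P π L.init n).support) : L.Follows τ := by
  induction n with
  | zero =>
    rw [trajectoryLaw, PMF.mem_support_pure_iff] at h
    subst h
    intro i
    simp [layer_init]
  | succ n ih =>
    obtain ⟨τ', h', a, x', hx', rfl⟩ := mem_support_trajectoryLaw_succ h
    have ih := ih (by omega) h'
    intro i
    refine Fin.lastCases ?_ (fun j => ?_) i
    · have hl := ih (Fin.last n)
      rw [Fin.val_last] at hl
      have := hP τ'.final a x' (by rw [hl]; omega) hx'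
      rw [← Trajectory.final, Trajectory.extend_final, this, hl, Fin.val_last]
    · rw [Trajectory.extend_state]
      exact ih j

theorem stepOcc_eq_expect [DecidableEq X] (L : Layering X H) (P : Transition X A) (π : Policy X A)
    (n : ℕ) (x : X) :
    L.stepOcc P π n x
      = expect (trajectoryLaw P π L.init n) fun τ => if τ.final = x then 1 else 0 := by
  induction n generalizing x with
  | zero =>
    rw [expect_trajectoryLaw_zero]
    simp only [Layering.stepOcc, Trajectory.final, eq_comm]
    congr
  | succ n ih =>
    rw [expect_trajectoryLaw_succ]
    have h : ∀ τ : Trajectory X A n, (∑ a, π τ.final a * ∑ x', P τ.final a x' *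
        if (τ.extend a x').final = x then (1 : ℝ) else 0)
        = ∑ y, (∑ a, π y a * P y a x) * if τ.final = y then 1 else 0 := by
      intro τ
      simp [Trajectory.extend_final]
    simp only [h, expect_sum, expect_const_mul, ← ih, Layering.stepOcc]
    refine Finset.sum_congr rfl fun y _ => ?_
    rw [Finset.sum_mul]
    exact Finset.sum_congr rfl fun a _ => by ring

open Classical in
/-- Indicator of the event that a trajectory visits `x` at step `h < n` and takes action `a`. -/
def Trajectory.visit {n : ℕ} (τ : Trajectory X A n) (h : ℕ) (x : X) (a : A) : ℝ :=
  if ∃ i : Fin n, (i : ℕ) = h ∧ τ.state i.castSucc = x ∧ τ.action i = a then 1 else 0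

theorem Trajectory.visit_extend_of_lt {n : ℕ} (τ : Trajectory X A n) {h : ℕ} (hn : h < n) (x : X)
    (a : A) (b : A) (y : X) : (τ.extend b y).visit h x a = τ.visit h x a := by
  have : (∃ i : Fin (n + 1), (i : ℕ) = h ∧ (τ.extend b y).state i.castSucc = x ∧
      (τ.extend b y).action i = a) ↔
      ∃ i : Fin n, (i : ℕ) = h ∧ τ.state i.castSucc = x ∧ τ.action i = a := by
    constructor
    · rintro ⟨i, hi, h1, h2⟩
      obtain ⟨j, rfl⟩ : ∃ j : Fin n, i = j.castSucc := ⟨⟨i, by omega⟩, rfl⟩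
      rw [Trajectory.extend_state] at h1
      rw [Trajectory.extend_action] at h2
      exact ⟨j, hi, h1, h2⟩
    · rintro ⟨i, hi, h1, h2⟩
      exact ⟨i.castSucc, hi, by rwa [Trajectory.extend_state], by rwa [Trajectory.extend_action]⟩
  unfold Trajectory.visit
  split_ifs with h1 h2 h2
  exacts [rfl, absurd (this.1 h1) h2, absurd (this.2 h2) h1, rfl]

theorem Trajectory.visit_extend_self [DecidableEq X] [DecidableEq A] {n : ℕ} (τ : Trajectory X A n)
    (x : X) (a : A) (b : A) (y : X) :
    (τ.extend b y).visit n x a = if τ.final = x ∧ b = a then 1 else 0 := by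
  have : (∃ i : Fin (n + 1), (i : ℕ) = n ∧ (τ.extend b y).state i.castSucc = x ∧
      (τ.extend b y).action i = a) ↔ τ.final = x ∧ b = a := by
    constructor
    · rintro ⟨i, hi, h1, h2⟩
      obtain rfl : i = Fin.last n := Fin.ext hi
      rw [Trajectory.extend_state] at h1
      rw [Trajectory.extend_action_last] at h2
      exact ⟨h1, h2⟩
    · rintro ⟨h1, h2⟩
      exact ⟨Fin.last n, rfl, by rwa [Trajectory.extend_state], by
        rwa [Trajectory.extend_action_last]⟩
  unfold Trajectory.visit
  split_ifs with h1 h2 h2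
  exacts [rfl, absurd (this.1 h1) h2, absurd (this.2 h2) h1, rfl]

/-- If `f m` is a martingale along the steps `h < m ≤ n` of an episode, and
`f (h + 1) = 1{x_h = x, a_h = a} G(x_{h+1})`, then its final expectation is
`q_h(x) π(a|x) ∑ P(x'|x,a) G(x')`. -/
theorem expect_of_visit (L : Layering X H) (P : Transition X A) (π : Policy X A)
    (f : (m : ℕ) → Trajectory X A m → ℝ) (G : X → ℝ) (h : ℕ) (x : X) (a : A)
    (hf : ∀ (τ : Trajectory X A h) b y, f (h + 1) (τ.extend b y) = (τ.extend b y).visit h x a * G y)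
    {n : ℕ} (hn : h + 1 ≤ n)
    (hs : ∀ m, h + 1 ≤ m → m < n → ∀ τ : Trajectory X A m,
      ∑ b, π τ.final b * ∑ y, P τ.final b y * f (m + 1) (τ.extend b y) = f m τ) :
    expect (trajectoryLaw P π L.init n) (f n)
      = L.stepOcc P π h x * π x a * ∑ y, P x a y * G y := by
  classical
  induction n, hn using Nat.le_induction with
  | base =>
    rw [expect_trajectoryLaw_succ, stepOcc_eq_expect, mul_assoc, mul_comm, ← expect_const_mul]
    refine expect_congr _ fun τ _ => ?_
    simp only [hf, Trajectory.visit_extend_self]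
    by_cases hx : τ.final = x
    · rw [Finset.sum_eq_single a]
      · simp [hx]
      · intro b _ hb
        simp [hb]
      · simp
    · simp [hx]
  | succ n hn ih =>
    rw [expect_trajectoryLaw_succ, ← ih fun m h1 h2 => hs m h1 (by omega)]
    exact expect_congr _ fun τ _ => hs n hn (by omega) τ

/-- State at step `h` (the final state if the trajectory is shorter). -/
def Trajectory.stateAt {n : ℕ} (τ : Trajectory X A n) (h : ℕ) : X :=
  τ.state ⟨min h n, by omega⟩

theorem Trajectory.stateAt_extend {n : ℕ} (τ : Trajectory X A n) {h : ℕ} (hn : h ≤ n) (b : A)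
    (y : X) : (τ.extend b y).stateAt h = τ.stateAt h := by
  have : (⟨min h (n + 1), by omega⟩ : Fin (n + 2)) = Fin.castSucc ⟨min h n, by omega⟩ := by
    ext; simp; omega
  rw [Trajectory.stateAt, this, Trajectory.extend_state, Trajectory.stateAt]

theorem Trajectory.stateAt_extend_self {n : ℕ} (τ : Trajectory X A n) (b : A)
    (y : X) : (τ.extend b y).stateAt (n + 1) = y := by
  have : (⟨min (n + 1) (n + 1), by omega⟩ : Fin (n + 2)) = Fin.last (n + 1) := by
    ext; simp
  rw [Trajectory.stateAt, this, ← Trajectory.final, Trajectory.extend_final]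

theorem sum_policy_transition (P : Transition X A) (π : Policy X A) (x : X) (c : ℝ) :
    ∑ b, π x b * ∑ y, P x b y * c = c := by
  simp only [← Finset.sum_mul, sum_transition, sum_policy, one_mul]

theorem expect_visit_mul_next (L : Layering X H) (P : Transition X A) (π : Policy X A)
    (G : X → ℝ) {h : ℕ} (hh : h < H) (x : X) (a : A) :
    expect (trajectoryLaw P π L.init H) (fun τ => τ.visit h x a * G (τ.stateAt (h + 1)))
      = L.stepOcc P π h x * π x a * ∑ y, P x a y * G y := by
  refine expect_of_visit L P π (fun m τ => τ.visit h x a * G (τ.stateAt (h + 1))) G h x a ?_ hh ?_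
  · intro τ b y
    rw [Trajectory.stateAt_extend_self]
  · intro m hm _ τ
    simp only [Trajectory.visit_extend_of_lt τ hm, Trajectory.stateAt_extend τ hm]
    exact sum_policy_transition _ _ _ _

theorem expect_visit (L : Layering X H) (P : Transition X A) (π : Policy X A)
    {h : ℕ} (hh : h < H) (x : X) (a : A) :
    expect (trajectoryLaw P π L.init H) (fun τ => τ.visit h x a) = L.stepOcc P π h x * π x a := by
  have := expect_visit_mul_next L P π (fun _ => 1) hh x a
  simpa only [mul_one, sum_transition] using this

/-- The value `Q_n(x,a)` with `n + 1` steps to go. -/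
theorem expect_visit_mul_loss (L : Layering X H) (P : Transition X A) (π : Policy X A)
    (ℓ : X → A → ℝ) {h : ℕ} (hh : h < H) (x : X) (a : A) :
    expect (trajectoryLaw P π L.init H) (fun τ => τ.visit h x a * (τ.observe ℓ).lossFrom h)
      = L.stepOcc P π h x * π x a *
        (ℓ x a + ∑ y, P x a y * valueToGo P π ℓ (H - (h + 1)) y) := by
  classical
  have h1 : ℓ x a + ∑ y, P x a y * valueToGo P π ℓ (H - (h + 1)) y
      = ∑ y, P x a y * (ℓ x a + valueToGo P π ℓ (H - (h + 1)) y) := by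
    simp only [mul_add, Finset.sum_add_distrib, ← Finset.sum_mul, sum_transition, one_mul]
  rw [h1]
  -- The martingale is the loss collected from step `h` on plus the value still to come. At time `H`
  -- nothing is to come; at time `h + 1` only `ℓ x a` has been collected.
  rw [← expect_of_visit L P π (fun m τ => τ.visit h x a * ((∑ i : Fin m, if h ≤ (i : ℕ) then
    ℓ (τ.state i.castSucc) (τ.action i) else 0) + valueToGo P π ℓ (H - m) τ.final)) _ h x a
    ?_ hh ?_]
  · refine expect_congr _ fun τ _ => ?_
    simp [Observation.lossFrom, Trajectory.observe, valueToGo]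
  · intro τ b y
    rw [Fin.sum_univ_castSucc, Trajectory.extend_final]
    simp only [Trajectory.extend_state, Trajectory.extend_action_last, Trajectory.visit_extend_self]
    rw [Finset.sum_eq_zero]
    · by_cases hx : τ.final = x ∧ b = a
      · obtain ⟨rfl, rfl⟩ := hx
        simp
      · simp [hx]
    · intro i _
      simp only [Fin.val_castSucc]
      rw [if_neg]
      omega
  · intro m hm hm' τ
    simp only [Trajectory.visit_extend_of_lt τ hm, Fin.sum_univ_castSucc, Trajectory.extend_final,
      Trajectory.extend_state, Trajectory.extend_action, Trajectory.extend_action_last]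
    have h2 : H - m = (H - (m + 1)) + 1 := by omega
    rw [h2, valueToGo]
    set c := τ.visit h x a
    simp only [Fin.val_castSucc, Fin.val_last, if_pos (show h ≤ m by omega)]
    set d := ∑ i : Fin m, if h ≤ (i : ℕ) then ℓ (τ.state i.castSucc) (τ.action i) else 0
    have h3 : ∀ b, ∑ y, P τ.final b y * (c * (d + ℓ τ.final b + valueToGo P π ℓ (H - (m + 1)) y))
        = c * (d + (ℓ τ.final b + ∑ y, P τ.final b y * valueToGo P π ℓ (H - (m + 1)) y)) := by
      intro b
      have : ∀ y, P τ.final b y * (c * (d + ℓ τ.final b + valueToGo P π ℓ (H - (m + 1)) y))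
        = P τ.final b y * (c * (d + ℓ τ.final b))
          + c * (P τ.final b y * valueToGo P π ℓ (H - (m + 1)) y) := fun y => by ring
      simp only [this, Finset.sum_add_distrib, ← Finset.sum_mul, sum_transition,
        ← Finset.mul_sum]
      ring
    simp only [h3]
    have h4 : ∀ b, π τ.final b * (c * (d + (ℓ τ.final b +
          ∑ y, P τ.final b y * valueToGo P π ℓ (H - (m + 1)) y)))
        = π τ.final b * (c * d) + c * (π τ.final b * (ℓ τ.final b +
          ∑ y, P τ.final b y * valueToGo P π ℓ (H - (m + 1)) y)) := fun b => by ring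
    simp only [h4, Finset.sum_add_distrib, ← Finset.sum_mul, sum_policy, ← Finset.mul_sum]
    ring

/-! ### Value functions are linear and monotone in the loss -/

theorem valueToGo_add (P : Transition X A) (π : Policy X A) (f g : X → A → ℝ) (n : ℕ) (x : X) :
    valueToGo P π (fun x a => f x a + g x a) n x = valueToGo P π f n x + valueToGo P π g n x := by
  induction n generalizing x with
  | zero => simp [valueToGo]
  | succ n ih =>
    simp only [valueToGo, ih, mul_add, Finset.sum_add_distrib]
    ring

theorem valueToGo_const_mul (P : Transition X A) (π : Policy X A) (c : ℝ) (f : X → A → ℝ) (n : ℕ)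
    (x : X) : valueToGo P π (fun x a => c * f x a) n x = c * valueToGo P π f n x := by
  induction n generalizing x with
  | zero => simp [valueToGo]
  | succ n ih =>
    simp only [valueToGo, ih, Finset.mul_sum]
    refine Finset.sum_congr rfl fun a _ => ?_
    rw [mul_add, mul_add, mul_add, Finset.mul_sum, Finset.mul_sum, Finset.mul_sum]
    congr 1
    · ring
    · exact Finset.sum_congr rfl fun y _ => by ring

theorem valueToGo_sub (P : Transition X A) (π : Policy X A) (f g : X → A → ℝ) (n : ℕ) (x : X) :
    valueToGo P π (fun x a => f x a - g x a) n x = valueToGo P π f n x - valueToGo P π g n x := by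
  have := valueToGo_add P π f (fun x a => -1 * g x a) n x
  rw [valueToGo_const_mul] at this
  simp only [sub_eq_add_neg]
  rw [← neg_one_mul (valueToGo P π g n x), ← this]
  simp only [neg_one_mul]

theorem valueToGo_zero_loss (P : Transition X A) (π : Policy X A) (n : ℕ) (x : X) :
    valueToGo P π (fun _ _ => 0) n x = 0 := by
  have := valueToGo_const_mul P π 0 (fun _ _ => 0) n x
  simpa using this

theorem valueToGo_sum {ι : Type*} (s : Finset ι) (P : Transition X A) (π : Policy X A)
    (f : ι → X → A → ℝ) (n : ℕ) (x : X) :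
    valueToGo P π (fun x a => ∑ i ∈ s, f i x a) n x = ∑ i ∈ s, valueToGo P π (f i) n x := by
  classical
  induction s using Finset.induction_on with
  | empty => simpa using valueToGo_zero_loss P π n x
  | insert i s hi ih =>
    simp only [Finset.sum_insert hi]
    rw [valueToGo_add, ih]

theorem valueToGo_one (P : Transition X A) (π : Policy X A) (n : ℕ) (x : X) :
    valueToGo P π (fun _ _ => 1) n x = n := by
  induction n generalizing x with
  | zero => simp [valueToGo]
  | succ n ih =>
    simp only [valueToGo, ih, ← Finset.sum_mul, sum_transition, sum_policy]
    push_cast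
    ring

theorem sum_transition_mul_le {L : Layering X H} {P : Transition X A} (hP : L.Respects P) {x : X}
    (hx : L.layer x < H) (a : A) {f g : X → ℝ} (h : ∀ y, L.layer y = L.layer x + 1 → f y ≤ g y) :
    ∑ y, P x a y * f y ≤ ∑ y, P x a y * g y := by
  refine Finset.sum_le_sum fun y _ => ?_
  by_cases hy : P x a y = 0
  · simp [hy]
  · exact mul_le_mul_of_nonneg_left (h y (hP x a y hx hy)) (transition_nonneg _ _ _ _)

theorem sum_transition_mul_congr {L : Layering X H} {P : Transition X A} (hP : L.Respects P)
    {x : X} (hx : L.layer x < H) (a : A) {f g : X → ℝ}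
    (h : ∀ y, L.layer y = L.layer x + 1 → f y = g y) :
    ∑ y, P x a y * f y = ∑ y, P x a y * g y :=
  le_antisymm (sum_transition_mul_le hP hx a fun y hy => (h y hy).le)
    (sum_transition_mul_le hP hx a fun y hy => (h y hy).ge)

theorem sum_policy_mul_le (π : Policy X A) (x : X) {f g : A → ℝ} (h : ∀ a, f a ≤ g a) :
    ∑ a, π x a * f a ≤ ∑ a, π x a * g a :=
  Finset.sum_le_sum fun a _ => mul_le_mul_of_nonneg_left (h a) (policy_nonneg _ _ _)

theorem sum_policy_mul_const (π : Policy X A) (x : X) (c : ℝ) : ∑ a, π x a * c = c := by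
  rw [← Finset.sum_mul, sum_policy, one_mul]

/-- The condition `layer x + n = H` keeps clock and layer in step, so the recursion ends before the
terminal layer is left. Hence the losses need to be compared on nonterminal layers only. -/
theorem valueToGo_mono {L : Layering X H} {P : Transition X A} (hP : L.Respects P)
    (π : Policy X A) {f g : X → A → ℝ} (h : ∀ x a, L.layer x < H → f x a ≤ g x a) (n : ℕ) (x : X)
    (hx : L.layer x + n = H) : valueToGo P π f n x ≤ valueToGo P π g n x := by
  induction n generalizing x with
  | zero => simp [valueToGo]
  | succ n ih =>
    simp only [valueToGo]
    refine sum_policy_mul_le _ _ fun a => add_le_add (h x a (by omega)) ?_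
    exact sum_transition_mul_le hP (by omega) a fun y hy => ih y (by omega)

theorem valueToGo_congr {L : Layering X H} {P : Transition X A} (hP : L.Respects P)
    (π : Policy X A) {f g : X → A → ℝ} (h : ∀ x a, L.layer x < H → f x a = g x a) (n : ℕ) (x : X)
    (hx : L.layer x + n = H) : valueToGo P π f n x = valueToGo P π g n x :=
  le_antisymm (valueToGo_mono hP π (fun x a hx => (h x a hx).le) n x hx)
    (valueToGo_mono hP π (fun x a hx => (h x a hx).ge) n x hx)

theorem valueToGo_nonneg {L : Layering X H} {P : Transition X A} (hP : L.Respects P)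
    (π : Policy X A) {f : X → A → ℝ} (h : ∀ x a, L.layer x < H → 0 ≤ f x a) (n : ℕ) (x : X)
    (hx : L.layer x + n = H) : 0 ≤ valueToGo P π f n x := by
  rw [← valueToGo_zero_loss P π n x]
  exact valueToGo_mono hP π h n x hx

theorem valueToGo_nonneg' (P : Transition X A) (π : Policy X A) {f : X → A → ℝ}
    (h : ∀ x a, 0 ≤ f x a) (n : ℕ) (x : X) : 0 ≤ valueToGo P π f n x := by
  induction n generalizing x with
  | zero => simp [valueToGo]
  | succ n ih =>
    refine Finset.sum_nonneg fun a _ => mul_nonneg (policy_nonneg _ _ _) (add_nonneg (h x a) ?_)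
    exact Finset.sum_nonneg fun y _ => mul_nonneg (transition_nonneg _ _ _ _) (ih y)

theorem valueToGo_le (P : Transition X A) (π : Policy X A) {f : X → A → ℝ} {c : ℝ}
    (h : ∀ x a, f x a ≤ c) (n : ℕ) (x : X) : valueToGo P π f n x ≤ n * c := by
  have h1 := valueToGo_nonneg' P π (f := fun x a => c * 1 - f x a)
    (fun x a => by linarith [h x a]) n x
  rw [valueToGo_sub, valueToGo_const_mul, valueToGo_one] at h1
  linarith

section Value

variable {L : Layering X H} {P : Transition X A} {π : Policy X A}

theorem value_mono (hP : L.Respects P) {f g : X → A → ℝ}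
    (h : ∀ x a, L.layer x < H → f x a ≤ g x a) : L.value P π f ≤ L.value P π g :=
  valueToGo_mono hP π h _ _ (by rw [layer_init, zero_add])

theorem value_congr (hP : L.Respects P) {f g : X → A → ℝ}
    (h : ∀ x a, L.layer x < H → f x a = g x a) : L.value P π f = L.value P π g :=
  valueToGo_congr hP π h _ _ (by rw [layer_init, zero_add])

theorem value_nonneg (hP : L.Respects P) {f : X → A → ℝ}
    (h : ∀ x a, L.layer x < H → 0 ≤ f x a) : 0 ≤ L.value P π f :=
  valueToGo_nonneg hP π h _ _ (by rw [layer_init, zero_add])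

theorem value_le_mul (hP : L.Respects P) {f : X → A → ℝ} {c : ℝ}
    (h : ∀ x a, L.layer x < H → f x a ≤ c) : L.value P π f ≤ H * c := by
  refine (value_mono hP (g := fun _ _ => c * 1) (by simpa using h)).trans_eq ?_
  rw [Layering.value, valueToGo_const_mul, valueToGo_one, mul_comm]

/-- Cauchy-Schwarz inequality for the expected total loss. -/
theorem value_sq_le (hP : L.Respects P) (hH : 1 ≤ H) (f : X → A → ℝ) :
    L.value P π f ^ 2 ≤ H * L.value P π fun x a => f x a ^ 2 := by
  set v := L.value P π f with hv
  have hH' : (0 : ℝ) < H := by exact_mod_cast hH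
  -- Variance argument: the value of `(f - v / H) ^ 2` is nonnegative, and the constant loss `1` has
  -- value `H`.
  have h1 : 0 ≤ L.value P π fun x a => f x a ^ 2 - (2 * (v / H) * f x a - (v / H) ^ 2 * 1) :=
    value_nonneg hP fun x a _ => by nlinarith [sq_nonneg (f x a - v / H)]
  simp only [Layering.value] at *
  rw [valueToGo_sub, valueToGo_sub, valueToGo_const_mul, valueToGo_const_mul, ← hv,
    valueToGo_one] at h1
  have h2 : 2 * (v / H) * v - (v / H) ^ 2 * H = v ^ 2 / H := by field_simp; ring
  rw [h2, sub_nonneg, div_le_iff₀ hH'] at h1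
  linarith

end Value

/-! ### Occupancy measures -/

theorem stepOcc_nonneg (L : Layering X H) (P : Transition X A) (π : Policy X A) (n : ℕ) (x : X) :
    0 ≤ L.stepOcc P π n x := by
  classical
  rw [stepOcc_eq_expect]
  refine (expect_const (trajectoryLaw P π L.init n) 0).symm.trans_le (expect_mono _ fun τ _ => ?_)
  split_ifs <;> simp

theorem stepOcc_le_one (L : Layering X H) (P : Transition X A) (π : Policy X A) (n : ℕ) (x : X) :
    L.stepOcc P π n x ≤ 1 := by
  classical
  rw [stepOcc_eq_expect]
  refine (expect_mono _ fun τ _ => ?_).trans_eq (expect_const (trajectoryLaw P π L.init n) 1)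
  split_ifs <;> simp

theorem stepOcc_eq_zero {L : Layering X H} {P : Transition X A} (hP : L.Respects P)
    (π : Policy X A) {n : ℕ} (hn : n ≤ H) {x : X} (hx : L.layer x ≠ n) :
    L.stepOcc P π n x = 0 := by
  classical
  rw [stepOcc_eq_expect]
  refine (expect_congr _ fun τ hτ => if_neg ?_).trans (expect_const _ 0)
  rintro rfl
  exact hx (follows_of_mem_support hP hn hτ (Fin.last n))

theorem occ_nonneg (L : Layering X H) (P : Transition X A) (π : Policy X A) (x : X) (a : A) :
    0 ≤ L.occ P π x a :=
  mul_nonneg (stepOcc_nonneg _ _ _ _ _) (policy_nonneg _ _ _)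

theorem occ_le_one (L : Layering X H) (P : Transition X A) (π : Policy X A) (x : X) (a : A) :
    L.occ P π x a ≤ 1 :=
  mul_le_one₀ (stepOcc_le_one _ _ _ _ _) (policy_nonneg _ _ _) (policy_le_one _ _ _)

theorem sum_stepOcc_mul_valueToGo (L : Layering X H) (P : Transition X A) (π : Policy X A)
    (f : X → A → ℝ) (m n : ℕ) :
    ∑ x, L.stepOcc P π m x * valueToGo P π f n x
      = ∑ i ∈ range n, ∑ x, ∑ a, L.stepOcc P π (m + i) x * π x a * f x a := by
  induction n generalizing m with
  | zero => simp [valueToGo]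
  | succ n ih =>
    rw [Finset.sum_range_succ']
    have h1 : ∑ i ∈ range n, ∑ x, ∑ a, L.stepOcc P π (m + (i + 1)) x * π x a * f x a
        = ∑ x, L.stepOcc P π (m + 1) x * valueToGo P π f n x := by
      rw [ih (m + 1)]
      refine Finset.sum_congr rfl fun i _ => ?_
      rw [show m + (i + 1) = m + 1 + i by omega]
    rw [h1, add_zero]
    have h2 : ∀ x, L.stepOcc P π m x * valueToGo P π f (n + 1) x
        = (∑ y, (∑ a, L.stepOcc P π m x * π x a * P x a y) * valueToGo P π f n y)
          + ∑ a, L.stepOcc P π m x * π x a * f x a := by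
      intro x
      simp only [valueToGo, mul_add, Finset.sum_add_distrib, Finset.mul_sum, Finset.sum_mul]
      rw [add_comm, Finset.sum_comm]
      congr 1
      · exact Finset.sum_congr rfl fun _ _ => Finset.sum_congr rfl fun _ _ => by ring
      · exact Finset.sum_congr rfl fun _ _ => by ring
    simp only [h2, Finset.sum_add_distrib]
    congr 1
    rw [Finset.sum_comm]
    refine Finset.sum_congr rfl fun y _ => ?_
    rw [← Finset.sum_mul]
    rfl

/-- In the double sum over steps and states only the step equal to the layer of the state survives.
-/
theorem value_eq_sum_occ {L : Layering X H} {P : Transition X A} (hP : L.Respects P)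
    (π : Policy X A) (f : X → A → ℝ) :
    L.value P π f = ∑ x with L.layer x < H, ∑ a, L.occ P π x a * f x a := by
  classical
  have h1 : L.value P π f = ∑ x, L.stepOcc P π 0 x * valueToGo P π f H x := by
    simp [Layering.stepOcc, Layering.value]
  rw [h1, sum_stepOcc_mul_valueToGo, Finset.sum_comm, Finset.sum_filter]
  refine Finset.sum_congr rfl fun x _ => ?_
  simp only [zero_add]
  split_ifs with hx
  · rw [Finset.sum_eq_single (L.layer x)]
    · rfl
    · intro i hi hne
      rw [Finset.mem_range] at hi
      simp [stepOcc_eq_zero hP π hi.le (Ne.symm hne)]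
    · simp [hx]
  · refine Finset.sum_eq_zero fun i hi => ?_
    rw [Finset.mem_range] at hi
    simp [stepOcc_eq_zero hP π hi.le (show L.layer x ≠ i by omega)]

theorem sum_occ (L : Layering X H) (P : Transition X A) (π : Policy X A) (x : X) (c : ℝ) :
    ∑ a, L.occ P π x a * c = L.stepOcc P π (L.layer x) x * c := by
  simp only [Layering.occ]
  rw [← Finset.sum_mul, ← Finset.mul_sum, sum_policy, mul_one]

/-! ### The performance difference lemma -/

/-- `Q^π(x,a)`. -/
def Layering.qValue (L : Layering X H) (P : Transition X A) (π : Policy X A) (ℓ : X → A → ℝ)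
    (x : X) (a : A) : ℝ :=
  ℓ x a + ∑ y, P x a y * valueToGo P π ℓ (H - (L.layer x + 1)) y

theorem qValue_nonneg (L : Layering X H) (P : Transition X A) (π : Policy X A) {ℓ : X → A → ℝ}
    (hℓ : ∀ x a, 0 ≤ ℓ x a) (x : X) (a : A) : 0 ≤ L.qValue P π ℓ x a :=
  add_nonneg (hℓ x a) (Finset.sum_nonneg fun _ _ => mul_nonneg (transition_nonneg _ _ _ _)
    (valueToGo_nonneg' P π hℓ _ _))

theorem qValue_le {L : Layering X H} (P : Transition X A) (π : Policy X A) {ℓ : X → A → ℝ}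
    (hℓ : ∀ x a, ℓ x a ≤ 1) {x : X} (hx : L.layer x < H) (a : A) : L.qValue P π ℓ x a ≤ H := by
  have h1 : ∑ y, P x a y * valueToGo P π ℓ (H - (L.layer x + 1)) y
      ≤ ∑ y, P x a y * ((H - (L.layer x + 1) : ℕ) * 1 : ℝ) :=
    Finset.sum_le_sum fun y _ => mul_le_mul_of_nonneg_left (valueToGo_le P π hℓ _ _)
      (transition_nonneg _ _ _ _)
  rw [← Finset.sum_mul, sum_transition, one_mul, mul_one] at h1
  have h2 : ((H - (L.layer x + 1) : ℕ) : ℝ) + 1 ≤ H := by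
    exact_mod_cast (show H - (L.layer x + 1) + 1 ≤ H by omega)
  have := hℓ x a
  unfold Layering.qValue
  linarith

/-- Backward induction: changing the policy at the first step only produces the sum on the right,
and the remaining difference is carried to the successor, which is reached with `π'`. -/
theorem valueToGo_sub_valueToGo {L : Layering X H} {P : Transition X A} (hP : L.Respects P)
    (π π' : Policy X A) (ℓ : X → A → ℝ) (n : ℕ) (x : X) (hx : L.layer x + n = H) :
    valueToGo P π ℓ n x - valueToGo P π' ℓ n x
      = valueToGo P π' (fun x _ => ∑ a, (π x a - π' x a) * L.qValue P π ℓ x a) n x := by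
  induction n generalizing x with
  | zero => simp [valueToGo]
  | succ n ih =>
    have hn : H - (L.layer x + 1) = n := by omega
    have h1 : valueToGo P π ℓ (n + 1) x = ∑ a, π x a * L.qValue P π ℓ x a := by
      simp only [valueToGo, Layering.qValue, hn]
    have h2 : ∀ a, ∑ y, P x a y *
        valueToGo P π' (fun x _ => ∑ a, (π x a - π' x a) * L.qValue P π ℓ x a) n y
        = L.qValue P π ℓ x a - (ℓ x a + ∑ y, P x a y * valueToGo P π' ℓ n y) := by
      intro a
      rw [← sum_transition_mul_congr hP (by omega) a fun y hy => ih y (by omega)]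
      simp only [mul_sub, Finset.sum_sub_distrib, Layering.qValue, hn]
      ring
    rw [h1, valueToGo, valueToGo]
    simp only [h2]
    set D := ∑ a, (π x a - π' x a) * L.qValue P π ℓ x a with hD
    rw [Finset.sum_congr rfl fun a _ => mul_add (π' x a) D _, Finset.sum_add_distrib,
      sum_policy_mul_const, hD, ← Finset.sum_sub_distrib, ← Finset.sum_add_distrib]
    exact Finset.sum_congr rfl fun a _ => by ring

theorem value_sub_value {L : Layering X H} {P : Transition X A} (hP : L.Respects P)
    (π π' : Policy X A) (ℓ : X → A → ℝ) :
    L.value P π ℓ - L.value P π' ℓ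
      = L.value P π' fun x _ => ∑ a, (π x a - π' x a) * L.qValue P π ℓ x a :=
  valueToGo_sub_valueToGo hP π π' ℓ _ _ (by rw [layer_init, zero_add])

/-! ### Perturbation of the transition function -/

/-- Layers increase along an episode, so a state of an earlier layer is never met again. -/
theorem valueToGo_indicator_eq_zero [DecidableEq X] {L : Layering X H} {P : Transition X A}
    (hP : L.Respects P) (π : Policy X A) (x : X) (n : ℕ) (y : X) (hy : L.layer y + n = H)
    (hxy : L.layer x < L.layer y) :
    valueToGo P π (fun z _ => if z = x then 1 else 0) n y = 0 := by
  induction n generalizing y with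
  | zero => rfl
  | succ n ih =>
    rw [valueToGo]
    refine Finset.sum_eq_zero fun a _ => ?_
    rw [if_neg (by rintro rfl; omega), sum_transition_mul_congr hP (by omega) a
      (g := fun _ => 0) fun z hz => ih z (by omega) (by omega)]
    simp

theorem valueToGo_indicator_le_one [DecidableEq X] {L : Layering X H} {P : Transition X A}
    (hP : L.Respects P) (π : Policy X A) (x : X) (n : ℕ) (y : X) (hy : L.layer y + n = H) :
    valueToGo P π (fun z _ => if z = x then 1 else 0) n y ≤ 1 := by
  induction n generalizing y with
  | zero => simp [valueToGo]
  | succ n ih =>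
    rw [valueToGo]
    refine (sum_policy_mul_le _ _ fun a => ?_).trans_eq (sum_policy_mul_const π y 1)
    split_ifs with hxy
    · rw [sum_transition_mul_congr hP (x := y) (by omega) a (g := fun _ => 0) fun z hz =>
        valueToGo_indicator_eq_zero hP π x n z (by omega) (by subst hxy; omega)]
      simp
    · rw [zero_add]
      refine (sum_transition_mul_le hP (x := y) (by omega) a (g := fun _ => 1) fun z hz =>
        ih z (by omega)).trans_eq ?_
      simp

/-- Probability of reaching `x`, as a value function. -/
theorem stepOcc_eq_value [DecidableEq X] {L : Layering X H} {P : Transition X A}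
    (hP : L.Respects P) (π : Policy X A) {x : X} (hx : L.layer x < H) :
    L.stepOcc P π (L.layer x) x = L.value P π fun z _ => if z = x then 1 else 0 := by
  rw [value_eq_sum_occ hP]
  simp only [sum_occ]
  rw [Finset.sum_eq_single x]
  · simp
  · intro y _ hy
    simp [hy]
  · intro h
    simp [hx] at h

theorem one_add_inv_pow_le (hH : 1 ≤ H) {n : ℕ} (hn : n ≤ H) : (1 + 1 / (H : ℝ)) ^ n ≤ 3 := by
  have hH' : (0 : ℝ) < H := by exact_mod_cast hH
  have h1 : 1 + 1 / (H : ℝ) ≤ Real.exp (1 / H) := by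
    linarith [Real.add_one_le_exp (1 / (H : ℝ))]
  calc (1 + 1 / (H : ℝ)) ^ n ≤ (1 + 1 / (H : ℝ)) ^ H :=
        pow_le_pow_right₀ (by have : 0 ≤ 1 / (H : ℝ) := by positivity
                              linarith) hn
    _ ≤ Real.exp (1 / H) ^ H := pow_le_pow_left₀ (by positivity) h1 H
    _ = Real.exp 1 := by rw [← Real.exp_nat_mul, mul_one_div_cancel hH'.ne']
    _ ≤ 3 := by linarith [Real.exp_one_lt_d9]

/-- With u, u' the probabilities of reaching `x`, one step reads P'u' - Pu = (P' - P)u + (P' - P)(u'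
- u) + P(u' - u). The middle term is of second order; `hβ`, applied to d = |u' - u|, turns it into
(1/H) P|u' - u| + β. Each step therefore multiplies the error by 1 + 1/H only, and what accumulates
under `P` is `ε` weighted by the true u, plus `β`. Keeping the weight u matters: summed over `x` it
is at most `H`. -/
theorem abs_valueToGo_indicator_sub_le [DecidableEq X] {L : Layering X H} {P P' : Transition X A}
    (hP : L.Respects P) (hP' : L.Respects P') (π : Policy X A)
    {ε : X → A → X → ℝ} {β : X → A → ℝ}
    (hε : ∀ y a z, L.layer y < H → |P' y a z - P y a z| ≤ ε y a z)
    (hβ : ∀ y a (d : X → ℝ), L.layer y < H → (∀ z, L.layer z = L.layer y + 1 → 0 ≤ d z ∧ d z ≤ 1) →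
      ∑ z, ε y a z * d z ≤ 1 / H * ∑ z, P y a z * d z + β y a)
    (x : X) (n : ℕ) (y : X) (hy : L.layer y + n = H) :
    |valueToGo P' π (fun z _ => if z = x then 1 else 0) n y
        - valueToGo P π (fun z _ => if z = x then 1 else 0) n y|
      ≤ (1 + 1 / (H : ℝ)) ^ n * valueToGo P π (fun y a => (∑ z, ε y a z *
        valueToGo P π (fun z _ => if z = x then 1 else 0) (H - (L.layer y + 1)) z) + β y a) n y := by
  set r : X → A → ℝ := fun z _ => if z = x then 1 else 0 with hr
  have hr0 : ∀ x a, 0 ≤ r x a := fun x a => by simp only [hr]; split_ifs <;> simp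
  set G : X → A → ℝ := fun y a =>
    (∑ z, ε y a z * valueToGo P π r (H - (L.layer y + 1)) z) + β y a with hG
  have hβ0 : ∀ y a, L.layer y < H → 0 ≤ β y a := by
    intro y a hy
    simpa using hβ y a (fun _ => 0) hy (by simp)
  have hG0 : ∀ y a, L.layer y < H → 0 ≤ G y a := by
    intro y a hy
    refine add_nonneg (Finset.sum_nonneg fun z _ => mul_nonneg ?_ (valueToGo_nonneg' P π hr0 _ _))
      (hβ0 y a hy)
    exact (abs_nonneg _).trans (hε y a z hy)
  induction n generalizing y with
  | zero => simp [valueToGo]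
  | succ n ih =>
    have hn : H - (L.layer y + 1) = n := by omega
    have hyH : L.layer y < H := by omega
    set u' := valueToGo P' π r n with hu'
    set u := valueToGo P π r n with hu
    have h1 : valueToGo P' π r (n + 1) y - valueToGo P π r (n + 1) y
        = ∑ a, π y a * (∑ z, (P' y a z - P y a z) * u z
          + ∑ z, (P' y a z - P y a z) * (u' z - u z) + ∑ z, P y a z * (u' z - u z)) := by
      simp only [valueToGo, ← hu, ← hu']
      rw [← Finset.sum_sub_distrib]
      refine Finset.sum_congr rfl fun a _ => ?_
      rw [← mul_sub, ← Finset.sum_add_distrib, ← Finset.sum_add_distrib, add_sub_add_left_eq_sub,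
        ← Finset.sum_sub_distrib]
      congr 1
      exact Finset.sum_congr rfl fun z _ => by ring
    have hd : ∀ z, L.layer z = L.layer y + 1 → 0 ≤ |u' z - u z| ∧ |u' z - u z| ≤ 1 := by
      intro z hz
      refine ⟨abs_nonneg _, abs_le.2 ?_⟩
      have a1 := valueToGo_indicator_le_one hP π x n z (by omega)
      have a2 := valueToGo_indicator_le_one hP' π x n z (by omega)
      have a3 := valueToGo_nonneg' P π hr0 n z
      have a4 := valueToGo_nonneg' P' π hr0 n z
      constructor <;> linarith
    have hW0 : ∀ z, L.layer z = L.layer y + 1 → 0 ≤ valueToGo P π G n z := fun z hz =>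
      valueToGo_nonneg hP π hG0 n z (by omega)
    have hc : (1 : ℝ) ≤ (1 + 1 / (H : ℝ)) ^ n := one_le_pow₀ (by
      have : (0 : ℝ) ≤ 1 / H := by positivity
      linarith)
    have h2 : ∀ a, |∑ z, (P' y a z - P y a z) * u z
          + ∑ z, (P' y a z - P y a z) * (u' z - u z) + ∑ z, P y a z * (u' z - u z)|
        ≤ (1 + 1 / (H : ℝ)) ^ (n + 1) * (G y a + ∑ z, P y a z * valueToGo P π G n z) := by
      intro a
      have b1 : |∑ z, (P' y a z - P y a z) * u z| ≤ ∑ z, ε y a z * u z := by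
        refine (Finset.abs_sum_le_sum_abs _ _).trans (Finset.sum_le_sum fun z _ => ?_)
        rw [abs_mul, abs_of_nonneg (valueToGo_nonneg' P π hr0 n z)]
        exact mul_le_mul_of_nonneg_right (hε y a z hyH) (valueToGo_nonneg' P π hr0 n z)
      have b2 : |∑ z, (P' y a z - P y a z) * (u' z - u z)| ≤ ∑ z, ε y a z * |u' z - u z| := by
        refine (Finset.abs_sum_le_sum_abs _ _).trans (Finset.sum_le_sum fun z _ => ?_)
        rw [abs_mul]
        exact mul_le_mul_of_nonneg_right (hε y a z hyH) (abs_nonneg _)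
      have b3 : |∑ z, P y a z * (u' z - u z)| ≤ ∑ z, P y a z * |u' z - u z| := by
        refine (Finset.abs_sum_le_sum_abs _ _).trans (Finset.sum_le_sum fun z _ => ?_)
        rw [abs_mul, abs_of_nonneg (transition_nonneg P y a z)]
      have b4 := hβ y a (fun z => |u' z - u z|) hyH hd
      have b5 : ∑ z, P y a z * |u' z - u z|
          ≤ (1 + 1 / (H : ℝ)) ^ n * ∑ z, P y a z * valueToGo P π G n z := by
        rw [Finset.mul_sum]
        refine (sum_transition_mul_le hP hyH a (g := fun z => (1 + 1 / (H : ℝ)) ^ n *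
          valueToGo P π G n z) fun z hz => ih z (by omega)).trans_eq ?_
        exact Finset.sum_congr rfl fun z _ => by ring
      have b6 : G y a = ∑ z, ε y a z * u z + β y a := by simp only [hG, hn, hu]
      have b7 := abs_add_three (∑ z, (P' y a z - P y a z) * u z)
        (∑ z, (P' y a z - P y a z) * (u' z - u z)) (∑ z, P y a z * (u' z - u z))
      have hH0 : (0 : ℝ) ≤ 1 / H := by positivity
      have b8 : G y a ≤ (1 + 1 / (H : ℝ)) ^ (n + 1) * G y a := by
        refine le_mul_of_one_le_left (hG0 y a hyH) (one_le_pow₀ (by linarith))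
      have b9 : (1 + 1 / (H : ℝ)) * ∑ z, P y a z * |u' z - u z|
          ≤ (1 + 1 / (H : ℝ)) ^ (n + 1) * ∑ z, P y a z * valueToGo P π G n z := by
        rw [pow_succ', mul_assoc]
        exact mul_le_mul_of_nonneg_left b5 (by linarith)
      rw [mul_add]
      linarith
    rw [h1, valueToGo, Finset.mul_sum]
    refine (Finset.abs_sum_le_sum_abs _ _).trans (Finset.sum_le_sum fun a _ => ?_)
    rw [abs_mul, abs_of_nonneg (policy_nonneg π y a)]
    calc _ ≤ π y a * ((1 + 1 / (H : ℝ)) ^ (n + 1) *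
          (G y a + ∑ z, P y a z * valueToGo P π G n z)) :=
          mul_le_mul_of_nonneg_left (h2 a) (policy_nonneg π y a)
      _ = _ := by ring

/-! ### Upper and lower occupancy bounds -/

theorem bddAbove_occ (L : Layering X H) (K : Set (Transition X A)) (π : Policy X A) (x : X)
    (a : A) : BddAbove ((fun P => L.occ P π x a) '' K) :=
  ⟨1, by rintro _ ⟨P, _, rfl⟩; exact occ_le_one _ _ _ _ _⟩

theorem bddBelow_occ (L : Layering X H) (K : Set (Transition X A)) (π : Policy X A) (x : X)
    (a : A) : BddBelow ((fun P => L.occ P π x a) '' K) :=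
  ⟨0, by rintro _ ⟨P, _, rfl⟩; exact occ_nonneg _ _ _ _ _⟩

theorem occ_le_upperOcc (L : Layering X H) {K : Set (Transition X A)} {P : Transition X A}
    (hP : P ∈ K) (π : Policy X A) (x : X) (a : A) : L.occ P π x a ≤ L.upperOcc K π x a :=
  le_csSup (bddAbove_occ L K π x a) ⟨P, hP, rfl⟩

theorem lowerOcc_le_occ (L : Layering X H) {K : Set (Transition X A)} {P : Transition X A}
    (hP : P ∈ K) (π : Policy X A) (x : X) (a : A) : L.lowerOcc K π x a ≤ L.occ P π x a :=
  csInf_le (bddBelow_occ L K π x a) ⟨P, hP, rfl⟩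

theorem upperOcc_nonneg (L : Layering X H) (K : Set (Transition X A)) (π : Policy X A) (x : X)
    (a : A) : 0 ≤ L.upperOcc K π x a :=
  Real.sSup_nonneg (by rintro _ ⟨P, _, rfl⟩; exact occ_nonneg _ _ _ _ _)

theorem lowerOcc_nonneg (L : Layering X H) (K : Set (Transition X A)) (π : Policy X A) (x : X)
    (a : A) : 0 ≤ L.lowerOcc K π x a :=
  Real.sInf_nonneg (by rintro _ ⟨P, _, rfl⟩; exact occ_nonneg _ _ _ _ _)

theorem upperOcc_sub_lowerOcc_le (L : Layering X H) {K : Set (Transition X A)}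
    (hK : K.Nonempty) (π : Policy X A) (x : X) (a : A) {q c : ℝ}
    (h : ∀ P ∈ K, |L.occ P π x a - q| ≤ c) : L.upperOcc K π x a - L.lowerOcc K π x a ≤ 2 * c := by
  have h1 : L.upperOcc K π x a ≤ q + c := by
    refine csSup_le (hK.image _) ?_
    rintro _ ⟨P, hP, rfl⟩
    linarith [(abs_le.1 (h P hP)).2]
  have h2 : q - c ≤ L.lowerOcc K π x a := by
    refine le_csInf (hK.image _) ?_
    rintro _ ⟨P, hP, rfl⟩
    linarith [(abs_le.1 (h P hP)).1]
  linarith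

/-! ### Dilated bonuses -/

section Dilated

variable {L : Layering X H} {K : Set (Transition X A)} {γ : ℝ} {π : Policy X A}

theorem lowerOcc_le_upperOcc (hK : K.Nonempty) (x : X) (a : A) :
    L.lowerOcc K π x a ≤ L.upperOcc K π x a :=
  (lowerOcc_le_occ L hK.some_mem π x a).trans (occ_le_upperOcc L hK.some_mem π x a)

theorem bonus_numerator_nonneg (hK : K.Nonempty) (hγ : 0 < γ) (x : X) (a : A) :
    0 ≤ 3 * γ * H + H * (L.upperOcc K π x a - L.lowerOcc K π x a) := by
  have := sub_nonneg.2 (lowerOcc_le_upperOcc (L := L) (π := π) hK x a)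
  positivity

theorem upperOcc_add_pos (hγ : 0 < γ) (x : X) (a : A) : 0 < L.upperOcc K π x a + γ :=
  add_pos_of_nonneg_of_pos (upperOcc_nonneg L K π x a) hγ

theorem bonus_nonneg (hK : K.Nonempty) (hγ : 0 < γ) (x : X) : 0 ≤ L.bonus γ K π x :=
  Finset.sum_nonneg fun a _ => mul_nonneg (policy_nonneg _ _ _)
    (div_nonneg (bonus_numerator_nonneg hK hγ x a) (upperOcc_add_pos hγ x a).le)

theorem bonus_le (hγ : 0 < γ) (x : X) : L.bonus γ K π x ≤ 4 * H := by
  rw [← sum_policy_mul_const π x (4 * H : ℝ)]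
  refine sum_policy_mul_le _ _ fun a => ?_
  rw [div_le_iff₀ (upperOcc_add_pos hγ x a)]
  have h1 := lowerOcc_nonneg L K π x a
  have h2 := upperOcc_nonneg L K π x a
  have hH : (0 : ℝ) ≤ H := by positivity
  nlinarith [mul_nonneg hH h1, mul_nonneg hH h2, mul_nonneg hH hγ.le]

theorem bddAbove_transition_sum (K : Set (Transition X A)) (x : X) (a : A) (f : X → ℝ) :
    BddAbove ((fun P : Transition X A => ∑ y, P x a y * f y) '' K) := by
  refine ⟨∑ y, |f y|, ?_⟩
  rintro _ ⟨P, _, rfl⟩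
  refine Finset.sum_le_sum fun y _ => ?_
  calc P x a y * f y ≤ P x a y * |f y| :=
        mul_le_mul_of_nonneg_left (le_abs_self _) (transition_nonneg _ _ _ _)
    _ ≤ |f y| := mul_le_of_le_one_left (abs_nonneg _) (transition_le_one _ _ _ _)

theorem one_add_inv_nonneg (H : ℕ) : (0 : ℝ) ≤ 1 + 1 / (H : ℝ) := by positivity

theorem bonus_add_le_dilatedToGo {P : Transition X A} (hP : P ∈ K) (n : ℕ) (x : X) (a : A) :
    L.bonus γ K π x + (1 + 1 / (H : ℝ)) *
      ∑ y, P x a y * ∑ a', π y a' * L.dilatedToGo γ K π n y a'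
      ≤ L.dilatedToGo γ K π (n + 1) x a := by
  rw [Layering.dilatedToGo]
  gcongr
  exact le_csSup (bddAbove_transition_sum K x a _) ⟨P, hP, rfl⟩

theorem dilatedToGo_nonneg (hK : K.Nonempty) (hγ : 0 < γ) (n : ℕ) (x : X) (a : A) :
    0 ≤ L.dilatedToGo γ K π n x a := by
  induction n generalizing x a with
  | zero => exact le_rfl
  | succ n ih =>
    refine le_trans ?_ (bonus_add_le_dilatedToGo hK.some_mem n x a)
    refine add_nonneg (bonus_nonneg hK hγ x) (mul_nonneg (one_add_inv_nonneg H) ?_)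
    exact Finset.sum_nonneg fun y _ => mul_nonneg (transition_nonneg _ _ _ _)
      (Finset.sum_nonneg fun b _ => mul_nonneg (policy_nonneg _ _ _) (ih y b))

theorem dilatedToGo_le (hK : K.Nonempty) (hγ : 0 < γ) (n : ℕ) (x : X) (a : A) :
    L.dilatedToGo γ K π n x a ≤ (1 + 1 / (H : ℝ)) ^ n * (n * (4 * H)) := by
  induction n generalizing x a with
  | zero => simp [Layering.dilatedToGo]
  | succ n ih =>
    rw [Layering.dilatedToGo]
    have h1 : sSup ((fun P : Transition X A =>
        ∑ x', P x a x' * ∑ a', π x' a' * L.dilatedToGo γ K π n x' a') '' K)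
        ≤ (1 + 1 / (H : ℝ)) ^ n * (n * (4 * H)) := by
      refine csSup_le (hK.image _) ?_
      rintro _ ⟨P, _, rfl⟩
      calc _ ≤ ∑ y, P x a y * ((1 + 1 / (H : ℝ)) ^ n * (n * (4 * H))) := by
            refine Finset.sum_le_sum fun y _ => mul_le_mul_of_nonneg_left ?_
              (transition_nonneg _ _ _ _)
            exact (sum_policy_mul_le π y fun b => ih y b).trans_eq (sum_policy_mul_const _ _ _)
        _ = _ := by rw [← Finset.sum_mul, sum_transition, one_mul]
    have h2 := bonus_le (L := L) (K := K) (π := π) hγ x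
    have h3 := mul_le_mul_of_nonneg_left h1 (one_add_inv_nonneg H)
    have h4 : (1 : ℝ) ≤ (1 + 1 / (H : ℝ)) ^ (n + 1) := one_le_pow₀ (by
      have : (0 : ℝ) ≤ 1 / H := by positivity
      linarith)
    have h5 : (4 * H : ℝ) ≤ (1 + 1 / (H : ℝ)) ^ (n + 1) * (4 * H) :=
      le_mul_of_one_le_left (by positivity) h4
    calc _ ≤ (1 + 1 / (H : ℝ)) ^ (n + 1) * (4 * H)
          + (1 + 1 / (H : ℝ)) * ((1 + 1 / (H : ℝ)) ^ n * (n * (4 * H))) := by linarith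
      _ = _ := by rw [pow_succ]; push_cast; ring

theorem dilatedBonus_nonneg (hK : K.Nonempty) (hγ : 0 < γ) (x : X) (a : A) :
    0 ≤ L.dilatedBonus γ K π x a :=
  dilatedToGo_nonneg hK hγ _ x a

/-- At most `4 * H` per step, over at most `H` steps, with total dilation at most 3. -/
theorem dilatedBonus_le (hH : 1 ≤ H) (hK : K.Nonempty) (hγ : 0 < γ) (x : X) (a : A) :
    L.dilatedBonus γ K π x a ≤ 12 * (H : ℝ) ^ 2 := by
  refine (dilatedToGo_le hK hγ _ x a).trans ?_
  have h1 := one_add_inv_pow_le hH (Nat.sub_le H (L.layer x))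
  have h2 : ((H - L.layer x : ℕ) : ℝ) ≤ H := by exact_mod_cast Nat.sub_le _ _
  calc _ ≤ 3 * ((H : ℝ) * (4 * H)) := by gcongr
    _ = _ := by ring

/-- The dilated Bellman inequality under the comparator policy `π'`. -/
theorem value_dilated_le {P : Transition X A} (hP : L.Respects P) (hPK : P ∈ K)
    (π' : Policy X A) :
    (L.value P π' fun x _ => L.bonus γ K π x
        + (1 + 1 / (H : ℝ)) * (∑ a, π x a * L.dilatedBonus γ K π x a)
        - ∑ a, π' x a * L.dilatedBonus γ K π x a)
      ≤ (1 + 1 / (H : ℝ)) * ∑ a, π L.init a * L.dilatedBonus γ K π L.init a := by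
  have key : ∀ n x, L.layer x + n = H →
      valueToGo P π' (fun x _ => L.bonus γ K π x
        + (1 + 1 / (H : ℝ)) * (∑ a, π x a * L.dilatedBonus γ K π x a)
        - ∑ a, π' x a * L.dilatedBonus γ K π x a) n x
      ≤ (1 + 1 / (H : ℝ)) * ∑ a, π x a * L.dilatedBonus γ K π x a := by
    intro n
    induction n with
    | zero =>
      intro x hx
      have : H - L.layer x = 0 := by omega
      simp [valueToGo, Layering.dilatedBonus, this, Layering.dilatedToGo]
    | succ n ih =>
      intro x hx
      set W : X → ℝ := fun y => ∑ a, π y a * L.dilatedBonus γ K π y a with hW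
      rw [valueToGo]
      set D := L.bonus γ K π x + (1 + 1 / (H : ℝ)) * W x
        - ∑ a, π' x a * L.dilatedBonus γ K π x a with hD
      -- Optimism: the true `P` belongs to `K`, so the supremum defining `B` dominates the average
      -- under `P`. Averaged over `π'`, the terms with `b` and with `π' B` then cancel those in `D`.
      have h1 : ∀ a, ∑ y, P x a y * valueToGo P π' (fun x _ => L.bonus γ K π x
          + (1 + 1 / (H : ℝ)) * W x - ∑ a, π' x a * L.dilatedBonus γ K π x a) n y
          ≤ L.dilatedBonus γ K π x a - L.bonus γ K π x := by
        intro a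
        have h2 := sum_transition_mul_le hP (x := x) (by omega) a fun y hy => ih y (by omega)
        have h3 := bonus_add_le_dilatedToGo (L := L) (γ := γ) (π := π) hPK n x a
        have h4 : L.dilatedBonus γ K π x a = L.dilatedToGo γ K π (n + 1) x a := by
          rw [Layering.dilatedBonus, show H - L.layer x = n + 1 by omega]
        rw [h4]
        have h5 : ∑ y, P x a y * ((1 + 1 / (H : ℝ)) * W y)
            = (1 + 1 / (H : ℝ)) * ∑ y, P x a y * ∑ a', π y a' * L.dilatedToGo γ K π n y a' := by
          rw [Finset.mul_sum]
          have : ∑ y, P x a y * ((1 + 1 / (H : ℝ)) * W y) = ∑ y, P x a y * ((1 + 1 / (H : ℝ)) *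
              ∑ a', π y a' * L.dilatedToGo γ K π n y a') := by
            refine sum_transition_mul_congr hP (by omega) a fun y hy => ?_
            simp only [hW, Layering.dilatedBonus, show H - L.layer y = n by omega]
          rw [this]
          exact Finset.sum_congr rfl fun y _ => by ring
        rw [h5] at h2
        linarith
      calc _ ≤ ∑ a, π' x a * (D + (L.dilatedBonus γ K π x a - L.bonus γ K π x)) :=
            sum_policy_mul_le _ _ fun a => by linarith [h1 a]
        _ = D + (∑ a, π' x a * L.dilatedBonus γ K π x a - L.bonus γ K π x) := by
            simp only [mul_add, mul_sub, Finset.sum_add_distrib, Finset.sum_sub_distrib,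
              sum_policy_mul_const]
        _ = _ := by rw [hD]; ring
  exact key H L.init (by rw [layer_init, zero_add])

/-- Compactness gives a maximizer for each pair separately; `hrect` says that `K` is a product over
pairs, so these can be glued into a single member of `K`. -/
theorem exists_greedy_transition (hK : IsCompact K) (hne : K.Nonempty)
    (hrect : ∀ F : X → A → Transition X A, (∀ x a, F x a ∈ K) → (fun x a => F x a x a) ∈ K)
    (f : X → X → ℝ) :
    ∃ P ∈ K, ∀ x a, sSup ((fun P : Transition X A => ∑ y, P x a y * f x y) '' K)
      = ∑ y, P x a y * f x y := by
  have h : ∀ x a, ∃ P ∈ K, sSup ((fun P : Transition X A => ∑ y, P x a y * f x y) '' K)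
      = ∑ y, P x a y * f x y := by
    intro x a
    refine hK.exists_sSup_image_eq hne (Continuous.continuousOn ?_)
    refine continuous_finsetSum _ fun y _ => Continuous.mul ?_ continuous_const
    have h1 : Continuous fun P : Transition X A => (P x a : X → ℝ) :=
      continuous_subtype_val.comp ((continuous_apply a).comp (continuous_apply x))
    exact (continuous_apply y).comp h1
  choose F hF hF' using h
  exact ⟨fun x a => F x a x a, hrect F hF, fun x a => hF' x a⟩

/-- Unrolling the dilated bonuses along a greedy transition function. -/
theorem exists_dilated_le_value (hH : 1 ≤ H) (hγ : 0 < γ) (hK : IsCompact K) (hne : K.Nonempty)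
    (hresp : ∀ P ∈ K, L.Respects P)
    (hrect : ∀ F : X → A → Transition X A, (∀ x a, F x a ∈ K) → (fun x a => F x a x a) ∈ K) :
    ∃ P ∈ K, ∑ a, π L.init a * L.dilatedBonus γ K π L.init a
      ≤ 3 * L.value P π fun x _ => L.bonus γ K π x := by
  obtain ⟨P, hP, hPs⟩ := exists_greedy_transition hK hne hrect fun x y =>
    ∑ a', π y a' * L.dilatedToGo γ K π (H - (L.layer x + 1)) y a'
  refine ⟨P, hP, ?_⟩
  have key : ∀ n x, L.layer x + n = H → ∑ a, π x a * L.dilatedToGo γ K π n x a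
      ≤ (1 + 1 / (H : ℝ)) ^ n * valueToGo P π (fun x _ => L.bonus γ K π x) n x := by
    intro n
    induction n with
    | zero =>
      intro x _
      simp [valueToGo, Layering.dilatedToGo]
    | succ n ih =>
      intro x hx
      rw [valueToGo, Finset.mul_sum]
      refine Finset.sum_le_sum fun a _ => ?_
      rw [mul_left_comm]
      refine mul_le_mul_of_nonneg_left ?_ (policy_nonneg _ _ _)
      have h1 := hPs x a
      simp only [show H - (L.layer x + 1) = n by omega] at h1
      rw [Layering.dilatedToGo, h1, mul_add]
      refine add_le_add ?_ ?_
      · refine le_mul_of_one_le_left (bonus_nonneg hne hγ x) (one_le_pow₀ ?_)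
        have : (0 : ℝ) ≤ 1 / H := by positivity
        linarith
      · rw [pow_succ', mul_assoc]
        refine mul_le_mul_of_nonneg_left ?_ (one_add_inv_nonneg H)
        refine (sum_transition_mul_le (hresp P hP) (x := x) (by omega) a fun y hy =>
          ih y (by omega)).trans_eq ?_
        rw [Finset.mul_sum]
        exact Finset.sum_congr rfl fun y _ => by ring
  have h1 := key H L.init (by rw [layer_init, zero_add])
  have h2 : L.dilatedBonus γ K π L.init = L.dilatedToGo γ K π H L.init := by
    funext a
    rw [Layering.dilatedBonus, layer_init, Nat.sub_zero]
  rw [h2]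
  refine h1.trans (mul_le_mul_of_nonneg_right (one_add_inv_pow_le hH le_rfl) ?_)
  exact valueToGo_nonneg' P π (fun x _ => bonus_nonneg hne hγ x) _ _

/-- The policy factor in the bonus completes the probability of reaching `x` to an occupancy, which
is at most the upper bound and so cancels the denominator. This works for every member of `K`, in
particular for the greedy one. -/
theorem value_bonus_le (hγ : 0 < γ) {P : Transition X A} (hP : P ∈ K) (hresp : L.Respects P) :
    (L.value P π fun x _ => L.bonus γ K π x) ≤ ∑ x with L.layer x < H, ∑ a,
      (3 * γ * H + H * (L.upperOcc K π x a - L.lowerOcc K π x a)) := by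
  rw [value_eq_sum_occ hresp]
  refine Finset.sum_le_sum fun x _ => ?_
  rw [sum_occ, Layering.bonus, Finset.mul_sum]
  refine Finset.sum_le_sum fun a _ => ?_
  rw [← mul_assoc, mul_div_assoc', div_le_iff₀ (upperOcc_add_pos hγ x a), mul_comm]
  refine mul_le_mul_of_nonneg_left ?_ (bonus_numerator_nonneg ⟨P, hP⟩ hγ x a)
  exact (occ_le_upperOcc L hP π x a).trans (by linarith)

end Dilated

/-! ### Exponential moments in one episode -/

theorem visit_nonneg {n : ℕ} (τ : Trajectory X A n) (h : ℕ) (x : X) (a : A) :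
    0 ≤ τ.visit h x a := by
  unfold Trajectory.visit
  split_ifs <;> simp

theorem visit_eq_zero_or_one {n : ℕ} (τ : Trajectory X A n) (h : ℕ) (x : X) (a : A) :
    τ.visit h x a = 0 ∨ τ.visit h x a = 1 := by
  unfold Trajectory.visit
  split_ifs <;> simp

theorem visit_le_one {n : ℕ} (τ : Trajectory X A n) (h : ℕ) (x : X) (a : A) :
    τ.visit h x a ≤ 1 := by
  rcases visit_eq_zero_or_one τ h x a with h | h <;> simp [h]

theorem exists_of_visit_ne_zero {n : ℕ} {τ : Trajectory X A n} {h : ℕ} {x : X} {a : A}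
    (ha : τ.visit h x a ≠ 0) :
    ∃ i : Fin n, (i : ℕ) = h ∧ τ.state i.castSucc = x ∧ τ.action i = a := by
  unfold Trajectory.visit at ha
  by_contra hn
  exact ha (if_neg hn)

theorem visit_eq_one_unique {n : ℕ} {τ : Trajectory X A n} {h : ℕ} {x : X} {a b : A}
    (ha : τ.visit h x a ≠ 0) (hb : τ.visit h x b ≠ 0) : a = b := by
  obtain ⟨i, hi, _, rfl⟩ := exists_of_visit_ne_zero ha
  obtain ⟨j, hj, _, rfl⟩ := exists_of_visit_ne_zero hb
  rw [Fin.ext (hi.trans hj.symm)]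

theorem lossFrom_nonneg {ℓ : X → A → ℝ} (hℓ : ∀ x a, 0 ≤ ℓ x a) (τ : Trajectory X A H) (h : ℕ) :
    0 ≤ (τ.observe ℓ).lossFrom h := by
  refine Finset.sum_nonneg fun i _ => ?_
  split_ifs
  exacts [hℓ _ _, le_rfl]

theorem lossFrom_le {ℓ : X → A → ℝ} (hℓ : ∀ x a, ℓ x a ≤ 1) (τ : Trajectory X A H) (h : ℕ) :
    (τ.observe ℓ).lossFrom h ≤ H := by
  have h1 : (τ.observe ℓ).lossFrom h ≤ ∑ _i : Fin H, (1 : ℝ) := by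
    refine Finset.sum_le_sum fun i _ => ?_
    split_ifs
    exacts [hℓ _ _, zero_le_one]
  simpa using h1

theorem qHat_eq (L : Layering X H) (γ : ℝ) (K : Set (Transition X A)) (π : Policy X A)
    (ℓ : X → A → ℝ) (τ : Trajectory X A H) (x : X) (a : A) :
    L.qHat γ K π (τ.observe ℓ) x a
      = τ.visit (L.layer x) x a * (τ.observe ℓ).lossFrom (L.layer x)
        / (L.upperOcc K π x a + γ) := by
  unfold Layering.qHat Trajectory.visit
  have : L.Visits (τ.observe ℓ) x a ↔
    ∃ i : Fin H, (i : ℕ) = L.layer x ∧ τ.state i.castSucc = x ∧ τ.action i = a := Iff.rfl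
  by_cases h : L.Visits (τ.observe ℓ) x a
  · rw [if_pos h, if_pos (this.1 h), one_mul]
  · rw [if_neg h, if_neg (mt this.2 h), zero_mul, zero_div]

/-- The chord of a convex function on the unit interval lies above it. -/
theorem exp_mul_le {z : ℝ} (h0 : 0 ≤ z) (h1 : z ≤ 1) (u : ℝ) :
    Real.exp (u * z) ≤ 1 + z * (Real.exp u - 1) := by
  have := convexOn_exp.2 (Set.mem_univ 0) (Set.mem_univ u) (sub_nonneg.2 h1) h0 (by ring)
  simp only [smul_eq_mul, mul_zero, zero_add, Real.exp_zero, mul_one] at this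
  rw [mul_comm]
  linarith

/-- The reason for implicit exploration: with y = 2γ/qb the exponent equals 2y/(y + 2), which is at
most log(1 + y). Adding γ to the denominator is exactly what makes the exponential moment linear in
γ. -/
theorem mul_exp_sub_one_le {q qb γ : ℝ} (h0 : 0 ≤ q) (h1 : q ≤ qb) (hγ : 0 < γ) :
    q * (Real.exp (2 * γ / (qb + γ)) - 1) ≤ 2 * γ := by
  rcases h0.eq_or_lt with rfl | hq
  · rw [zero_mul]; positivity
  have hqb : 0 < qb := hq.trans_le h1
  have h2 := Real.le_log_one_add_of_nonneg (x := 2 * γ / qb) (by positivity)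
  have h3 : 2 * (2 * γ / qb) / (2 * γ / qb + 2) = 2 * γ / (qb + γ) := by
    field_simp
    ring
  rw [h3, Real.le_log_iff_exp_le (by positivity)] at h2
  have h4 : Real.exp (2 * γ / (qb + γ)) - 1 ≤ 2 * γ / qb := by linarith
  calc q * (Real.exp (2 * γ / (qb + γ)) - 1) ≤ q * (2 * γ / qb) :=
        mul_le_mul_of_nonneg_left h4 hq.le
    _ = 2 * γ * (q / qb) := by ring
    _ ≤ 2 * γ := mul_le_of_le_one_right (by positivity) (div_le_one_of_le₀ h1 hqb.le)

section Episode

variable {L : Layering X H} {P : Transition X A} {K : Set (Transition X A)} {γ : ℝ}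
  {π : Policy X A} {ℓ : X → A → ℝ}

theorem expect_visit_eq_occ {x : X} (hx : L.layer x < H) (a : A) :
    expect (trajectoryLaw P π L.init H) (fun τ => τ.visit (L.layer x) x a) = L.occ P π x a :=
  expect_visit L P π hx x a

theorem expect_visit_mul_lossFrom {x : X} (hx : L.layer x < H) (a : A) :
    expect (trajectoryLaw P π L.init H)
        (fun τ => τ.visit (L.layer x) x a * (τ.observe ℓ).lossFrom (L.layer x))
      = L.occ P π x a * L.qValue P π ℓ x a :=
  expect_visit_mul_loss L P π ℓ hx x a

/-- Implicit exploration: the loss estimator exceeds the `Q`-function only slightly. -/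
theorem expect_exp_qHat_le (hH : 1 ≤ H) (hγ : 0 < γ) (hP : P ∈ K)
    (hℓ : ∀ x a, ℓ x a ∈ Set.Icc (0 : ℝ) 1) {x : X} (hx : L.layer x < H) (a : A) :
    expect (trajectoryLaw P π L.init H) (fun τ => Real.exp
      (2 * γ / H * (L.qHat γ K π (τ.observe ℓ) x a - L.qValue P π ℓ x a))) ≤ 1 := by
  have hH' : (0 : ℝ) < H := by exact_mod_cast hH
  set u := 2 * γ / (L.upperOcc K π x a + γ) with hu
  set Q := L.qValue P π ℓ x a
  set z : Trajectory X A H → ℝ := fun τ =>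
    τ.visit (L.layer x) x a * (τ.observe ℓ).lossFrom (L.layer x)
  have hz : ∀ τ, Real.exp (2 * γ / H * (L.qHat γ K π (τ.observe ℓ) x a - Q))
      ≤ Real.exp (-(2 * γ / H * Q)) * (1 + (Real.exp u - 1) / H * z τ) := by
    intro τ
    have h1 : 2 * γ / H * (L.qHat γ K π (τ.observe ℓ) x a - Q)
        = -(2 * γ / H * Q) + u * (z τ / H) := by
      rw [qHat_eq, hu]
      ring
    rw [h1, Real.exp_add]
    refine mul_le_mul_of_nonneg_left ?_ (Real.exp_pos _).le
    have h2 := lossFrom_nonneg (fun x a => (hℓ x a).1) τ (L.layer x)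
    have h3 := lossFrom_le (fun x a => (hℓ x a).2) τ (L.layer x)
    refine (exp_mul_le (div_nonneg (mul_nonneg (visit_nonneg _ _ _ _) h2) hH'.le) ?_ u).trans_eq
      (by ring)
    refine div_le_one_of_le₀ ?_ hH'.le
    calc z τ ≤ 1 * H := mul_le_mul (visit_le_one _ _ _ _) h3 h2 zero_le_one
      _ = H := one_mul _
  refine (expect_mono _ fun τ _ => hz τ).trans ?_
  rw [expect_const_mul, expect_add, expect_const, expect_const_mul, expect_visit_mul_lossFrom hx]
  have hQ : 0 ≤ Q := qValue_nonneg L P π (fun x a => (hℓ x a).1) x a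
  have h4 : (Real.exp u - 1) / H * (L.occ P π x a * Q) ≤ 2 * γ / H * Q := by
    have h5 := mul_exp_sub_one_le (occ_nonneg L P π x a) (occ_le_upperOcc L hP π x a) hγ
    calc _ = L.occ P π x a * (Real.exp u - 1) * (Q / H) := by ring
      _ ≤ 2 * γ * (Q / H) := mul_le_mul_of_nonneg_right h5 (by positivity)
      _ = _ := by ring
  calc _ ≤ Real.exp (-(2 * γ / H * Q)) * Real.exp (2 * γ / H * Q) := by
        refine mul_le_mul_of_nonneg_left ?_ (Real.exp_pos _).le
        linarith [Real.add_one_le_exp (2 * γ / H * Q)]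
    _ = 1 := by rw [← Real.exp_add]; simp

/-- An episode takes at most one action at `x`, so at most one summand in the exponent is active,
and the chord bound for single terms applies to the exponential of the whole sum. -/
theorem expect_exp_weighted_visits_le (hγ : 0 < γ) (hP : P ∈ K) {x : X} (hx : L.layer x < H)
    {W : A → ℝ} (hW0 : ∀ a, 0 ≤ W a) (hW1 : ∀ a, W a ≤ 1) :
    expect (trajectoryLaw P π L.init H) (fun τ => Real.exp
      (∑ a, W a * τ.visit (L.layer x) x a * (2 * γ / (L.upperOcc K π x a + γ))
        - 2 * γ * ∑ a, W a)) ≤ 1 := by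
  classical
  set u : A → ℝ := fun a => 2 * γ / (L.upperOcc K π x a + γ) with hu
  have hz : ∀ τ : Trajectory X A H, Real.exp (∑ a, W a * τ.visit (L.layer x) x a * u a)
      ≤ 1 + ∑ a, W a * (Real.exp (u a) - 1) * τ.visit (L.layer x) x a := by
    intro τ
    by_cases h : ∀ a, τ.visit (L.layer x) x a = 0
    · simp [h]
    · obtain ⟨a, ha⟩ := not_forall.1 h
      have hb : ∀ b, b ≠ a → τ.visit (L.layer x) x b = 0 := by
        intro b hb
        by_contra hb'
        exact hb (visit_eq_one_unique hb' ha)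
      have ha1 := (visit_eq_zero_or_one τ (L.layer x) x a).resolve_left ha
      rw [Finset.sum_eq_single a (fun b _ hb' => by simp [hb b hb']) (by simp),
        Finset.sum_eq_single a (fun b _ hb' => by simp [hb b hb']) (by simp), ha1, mul_one,
        mul_one, mul_comm]
      exact exp_mul_le (hW0 a) (hW1 a) (u a)
  have hz' : ∀ τ : Trajectory X A H,
      Real.exp (∑ a, W a * τ.visit (L.layer x) x a * u a - 2 * γ * ∑ a, W a)
      ≤ Real.exp (-(2 * γ * ∑ a, W a)) *
        (1 + ∑ a, W a * (Real.exp (u a) - 1) * τ.visit (L.layer x) x a) := by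
    intro τ
    rw [sub_eq_neg_add, Real.exp_add]
    exact mul_le_mul_of_nonneg_left (hz τ) (Real.exp_pos _).le
  refine (expect_mono _ fun τ _ => hz' τ).trans ?_
  rw [expect_const_mul, expect_add, expect_const, expect_sum]
  simp only [expect_const_mul, expect_visit_eq_occ hx]
  have h4 : ∑ a, W a * (Real.exp (u a) - 1) * L.occ P π x a ≤ 2 * γ * ∑ a, W a := by
    rw [Finset.mul_sum]
    refine Finset.sum_le_sum fun a _ => ?_
    have h5 := mul_exp_sub_one_le (occ_nonneg L P π x a) (occ_le_upperOcc L hP π x a) hγ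
    calc _ = W a * (L.occ P π x a * (Real.exp (u a) - 1)) := by ring
      _ ≤ W a * (2 * γ) := mul_le_mul_of_nonneg_left h5 (hW0 a)
      _ = _ := by ring
  calc _ ≤ Real.exp (-(2 * γ * ∑ a, W a)) * Real.exp (2 * γ * ∑ a, W a) := by
        refine mul_le_mul_of_nonneg_left ?_ (Real.exp_pos _).le
        linarith [Real.add_one_le_exp (2 * γ * ∑ a, W a)]
    _ = 1 := by rw [← Real.exp_add]; simp

/-- Indeed (1 + y + y²/2)(1 - y + y²/2) = 1 + y⁴/4. -/
theorem exp_neg_le_quadratic {y : ℝ} (hy : 0 ≤ y) : Real.exp (-y) ≤ 1 - y + y ^ 2 / 2 := by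
  have h1 := Real.quadratic_le_exp_of_nonneg hy
  have h2 : (0 : ℝ) < 1 + y + y ^ 2 / 2 := by positivity
  rw [Real.exp_neg]
  calc (Real.exp y)⁻¹ ≤ (1 + y + y ^ 2 / 2)⁻¹ := inv_anti₀ h2 h1
    _ ≤ 1 - y + y ^ 2 / 2 := by
      rw [inv_le_iff_one_le_mul₀ h2]
      nlinarith [sq_nonneg (y ^ 2)]

/-- One-sided exponential bound for a nonnegative variable in terms of its second moment. -/
theorem expect_exp_lower_le {Ω : Type*} [Fintype Ω] (p : PMF Ω) {Y : Ω → ℝ}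
    (hY : ∀ ω ∈ p.support, 0 ≤ Y ω) {lam M : ℝ} (hlam : 0 ≤ lam)
    (hM : expect p (fun ω => Y ω ^ 2) ≤ M) :
    expect p (fun ω => Real.exp (lam * (expect p Y - Y ω) - lam ^ 2 / 2 * M)) ≤ 1 := by
  set e := expect p Y
  have h1 : ∀ ω ∈ p.support, Real.exp (lam * (e - Y ω) - lam ^ 2 / 2 * M)
      ≤ Real.exp (lam * e - lam ^ 2 / 2 * M) * (1 - lam * Y ω + lam ^ 2 / 2 * Y ω ^ 2) := by
    intro ω hω
    rw [show lam * (e - Y ω) - lam ^ 2 / 2 * M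
      = (lam * e - lam ^ 2 / 2 * M) + -(lam * Y ω) by ring, Real.exp_add]
    refine mul_le_mul_of_nonneg_left ?_ (Real.exp_pos _).le
    exact (exp_neg_le_quadratic (mul_nonneg hlam (hY ω hω))).trans_eq (by ring)
  refine (expect_mono p h1).trans ?_
  rw [expect_const_mul, expect_add, expect_sub, expect_const, expect_const_mul, expect_const_mul]
  have h2 : lam ^ 2 / 2 * expect p (fun ω => Y ω ^ 2) ≤ lam ^ 2 / 2 * M :=
    mul_le_mul_of_nonneg_left hM (by positivity)
  calc _ ≤ Real.exp (lam * e - lam ^ 2 / 2 * M) * Real.exp (-(lam * e - lam ^ 2 / 2 * M)) := by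
        refine mul_le_mul_of_nonneg_left ?_ (Real.exp_pos _).le
        refine le_trans ?_ (Real.add_one_le_exp _)
        linarith
    _ = 1 := by rw [← Real.exp_add]; simp

/-- For `w ≤ 1` one has exp(-w) ≤ 1 - w/2. Giving away half of the mean removes the variance term,
so weighted occupancies are bounded by twice the weighted visits plus a logarithm. -/
theorem expect_exp_occ_sub_visit_le {x : X} (hx : L.layer x < H) (a : A) {w : ℝ} (hw0 : 0 ≤ w)
    (hw1 : w ≤ 1) :
    expect (trajectoryLaw P π L.init H) (fun τ => Real.exp
      (w * L.occ P π x a / 2 - w * τ.visit (L.layer x) x a)) ≤ 1 := by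
  set q := L.occ P π x a with hq
  have h1 : ∀ τ : Trajectory X A H, Real.exp (w * q / 2 - w * τ.visit (L.layer x) x a)
      ≤ Real.exp (w * q / 2) * (1 - w / 2 * τ.visit (L.layer x) x a) := by
    intro τ
    rw [sub_eq_add_neg, Real.exp_add]
    refine mul_le_mul_of_nonneg_left ?_ (Real.exp_pos _).le
    rcases visit_eq_zero_or_one τ (L.layer x) x a with h | h
    · simp [h]
    · rw [h, mul_one, mul_one]
      have := exp_neg_le_quadratic hw0
      nlinarith
  refine (expect_mono _ fun τ _ => h1 τ).trans ?_
  rw [expect_const_mul, expect_sub, expect_const, expect_const_mul, expect_visit_eq_occ hx, ← hq]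
  calc _ ≤ Real.exp (w * q / 2) * Real.exp (-(w * q / 2)) := by
        refine mul_le_mul_of_nonneg_left ?_ (Real.exp_pos _).le
        linarith [Real.add_one_le_exp (-(w * q / 2))]
    _ = 1 := by rw [← Real.exp_add]; simp

/-- Given a visit, arrival at `x'` is a Bernoulli variable, and `c * P x a x'` compensates its
centered log-moment p(exp λ - 1 - λ). Without a visit the exponent vanishes. -/
theorem expect_exp_transition_le [DecidableEq X] {x : X} (hx : L.layer x < H) (a : A) (x' : X)
    {lam c : ℝ} (hc : Real.exp lam - 1 - lam ≤ c) :
    expect (trajectoryLaw P π L.init H) (fun τ => Real.exp (τ.visit (L.layer x) x a *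
      (lam * ((if τ.stateAt (L.layer x + 1) = x' then 1 else 0) - P x a x') - c * P x a x')))
      ≤ 1 := by
  set p := P x a x' with hp
  set g : X → ℝ := fun y => lam * ((if y = x' then 1 else 0) - p) - c * p with hg
  have h1 : ∀ τ : Trajectory X A H,
      Real.exp (τ.visit (L.layer x) x a * g (τ.stateAt (L.layer x + 1)))
      = 1 + τ.visit (L.layer x) x a * (Real.exp (g (τ.stateAt (L.layer x + 1))) - 1) := by
    intro τ
    rcases visit_eq_zero_or_one τ (L.layer x) x a with h | h <;> simp [h]
  have h2 := expect_visit_mul_next L P π (fun y => Real.exp (g y) - 1) hx x a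
  have h3 : ∑ y, P x a y * (Real.exp (g y) - 1)
      = Real.exp (-(lam * p) - c * p) * (1 + p * (Real.exp lam - 1)) - 1 := by
    have : ∀ y, P x a y * (Real.exp (g y) - 1)
        = Real.exp (-(lam * p) - c * p) * (P x a y + P x a y *
          (if y = x' then Real.exp lam - 1 else 0)) - P x a y := by
      intro y
      simp only [hg]
      split_ifs with h
      · rw [show lam * (1 - p) - c * p = (-(lam * p) - c * p) + lam by ring, Real.exp_add]
        ring
      · rw [show lam * (0 - p) - c * p = -(lam * p) - c * p by ring]
        ring
    simp only [this, Finset.sum_sub_distrib, ← Finset.mul_sum, Finset.sum_add_distrib,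
      sum_transition]
    simp [hp]
  have hp0 : 0 ≤ p := transition_nonneg P x a x'
  have h4 : ∑ y, P x a y * (Real.exp (g y) - 1) ≤ 0 := by
    rw [h3, sub_nonpos]
    calc _ ≤ Real.exp (-(lam * p) - c * p) * Real.exp (p * (Real.exp lam - 1)) := by
          refine mul_le_mul_of_nonneg_left ?_ (Real.exp_pos _).le
          linarith [Real.add_one_le_exp (p * (Real.exp lam - 1))]
      _ = Real.exp (p * (Real.exp lam - 1 - lam - c)) := by
          rw [← Real.exp_add]
          congr 1
          ring
      _ ≤ 1 := Real.exp_le_one_iff.2 (mul_nonpos_of_nonneg_of_nonpos hp0 (by linarith))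
  change expect _ (fun τ : Trajectory X A H =>
    Real.exp (τ.visit (L.layer x) x a * g (τ.stateAt (L.layer x + 1)))) ≤ 1
  rw [funext h1, expect_add, expect_const, h2]
  have := mul_nonpos_of_nonneg_of_nonpos (occ_nonneg L P π x a) h4
  unfold Layering.occ at this
  linarith

end Episode

/-! ### The interaction of the algorithm with the MDP -/

section Interaction

variable [Nonempty A]

/-- The policy executed in memory state `s`. -/
abbrev AlgState.policy (s : AlgState X A) (H T : ℕ) : Policy X A :=
  expPolicy (eta X A H T) s.cumLoss

/-- Memory after `n` episodes with trajectories `τ 0, τ 1, …`. -/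
def Layering.run (L : Layering X H) (T : ℕ) (δ : ℝ) (ℓ : ℕ → X → A → ℝ)
    (τ : ℕ → Trajectory X A H) : ℕ → AlgState X A
  | 0 => L.initState A
  | n + 1 => L.update T δ (L.run T δ ℓ τ n) ((τ n).observe (ℓ n))

/-- Extension of finitely many trajectories to a sequence. -/
def Layering.extendSeq (L : Layering X H) {n : ℕ} (ω : Fin n → Trajectory X A H) (t : ℕ) :
    Trajectory X A H :=
  if h : t < n then ω ⟨t, h⟩ else ⟨fun _ => L.init, fun _ => Classical.arbitrary A⟩

theorem extendSeq_val (L : Layering X H) {n : ℕ} (ω : Fin n → Trajectory X A H) (t : Fin n) :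
    L.extendSeq ω t = ω t := by
  simp [Layering.extendSeq]

theorem extendSeq_snoc_of_lt (L : Layering X H) {n : ℕ} (ω : Fin n → Trajectory X A H)
    (τ : Trajectory X A H) {t : ℕ} (ht : t < n) :
    L.extendSeq (Fin.snoc ω τ : Fin (n + 1) → Trajectory X A H) t = L.extendSeq ω t := by
  rw [show t = ((⟨t, ht⟩ : Fin n).castSucc : ℕ) from rfl, extendSeq_val, Fin.snoc_castSucc,
    Fin.val_castSucc, extendSeq_val]

theorem extendSeq_snoc_self (L : Layering X H) {n : ℕ} (ω : Fin n → Trajectory X A H)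
    (τ : Trajectory X A H) :
    L.extendSeq (Fin.snoc ω τ : Fin (n + 1) → Trajectory X A H) n = τ := by
  have := extendSeq_val L (Fin.snoc ω τ : Fin (n + 1) → Trajectory X A H) (Fin.last n)
  rwa [Fin.val_last, Fin.snoc_last] at this

variable {L : Layering X H} {T : ℕ} {δ : ℝ} {ℓ : ℕ → X → A → ℝ} {P : Transition X A}

theorem run_congr {τ τ' : ℕ → Trajectory X A H} {n : ℕ} (h : ∀ t < n, τ t = τ' t) :
    L.run T δ ℓ τ n = L.run T δ ℓ τ' n := by
  induction n with
  | zero => rfl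
  | succ n ih =>
    rw [Layering.run, Layering.run, ih fun t ht => h t (by omega), h n (by omega)]

theorem stateAfter_eq_run (τ : ℕ → Trajectory X A H) (n : ℕ)
    (o : Fin n → Observation X A H) (ho : ∀ t : Fin n, o t = (τ t).observe (ℓ t)) :
    L.stateAfter T δ n o = L.run T δ ℓ τ n := by
  induction n with
  | zero => rfl
  | succ n ih =>
    rw [Layering.stateAfter, Layering.run, ih (fun s => o s.castSucc) fun t => ho t.castSucc,
      ho (Fin.last n), Fin.val_last]

theorem policyAfter_eq (τ : ℕ → Trajectory X A H) (n : ℕ) (ω : Fin n → Trajectory X A H)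
    (hω : ∀ t : Fin n, ω t = τ t) :
    (L.dilatedBonusPO T δ).policyAfter ℓ n ω = (L.run T δ ℓ τ n).policy H T := by
  rw [Learner.policyAfter, Layering.dilatedBonusPO, stateAfter_eq_run τ]
  intro t
  rw [hω]

theorem expect_interactionLaw_succ (n : ℕ) (f : (Fin (n + 1) → Trajectory X A H) → ℝ) :
    expect (L.interactionLaw P ℓ (L.dilatedBonusPO T δ) (n + 1)) f
      = expect (L.interactionLaw P ℓ (L.dilatedBonusPO T δ) n) fun ω =>
        expect (trajectoryLaw P ((L.run T δ ℓ (L.extendSeq ω) n).policy H T) L.init H) fun τ =>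
          f (Fin.snoc ω τ) := by
  rw [Layering.interactionLaw, expect_bind]
  refine expect_congr _ fun ω _ => ?_
  rw [expect_map, policyAfter_eq (L.extendSeq ω) n ω fun t => (extendSeq_val L ω t).symm]

theorem follows_of_mem_support_interactionLaw (hP : L.Respects P) {n : ℕ}
    {ω : Fin n → Trajectory X A H}
    (h : ω ∈ (L.interactionLaw P ℓ (L.dilatedBonusPO T δ) n).support) (t : Fin n) :
    L.Follows (ω t) := by
  induction n with
  | zero => exact t.elim0
  | succ n ih =>
    rw [Layering.interactionLaw, PMF.mem_support_bind_iff] at h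
    obtain ⟨ω', h', h⟩ := h
    rw [PMF.mem_support_map_iff] at h
    obtain ⟨τ, hτ, rfl⟩ := h
    refine Fin.lastCases ?_ (fun j => ?_) t
    · rw [Fin.snoc_last]
      exact follows_of_mem_support hP le_rfl hτ
    · rw [Fin.snoc_castSucc]
      exact ih h' j

/-- Sum of increments along the episodes. -/
def Layering.runSum (L : Layering X H) (T : ℕ) (δ : ℝ) (ℓ : ℕ → X → A → ℝ)
    (Z : ℕ → AlgState X A → Trajectory X A H → ℝ) (τ : ℕ → Trajectory X A H) (n : ℕ) : ℝ :=
  ∑ t ∈ range n, Z t (L.run T δ ℓ τ t) (τ t)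

/-- Exponential supermartingales along the interaction. -/
theorem expect_exp_runSum_le {Z : ℕ → AlgState X A → Trajectory X A H → ℝ}
    (hZ : ∀ t s, expect (trajectoryLaw P (s.policy H T) L.init H)
      (fun τ => Real.exp (Z t s τ)) ≤ 1) (n : ℕ) :
    expect (L.interactionLaw P ℓ (L.dilatedBonusPO T δ) n)
      (fun ω => Real.exp (L.runSum T δ ℓ Z (L.extendSeq ω) n)) ≤ 1 := by
  induction n with
  | zero =>
    simp only [Layering.runSum, Finset.range_zero, Finset.sum_empty, Real.exp_zero]
    rw [expect_const]
  | succ n ih =>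
    rw [expect_interactionLaw_succ]
    refine le_trans (expect_mono _ fun ω _ => ?_) ih
    have h1 : ∀ τ, L.runSum T δ ℓ Z
        (L.extendSeq (Fin.snoc ω τ : Fin (n + 1) → Trajectory X A H)) (n + 1)
        = L.runSum T δ ℓ Z (L.extendSeq ω) n + Z n (L.run T δ ℓ (L.extendSeq ω) n) τ := by
      intro τ
      have h2 : ∀ t ≤ n, L.run T δ ℓ
          (L.extendSeq (Fin.snoc ω τ : Fin (n + 1) → Trajectory X A H)) t
          = L.run T δ ℓ (L.extendSeq ω) t := fun t ht =>
        run_congr fun s hs => extendSeq_snoc_of_lt L ω τ (by omega)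
      rw [Layering.runSum, Layering.runSum, Finset.sum_range_succ, extendSeq_snoc_self,
        h2 n le_rfl]
      congr 1
      refine Finset.sum_congr rfl fun t ht => ?_
      rw [Finset.mem_range] at ht
      rw [h2 t ht.le, extendSeq_snoc_of_lt L ω τ ht]
    simp only [h1, Real.exp_add, expect_const_mul]
    exact mul_le_of_le_one_right (Real.exp_pos _).le (hZ _ _)

theorem prob_runSum_gt_le {Z : ℕ → AlgState X A → Trajectory X A H → ℝ}
    (hZ : ∀ t s, expect (trajectoryLaw P (s.policy H T) L.init H)
      (fun τ => Real.exp (Z t s τ)) ≤ 1) (n : ℕ) (c : ℝ) :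
    prob (L.interactionLaw P ℓ (L.dilatedBonusPO T δ) n)
      {ω | c < L.runSum T δ ℓ Z (L.extendSeq ω) n} ≤ Real.exp (-c) :=
  prob_le_exp_neg _ (expect_exp_runSum_le hZ n) c

end Interaction

/-! ### Counters -/

open Classical in
-- A trajectory that follows the layers can be in `x` only at step `layer x`, so the learner's
-- counter grows by the visit indicator.
theorem card_visit {L : Layering X H} {τ : Trajectory X A H} (hτ : L.Follows τ) (x : X) (a : A) :
    ((#{h : Fin H | τ.state h.castSucc = x ∧ τ.action h = a} : ℕ) : ℝ)
      = τ.visit (L.layer x) x a := by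
  by_cases hv : ∃ i : Fin H, (i : ℕ) = L.layer x ∧ τ.state i.castSucc = x ∧ τ.action i = a
  · rw [Trajectory.visit, if_pos hv]
    obtain ⟨i, hi, h1, h2⟩ := hv
    have : ({h : Fin H | τ.state h.castSucc = x ∧ τ.action h = a} : Finset (Fin H)) = {i} := by
      ext j
      simp only [Finset.mem_filter, Finset.mem_univ, true_and, Finset.mem_singleton]
      constructor
      · rintro ⟨hj, _⟩
        have := hτ j.castSucc
        rw [hj, Fin.val_castSucc] at this
        exact Fin.ext (by omega)
      · rintro rfl
        exact ⟨h1, h2⟩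
    rw [this, Finset.card_singleton, Nat.cast_one]
  · rw [Trajectory.visit, if_neg hv, Nat.cast_eq_zero, Finset.card_eq_zero,
      Finset.filter_eq_empty_iff]
    rintro j _ ⟨hj, hj'⟩
    have := hτ j.castSucc
    rw [hj, Fin.val_castSucc] at this
    exact hv ⟨j, this.symm, hj, hj'⟩

open Classical in
theorem card_visit_next {L : Layering X H} {τ : Trajectory X A H} (hτ : L.Follows τ) (x : X)
    (a : A) (x' : X) :
    ((#{h : Fin H | τ.state h.castSucc = x ∧ τ.action h = a ∧ τ.state h.succ = x'} : ℕ) : ℝ)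
      = τ.visit (L.layer x) x a * if τ.stateAt (L.layer x + 1) = x' then 1 else 0 := by
  rw [← card_visit hτ]
  have key : ∀ i : Fin H, τ.state i.castSucc = x → τ.stateAt (L.layer x + 1) = τ.state i.succ := by
    intro i hi
    have := hτ i.castSucc
    rw [hi, Fin.val_castSucc] at this
    rw [Trajectory.stateAt]
    congr 1
    ext
    simp only [Fin.val_succ]
    omega
  split_ifs with h
  · rw [mul_one]
    congr 2
    ext i
    simp only [Finset.mem_filter, Finset.mem_univ, true_and]
    exact ⟨fun hi => ⟨hi.1, hi.2.1⟩, fun hi => ⟨hi.1, hi.2, by rw [← key i hi.1, h]⟩⟩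
  · rw [mul_zero, Nat.cast_eq_zero, Finset.card_eq_zero, Finset.filter_eq_empty_iff]
    rintro i _ ⟨h1, _, h3⟩
    exact h (by rw [key i h1, h3])

section Run

variable [Nonempty A] {L : Layering X H} {T : ℕ} {δ : ℝ} {ℓ : ℕ → X → A → ℝ}
  {P : Transition X A} {τ : ℕ → Trajectory X A H}

open Classical in
theorem update_count (s : AlgState X A) (o : Observation X A H) (x : X) (a : A) :
    (L.update T δ s o).count x a
      = s.count x a + #{h : Fin H | o.state h.castSucc = x ∧ o.action h = a} := by
  unfold Layering.update
  dsimp only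
  split_ifs <;> rfl

open Classical in
theorem update_count₃ (s : AlgState X A) (o : Observation X A H) (x : X) (a : A) (x' : X) :
    (L.update T δ s o).count₃ x a x' = s.count₃ x a x' +
      #{h : Fin H | o.state h.castSucc = x ∧ o.action h = a ∧ o.state h.succ = x'} := by
  unfold Layering.update
  dsimp only
  split_ifs <;> rfl

theorem update_cumLoss (s : AlgState X A) (o : Observation X A H) (x : X) (a : A) :
    (L.update T δ s o).cumLoss x a = s.cumLoss x a +
      (L.qHat (gam X A H T) s.conf (s.policy H T) o x a
        - L.dilatedBonus (gam X A H T) s.conf (s.policy H T) x a) := by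
  unfold Layering.update
  dsimp only
  split_ifs <;> rfl

theorem update_conf (s : AlgState X A) (o : Observation X A H) :
    ((L.update T δ s o).conf = s.conf ∧ (L.update T δ s o).prevCount = s.prevCount) ∨
    ((L.update T δ s o).conf = L.confSet (logTerm X A T δ) (L.update T δ s o).count
        (L.update T δ s o).count₃ ∧
      (L.update T δ s o).prevCount = (L.update T δ s o).count) := by
  unfold Layering.update
  dsimp only
  split_ifs
  · exact Or.inr ⟨rfl, rfl⟩
  · exact Or.inl ⟨rfl, rfl⟩

/-- Invariant of the doubling schedule. If the epoch continues, no visited pair has reached its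
threshold and unvisited pairs are unchanged; if a new epoch starts, both counters coincide. -/
theorem update_count_lt (s : AlgState X A) (o : Observation X A H)
    (hs : ∀ x a, s.count x a < max 1 (2 * s.prevCount x a)) (x : X) (a : A) :
    (L.update T δ s o).count x a < max 1 (2 * (L.update T δ s o).prevCount x a) := by
  classical
  rcases em (∃ h : Fin H, o.state h.castSucc = x ∧ o.action h = a) with ⟨h, rfl, rfl⟩ | hn
  · by_cases ht : ∃ h : Fin H, max 1 (2 * s.prevCount (o.state h.castSucc) (o.action h))
        ≤ (L.update T δ s o).count (o.state h.castSucc) (o.action h)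
    · rcases update_conf (L := L) (T := T) (δ := δ) s o with h1 | h1
      · simp only [update_count] at ht
        have h2 : (L.update T δ s o).prevCount = (L.update T δ s o).count := by
          unfold Layering.update
          dsimp only
          rw [if_pos (by convert ht)]
        rw [h2]
        omega
      · rw [h1.2]
        omega
    · have h0 := not_exists.1 ht h
      rcases update_conf (L := L) (T := T) (δ := δ) s o with h1 | h1
      · rw [h1.2]
        exact not_le.1 h0
      · rw [h1.2]
        omega
  · have hc : (L.update T δ s o).count x a = s.count x a := by
      rw [update_count, Finset.filter_eq_empty_iff.2, Finset.card_empty, add_zero]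
      exact fun h _ h' => hn ⟨h, h'⟩
    rcases update_conf (L := L) (T := T) (δ := δ) s o with h1 | h1
    · rw [h1.2, hc]
      exact hs x a
    · rw [h1.2]
      omega

theorem run_count_lt (n : ℕ) (x : X) (a : A) :
    (L.run T δ ℓ τ n).count x a < max 1 (2 * (L.run T δ ℓ τ n).prevCount x a) := by
  induction n generalizing x a with
  | zero => simp [Layering.run, Layering.initState]
  | succ n ih => exact update_count_lt _ _ ih x a

theorem run_count {n : ℕ} (hτ : ∀ t < n, L.Follows (τ t)) (x : X) (a : A) :
    ((L.run T δ ℓ τ n).count x a : ℝ) = ∑ t ∈ range n, (τ t).visit (L.layer x) x a := by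
  classical
  induction n with
  | zero => simp [Layering.run, Layering.initState]
  | succ n ih =>
    rw [Finset.sum_range_succ, ← ih fun t ht => hτ t (by omega), Layering.run, update_count,
      Nat.cast_add, ← card_visit (hτ n (by omega))]
    rfl

open Classical in
theorem run_count₃ {n : ℕ} (hτ : ∀ t < n, L.Follows (τ t)) (x : X) (a : A)
    (x' : X) :
    ((L.run T δ ℓ τ n).count₃ x a x' : ℝ) = ∑ t ∈ range n, (τ t).visit (L.layer x) x a *
      if (τ t).stateAt (L.layer x + 1) = x' then 1 else 0 := by
  induction n with
  | zero => simp [Layering.run, Layering.initState]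
  | succ n ih =>
    have h1 := card_visit_next (hτ n (by omega)) x a x'
    rw [Finset.sum_range_succ, ← ih fun t ht => hτ t (by omega), Layering.run, update_count₃,
      Nat.cast_add]
    congr 1

theorem run_count_le {n : ℕ} (hτ : ∀ t < n, L.Follows (τ t)) (x : X) (a : A) :
    (L.run T δ ℓ τ n).count x a ≤ n := by
  have h1 : ∑ t ∈ range n, (τ t).visit (L.layer x) x a ≤ ∑ t ∈ range n, (1 : ℝ) :=
    Finset.sum_le_sum fun t _ => visit_le_one _ _ _ _
  rw [← run_count (T := T) (δ := δ) (ℓ := ℓ) hτ] at h1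
  simpa using h1

/-- With empty counters the confidence width is 28ι/3 ≥ 1, hence no constraint. The first epoch thus
needs no separate treatment. -/
theorem allTransitions_eq_confSet {ι : ℝ} (hι : 3 / 28 ≤ ι) :
    L.allTransitions A = L.confSet ι (fun _ _ => 0) (fun _ _ _ => 0) := by
  ext P
  refine ⟨fun h => ⟨h, fun x a x' _ _ => ?_⟩, fun h => h.1⟩
  have h1 := transition_nonneg P x a x'
  have h2 := transition_le_one P x a x'
  simp only [empirical, confWidth, Nat.cast_zero, zero_div, sub_zero, zero_mul, Real.sqrt_zero,
    mul_zero, zero_add]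
  rw [abs_of_nonneg h1]
  norm_num
  linarith

/-- The confidence set in force was built from the counters of some earlier episode. -/
theorem run_conf (hι : 3 / 28 ≤ logTerm X A T δ) (n : ℕ) :
    ∃ m ≤ n, (L.run T δ ℓ τ n).prevCount = (L.run T δ ℓ τ m).count ∧
      (L.run T δ ℓ τ n).conf = L.confSet (logTerm X A T δ) (L.run T δ ℓ τ m).count
        (L.run T δ ℓ τ m).count₃ := by
  induction n with
  | zero => exact ⟨0, le_rfl, rfl, allTransitions_eq_confSet hι⟩
  | succ n ih =>
    obtain ⟨m, hm, h1, h2⟩ := ih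
    rcases update_conf (L := L) (T := T) (δ := δ) (L.run T δ ℓ τ n)
      ((τ n).observe (ℓ n)) with h | h
    · exact ⟨m, by omega, h.2.trans h1, h.1.trans h2⟩
    · exact ⟨n + 1, le_rfl, h.2, h.1⟩

end Run

/-! ### Confidence sets -/

theorem confSet_rectangular {L : Layering X H} {ι : ℝ} {N₂ : X → A → ℕ} {N₃ : X → A → X → ℕ}
    (F : X → A → Transition X A) (hF : ∀ x a, F x a ∈ L.confSet ι N₂ N₃) :
    (fun x a => F x a x a) ∈ L.confSet ι N₂ N₃ :=
  ⟨fun x a => (hF x a).1 x a, fun x a => (hF x a).2 x a⟩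

theorem isCompact_confSet (L : Layering X H) (ι : ℝ) (N₂ : X → A → ℕ) (N₃ : X → A → X → ℕ) :
    IsCompact (L.confSet ι N₂ N₃) := by
  have hc : ∀ x a x', Continuous fun P : Transition X A => P x a x' := by
    intro x a x'
    have h1 : Continuous fun P : Transition X A => (P x a : X → ℝ) :=
      continuous_subtype_val.comp ((continuous_apply a).comp (continuous_apply x))
    exact (continuous_apply x').comp h1
  refine IsClosed.isCompact ?_
  have h1 : L.confSet ι N₂ N₃ = (⋂ x, ⋂ a, ⋂ x', {P : Transition X A |
      (L.layer x < H → L.layer x' ≠ L.layer x + 1 → P x a x' = 0)}) ∩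
      ⋂ x, ⋂ a, ⋂ x', {P : Transition X A | L.layer x < H → L.layer x' = L.layer x + 1 →
        |P x a x' - empirical N₂ N₃ x a x'| ≤ confWidth ι N₂ N₃ x a x'} := by
    ext P
    simp only [Layering.confSet, Layering.Respects, Set.mem_ofPred_eq, Set.mem_inter_iff,
      Set.mem_iInter]
    refine and_congr_left fun _ => ?_
    refine forall_congr' fun x => forall_congr' fun a => forall_congr' fun x' => ?_
    tauto
  rw [h1]
  refine IsClosed.inter ?_ ?_
  · refine isClosed_iInter fun x => isClosed_iInter fun a => isClosed_iInter fun x' => ?_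
    by_cases h : L.layer x < H ∧ L.layer x' ≠ L.layer x + 1
    · simp only [h.1, h.2, ne_eq, not_false_eq_true, forall_const]
      exact isClosed_eq (hc x a x') continuous_const
    · convert isClosed_univ
      ext P
      simp only [Set.mem_ofPred_eq, Set.mem_univ, iff_true]
      exact fun h1 h2 => absurd ⟨h1, h2⟩ h
  · refine isClosed_iInter fun x => isClosed_iInter fun a => isClosed_iInter fun x' => ?_
    by_cases h : L.layer x < H ∧ L.layer x' = L.layer x + 1
    · simp only [h.1, h.2, forall_const]
      exact isClosed_le ((hc x a x').sub continuous_const).abs continuous_const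
    · convert isClosed_univ
      ext P
      simp only [Set.mem_ofPred_eq, Set.mem_univ, iff_true]
      exact fun h1 h2 => absurd ⟨h1, h2⟩ h

/-- Two members differ by at most two widths. The empirical frequency in the width is traded for the
probability under `P` at the price of a larger linear term, so that later sums run over a genuine
distribution. -/
theorem abs_transition_sub_le {L : Layering X H} {ι : ℝ} (hι : 0 ≤ ι) {N₂ : X → A → ℕ}
    {N₃ : X → A → X → ℕ} {P P' : Transition X A} (hP : P ∈ L.confSet ι N₂ N₃)
    (hP' : P' ∈ L.confSet ι N₂ N₃) {x : X} (hx : L.layer x < H) (a : A) {x' : X}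
    (hx' : L.layer x' = L.layer x + 1) :
    |P' x a x' - P x a x'| ≤ 8 * √(P x a x' * (ι / max 1 (N₂ x a : ℝ)))
      + 70 * (ι / max 1 (N₂ x a : ℝ)) := by
  have h1 := hP.2 x a x' hx hx'
  have h2 := hP'.2 x a x' hx hx'
  have hp := transition_nonneg P x a x'
  have hN : (0 : ℝ) < max 1 (N₂ x a : ℝ) := lt_max_of_lt_left one_pos
  have he : 0 ≤ empirical N₂ N₃ x a x' := div_nonneg (Nat.cast_nonneg _) hN.le
  set r := ι / max 1 (N₂ x a : ℝ) with hr
  have hr0 : 0 ≤ r := div_nonneg hι hN.le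
  have hw : confWidth ι N₂ N₃ x a x'
      = 4 * (√(empirical N₂ N₃ x a x') * √r) + 28 / 3 * √r ^ 2 := by
    rw [← Real.sqrt_mul he, Real.sq_sqrt hr0, confWidth, hr]
    congr 2
    · rw [mul_div_assoc]
    · field_simp
  rw [hw] at h1 h2
  rw [Real.sqrt_mul hp]
  have hv2 := Real.sq_sqrt hp
  have hw2 := Real.sq_sqrt he
  have hs2 := Real.sq_sqrt hr0
  set v := √(P x a x')
  set w := √(empirical N₂ N₃ x a x')
  set s := √r
  have hv0 : 0 ≤ v := Real.sqrt_nonneg _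
  have hw0 : 0 ≤ w := Real.sqrt_nonneg _
  have hs0 : 0 ≤ s := Real.sqrt_nonneg _
  rw [abs_le] at h1 h2
  -- Completing the square in `h1` gives (w - 2s)² ≤ v² + (40/3)s², and 2 + √(40/3) < 6.
  have h3 : w ≤ v + 6 * s := by
    nlinarith [mul_nonneg hv0 hs0, mul_nonneg hw0 hs0, sq_nonneg s]
  have h4 : w * s ≤ (v + 6 * s) * s := mul_le_mul_of_nonneg_right h3 hs0
  rw [abs_le]
  constructor <;> nlinarith [sq_nonneg s]

/-- From exponential-moment bounds at the optimal parameters to an empirical Bernstein bound. -/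
theorem abs_sub_le_of_bernstein {p e r : ℝ} (hp : 0 ≤ p) (he : 0 ≤ e) (hr : 0 < r)
    (h1 : ∀ lam, lam = (if p ≤ 2 * r then 1 else √(2 * r / p)) →
      lam * (e - p) - lam ^ 2 * p ≤ 2 * r)
    (h2 : ∀ lam, lam = √(4 * r / p) → lam * (p - e) - lam ^ 2 / 2 * p ≤ 2 * r) :
    |p - e| ≤ 4 * √(e * r) + 28 / 3 * r := by
  have h1 := h1 _ rfl
  have h2 := h2 _ rfl
  have hse : √(e * r) = √e * √r := Real.sqrt_mul he r
  have hs : 0 < √r := Real.sqrt_pos.2 hr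
  have hs2 := Real.sq_sqrt hr.le
  have hw2 := Real.sq_sqrt he
  have hw0 := Real.sqrt_nonneg e
  rw [hse, abs_le]
  constructor
  · by_cases hpe : e ≤ p
    · nlinarith [mul_nonneg hw0 hs.le]
    rw [not_le] at hpe
    -- If `p ≤ 2 * r` the parameter is 1 and e - p ≤ p + 2r ≤ 4r. Otherwise λ²p = 2r, so that e - p
    -- ≤ 4r/λ = 2√2 √(pr).
    split_ifs at h1 with hc
    · nlinarith [mul_nonneg hw0 hs.le]
    · rw [not_le] at hc
      have hp' : 0 < p := by linarith
      set lam := √(2 * r / p) with hlam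
      have hl2 : lam ^ 2 * p = 2 * r := by
        rw [hlam, Real.sq_sqrt (by positivity)]
        field_simp
      have hl0 : 0 < lam := Real.sqrt_pos.2 (by positivity)
      have h3 : lam * (e - p) ≤ 4 * r := by linarith
      have hv0 : √p ≤ √e := Real.sqrt_le_sqrt hpe.le
      have hv2 := Real.sq_sqrt hp
      have hvp : 0 < √p := Real.sqrt_pos.2 hp'
      set v := √p
      have h4 : (lam * v) ^ 2 = 2 * √r ^ 2 := by rw [mul_pow, hv2, hl2, hs2]
      have h5 : √r ≤ lam * v := by
        refine le_of_sq_le_sq ?_ (by positivity)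
        rw [h4]
        nlinarith [sq_nonneg (√r)]
      have h6 : e - p ≤ 4 * (v * √r) := by
        have : lam * (e - p) ≤ lam * (4 * (v * √r)) := by nlinarith
        exact le_of_mul_le_mul_left this hl0
      nlinarith [mul_le_mul_of_nonneg_right hv0 hs.le]
  · rcases hp.eq_or_lt with rfl | hp'
    · nlinarith [mul_nonneg hw0 hs.le]
    set lam := √(4 * r / p) with hlam
    have hl2 : lam ^ 2 * p = 4 * r := by
      rw [hlam, Real.sq_sqrt (by positivity)]
      field_simp
    have hl0 : 0 < lam := Real.sqrt_pos.2 (by positivity)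
    have h3 : lam * (p - e) ≤ 4 * r := by linarith
    have hv2 := Real.sq_sqrt hp
    have hvp : 0 < √p := Real.sqrt_pos.2 hp'
    set v := √p
    have h4 : (lam * v) ^ 2 = (2 * √r) ^ 2 := by rw [mul_pow, hv2, hl2, mul_pow, hs2]; ring
    have h5 : lam * v = 2 * √r := by
      exact (pow_left_inj₀ (by positivity) (by positivity) two_ne_zero).1 h4
    have h6 : p - e ≤ 2 * (v * √r) := by
      have : lam * (p - e) ≤ lam * (2 * (v * √r)) := by nlinarith
      exact le_of_mul_le_mul_left this hl0
    -- Solves the quadratic inequality (v - √r)² ≤ e + r, which is `h6` rearranged.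
    have h7 : v ≤ √e + 2 * √r := by nlinarith
    nlinarith

/-! ### The width of the occupancy bounds -/

open Classical in
/-- Number of states in layer `m`. -/
def Layering.width (L : Layering X H) (m : ℕ) : ℕ := #{x | L.layer x = m}

section Width

variable {L : Layering X H} {ι : ℝ} {N₂ : X → A → ℕ} {N₃ : X → A → X → ℕ}
  {P : Transition X A} {π : Policy X A}

open Classical in
/-- Transition uncertainty derived from the counters. -/
def Layering.deviation (L : Layering X H) (ι : ℝ) (N₂ : X → A → ℕ) (P : Transition X A)
    (y : X) (a : A) (z : X) : ℝ :=
  if L.layer z = L.layer y + 1 then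
    8 * √(P y a z * (ι / max 1 (N₂ y a : ℝ))) + 70 * (ι / max 1 (N₂ y a : ℝ)) else 0

theorem rate_nonneg (hι : 0 ≤ ι) (y : X) (a : A) : 0 ≤ ι / max 1 (N₂ y a : ℝ) :=
  div_nonneg hι (zero_le_one.trans (le_max_left _ _))

theorem deviation_nonneg (hι : 0 ≤ ι) (y : X) (a : A) (z : X) :
    0 ≤ L.deviation ι N₂ P y a z := by
  have := rate_nonneg (N₂ := N₂) hι y a
  unfold Layering.deviation
  split_ifs <;> positivity

/-- Cauchy-Schwarz over the next layer only: the probabilities sum to at most one, leaving the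
square root of the number of possible successors. -/
theorem sum_deviation_le (hι : 0 ≤ ι) (y : X) (a : A) :
    ∑ z, L.deviation ι N₂ P y a z
      ≤ 8 * √(L.width (L.layer y + 1) * (ι / max 1 (N₂ y a : ℝ)))
        + 70 * Fintype.card X * (ι / max 1 (N₂ y a : ℝ)) := by
  classical
  have hr0 := rate_nonneg (N₂ := N₂) hι y a
  simp only [Layering.deviation]
  set r := ι / max 1 (N₂ y a : ℝ)
  rw [← Finset.sum_filter, Finset.sum_add_distrib, ← Finset.mul_sum, Finset.sum_const,
    nsmul_eq_mul]
  refine add_le_add (mul_le_mul_of_nonneg_left ?_ (by norm_num)) ?_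
  · have h1 := Real.sum_sqrt_mul_sqrt_le (univ.filter fun z => L.layer z = L.layer y + 1)
      (f := fun z => P y a z) (g := fun _ => r) (fun z => transition_nonneg _ _ _ _)
      (fun _ => hr0)
    simp only [← Real.sqrt_mul (transition_nonneg P y a _)] at h1
    refine h1.trans ?_
    rw [Finset.sum_const, nsmul_eq_mul]
    have h2 : √(∑ z with L.layer z = L.layer y + 1, P y a z) ≤ 1 := by
      rw [Real.sqrt_le_one]
      exact (Finset.sum_le_univ_sum_of_nonneg fun z => transition_nonneg _ _ _ _).trans_eq
        (sum_transition P y a)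
    refine (mul_le_of_le_one_left (Real.sqrt_nonneg _) h2).trans_eq ?_
    unfold Layering.width
    congr
  · have h1 : ((#{z | L.layer z = L.layer y + 1} : ℕ) : ℝ) ≤ Fintype.card X := by
      exact_mod_cast Finset.card_le_univ _
    nlinarith [mul_le_mul_of_nonneg_right h1 hr0]

/-- AM-GM in the form 8√(pr) ≤ p/H + 16Hr; then 16H + 70 ≤ 86H. This supplies hypothesis `hβ` of
`abs_valueToGo_indicator_sub_le`. -/
theorem sum_deviation_mul_le (hι : 0 ≤ ι) (hH : 1 ≤ H) (y : X) (a : A) (d : X → ℝ)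
    (hd : ∀ z, L.layer z = L.layer y + 1 → 0 ≤ d z ∧ d z ≤ 1) (hy : L.layer y < H)
    (hP : L.Respects P) :
    ∑ z, L.deviation ι N₂ P y a z * d z ≤ 1 / H * ∑ z, P y a z * d z
      + 86 * Fintype.card X * H * (ι / max 1 (N₂ y a : ℝ)) := by
  have hr0 := rate_nonneg (N₂ := N₂) hι y a
  have hH' : (1 : ℝ) ≤ H := by exact_mod_cast hH
  have h1 : ∀ z, L.deviation ι N₂ P y a z * d z
      ≤ 1 / H * (P y a z * d z) + 86 * H * (ι / max 1 (N₂ y a : ℝ)) := by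
    intro z
    unfold Layering.deviation
    set r := ι / max 1 (N₂ y a : ℝ)
    split_ifs with hz
    · obtain ⟨h0, h1⟩ := hd z hz
      have hp := transition_nonneg P y a z
      rw [Real.sqrt_mul hp]
      have hv2 := Real.sq_sqrt hp
      have hs2 := Real.sq_sqrt hr0
      set v := √(P y a z)
      set s := √r
      have h2 : 8 * (v * s) ≤ 1 / H * v ^ 2 + 16 * H * s ^ 2 := by
        have h3 : 1 / (H : ℝ) * (v - 4 * H * s) ^ 2
            = 1 / H * v ^ 2 + 16 * H * s ^ 2 - 8 * (v * s) := by
          field_simp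
          ring
        have : 0 ≤ 1 / (H : ℝ) * (v - 4 * H * s) ^ 2 := by positivity
        linarith
      have h4 := mul_le_mul_of_nonneg_right h2 h0
      have h5 : 16 * H * s ^ 2 * d z ≤ 16 * H * s ^ 2 :=
        mul_le_of_le_one_right (by positivity) h1
      have h6 : 70 * r * d z ≤ 70 * r := mul_le_of_le_one_right (by positivity) h1
      have h7 : r ≤ H * r := le_mul_of_one_le_left hr0 hH'
      rw [hv2] at h4
      rw [hs2] at h4 h5
      nlinarith
    · have hp : P y a z = 0 := by
        by_contra h
        exact hz (hP y a z hy h)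
      rw [hp]
      simp only [zero_mul, mul_zero, zero_add]
      positivity
  refine (Finset.sum_le_sum fun z _ => h1 z).trans_eq ?_
  rw [Finset.sum_add_distrib, ← Finset.mul_sum, Finset.sum_const, nsmul_eq_mul, Finset.card_univ]
  ring

/-- The sum over target states is moved inside the value: from any `z`, the probabilities of
reaching the various `x` add up to at most the remaining number of steps, so the main part gains `H`
instead of `|X|`. The factor 6 = 2 · 3 comes from the two-sided width and the dilation; 48 = 6 · 8
and 936 = 6 · (70 + 86). -/
theorem sum_upperOcc_sub_lowerOcc_le (hι : 0 ≤ ι) (hH : 1 ≤ H) (hP : P ∈ L.confSet ι N₂ N₃) :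
    ∑ x with L.layer x < H, ∑ a,
      (L.upperOcc (L.confSet ι N₂ N₃) π x a - L.lowerOcc (L.confSet ι N₂ N₃) π x a)
    ≤ ∑ y with L.layer y < H, ∑ a, L.occ P π y a *
      (48 * H * √(L.width (L.layer y + 1) * (ι / max 1 (N₂ y a : ℝ)))
        + 936 * (Fintype.card X) ^ 2 * H * (ι / max 1 (N₂ y a : ℝ))) := by
  classical
  set β : X → A → ℝ := fun y a => 86 * Fintype.card X * H * (ι / max 1 (N₂ y a : ℝ)) with hβ
  set u : X → X → ℝ := fun x z =>
    valueToGo P π (fun z _ => if z = x then 1 else 0) (H - L.layer z) z with hu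
  set G : X → X → A → ℝ := fun x y a => (∑ z, L.deviation ι N₂ P y a z *
    valueToGo P π (fun z _ => if z = x then 1 else 0) (H - (L.layer y + 1)) z) + β y a with hG
  have hdev : ∀ P' ∈ L.confSet ι N₂ N₃, ∀ y a z, L.layer y < H →
      |P' y a z - P y a z| ≤ L.deviation ι N₂ P y a z := by
    intro P' hP' y a z hy
    unfold Layering.deviation
    split_ifs with hz
    · exact abs_transition_sub_le hι hP hP' hy a hz
    · have h1 : P y a z = 0 := by
        by_contra h
        exact hz (hP.1 y a z hy h)
      have h2 : P' y a z = 0 := by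
        by_contra h
        exact hz (hP'.1 y a z hy h)
      rw [h1, h2, sub_zero, abs_zero]
  have h1 : ∀ x, L.layer x < H → ∀ P' ∈ L.confSet ι N₂ N₃,
      |L.stepOcc P' π (L.layer x) x - L.stepOcc P π (L.layer x) x| ≤ 3 * L.value P π (G x) := by
    intro x hx P' hP'
    rw [stepOcc_eq_value hP.1 π hx, stepOcc_eq_value hP'.1 π hx]
    have h2 := abs_valueToGo_indicator_sub_le hP.1 hP'.1 π (hdev P' hP') (β := β)
      (fun y a d hy hd => sum_deviation_mul_le hι hH y a d hd hy hP.1) x H L.init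
      (by rw [layer_init, zero_add])
    refine h2.trans (mul_le_mul_of_nonneg_right (one_add_inv_pow_le hH le_rfl) ?_)
    refine valueToGo_nonneg' P π (fun y a => add_nonneg (Finset.sum_nonneg fun z _ => ?_) ?_) _ _
    · refine mul_nonneg (deviation_nonneg hι y a z) (valueToGo_nonneg' P π (fun z _ => ?_) _ _)
      split_ifs <;> simp
    · have := rate_nonneg (N₂ := N₂) hι y a
      simp only [hβ]
      positivity
  have h2 : ∀ x, L.layer x < H → ∑ a, (L.upperOcc (L.confSet ι N₂ N₃) π x a
      - L.lowerOcc (L.confSet ι N₂ N₃) π x a) ≤ 6 * L.value P π (G x) := by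
    intro x hx
    calc _ ≤ ∑ a, π x a * (6 * L.value P π (G x)) := by
          refine Finset.sum_le_sum fun a _ => ?_
          have := upperOcc_sub_lowerOcc_le L ⟨P, hP⟩ π x a (q := L.occ P π x a)
            (c := π x a * (3 * L.value P π (G x))) fun P' hP' => by
              rw [Layering.occ, Layering.occ, ← sub_mul, abs_mul,
                abs_of_nonneg (policy_nonneg π x a), mul_comm]
              exact mul_le_mul_of_nonneg_left (h1 x hx P' hP') (policy_nonneg π x a)
          linarith
      _ = _ := sum_policy_mul_const _ _ _
  calc _ ≤ ∑ x with L.layer x < H, 6 * L.value P π (G x) :=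
        Finset.sum_le_sum fun x hx => h2 x (Finset.mem_filter.1 hx).2
    _ = 6 * L.value P π fun y a => ∑ x with L.layer x < H, G x y a := by
        rw [← Finset.mul_sum, Layering.value, valueToGo_sum]
        rfl
    _ ≤ 6 * L.value P π fun y a => 8 * H * √(L.width (L.layer y + 1) * (ι / max 1 (N₂ y a : ℝ)))
        + 156 * (Fintype.card X) ^ 2 * H * (ι / max 1 (N₂ y a : ℝ)) := by
        refine mul_le_mul_of_nonneg_left (value_mono hP.1 fun y a hy => ?_) (by norm_num)
        have hr0 := rate_nonneg (N₂ := N₂) hι y a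
        have hX1 : (1 : ℝ) ≤ Fintype.card X := by
          exact_mod_cast Fintype.card_pos_iff.2 ⟨y⟩
        have h3 : ∑ x with L.layer x < H, ∑ z, L.deviation ι N₂ P y a z *
            valueToGo P π (fun z _ => if z = x then 1 else 0) (H - (L.layer y + 1)) z
            ≤ H * ∑ z, L.deviation ι N₂ P y a z := by
          rw [Finset.sum_comm, Finset.mul_sum]
          refine Finset.sum_le_sum fun z _ => ?_
          rw [← Finset.mul_sum, mul_comm]
          refine mul_le_mul_of_nonneg_right ?_ (deviation_nonneg hι y a z)
          rw [← valueToGo_sum]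
          refine (valueToGo_le P π (c := 1) (fun z' _ => ?_) _ _).trans ?_
          · rw [Finset.sum_ite_eq]
            split_ifs <;> simp
          · rw [mul_one]
            exact_mod_cast Nat.sub_le _ _
        have h4 : ∑ x with L.layer x < H, β y a ≤ Fintype.card X * β y a := by
          rw [Finset.sum_const, nsmul_eq_mul]
          refine mul_le_mul_of_nonneg_right ?_ (by simp only [hβ]; positivity)
          exact_mod_cast Finset.card_le_univ _
        have h5 := sum_deviation_le (L := L) (P := P) (N₂ := N₂) hι y a
        have hH0 : (0 : ℝ) ≤ H := Nat.cast_nonneg _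
        have h6 := mul_le_mul_of_nonneg_left h5 hH0
        simp only [hG, Finset.sum_add_distrib]
        set r := ι / max 1 (N₂ y a : ℝ)
        have h7 : (Fintype.card X : ℝ) * (H * r) ≤ (Fintype.card X) ^ 2 * (H * r) := by
          refine mul_le_mul_of_nonneg_right ?_ (by positivity)
          nlinarith
        simp only [hβ] at h4 ⊢
        linarith
    _ = _ := by
        rw [value_eq_sum_occ hP.1, Finset.mul_sum]
        refine Finset.sum_congr rfl fun y _ => ?_
        rw [Finset.mul_sum]
        exact Finset.sum_congr rfl fun a _ => by ring

end Width

/-! ### Exponential weights -/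

theorem exp_neg_le_of_neg_one_le {y : ℝ} (hy : -1 ≤ y) : Real.exp (-y) ≤ 1 - y + y ^ 2 := by
  rcases le_total y 1 with h | h
  · have := abs_le.1 (Real.abs_exp_sub_one_sub_id_le (x := -y) (abs_le.2 ⟨by linarith, by linarith⟩))
    nlinarith [this.2]
  · have : Real.exp (-y) ≤ 1 := Real.exp_le_one_iff.2 (by linarith)
    nlinarith

/-- Potential argument with log ∑ exp(-ηS). Only a lower bound on `η * f` is needed, which suits
estimators that are nonnegative up to a small bonus. -/
theorem exp_weights_le [Nonempty A] {η : ℝ} (hη : 0 < η) (S f p : ℕ → A → ℝ) (n : ℕ)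
    (hS0 : ∀ a, S 0 a = 0) (hS : ∀ t < n, ∀ a, S (t + 1) a = S t a + f t a)
    (hf : ∀ t < n, ∀ a, -1 ≤ η * f t a)
    (hp : ∀ t a, p t a = Real.exp (-η * S t a) / ∑ b, Real.exp (-η * S t b)) (c : A) :
    ∑ t ∈ range n, (∑ a, p t a * f t a) - ∑ t ∈ range n, f t c
      ≤ Real.log (Fintype.card A) / η + ∑ t ∈ range n, η * ∑ a, p t a * f t a ^ 2 := by
  set Φ : ℕ → ℝ := fun t => ∑ b, Real.exp (-η * S t b) with hΦ
  have hΦ0 : ∀ t, 0 < Φ t := fun t =>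
    Finset.sum_pos (fun _ _ => Real.exp_pos _) Finset.univ_nonempty
  have hsum : ∀ m ≤ n, S m c = ∑ t ∈ range m, f t c := by
    intro m
    induction m with
    | zero => simp [hS0]
    | succ m ih =>
      intro hm
      rw [hS m (by omega), ih (by omega), Finset.sum_range_succ]
  have hlog : ∀ m ≤ n, Real.log (Φ m) ≤ Real.log (Fintype.card A)
      + ∑ t ∈ range m, (-η * (∑ a, p t a * f t a) + η ^ 2 * ∑ a, p t a * f t a ^ 2) := by
    intro m
    induction m with
    | zero =>
      intro _
      simp [hΦ, hS0]
    | succ m ih =>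
      intro hm
      rw [Finset.sum_range_succ, ← add_assoc]
      have h1 : Φ (m + 1) = Φ m * ∑ a, p m a * Real.exp (-(η * f m a)) := by
        rw [Finset.mul_sum]
        refine Finset.sum_congr rfl fun a _ => ?_
        rw [hp, hS m (by omega), mul_add, Real.exp_add]
        change _ = Φ m * (Real.exp (-η * S m a) / Φ m * _)
        rw [← mul_assoc, mul_div_cancel₀ _ (hΦ0 m).ne', neg_mul η (f m a)]
      have hp0 : ∀ a, 0 ≤ p m a := fun a => by
        rw [hp]
        exact div_nonneg (Real.exp_pos _).le (hΦ0 m).le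
      have hp1 : ∑ a, p m a = 1 := by
        simp only [hp]
        rw [← Finset.sum_div]
        exact div_self (hΦ0 m).ne'
      have h2 : ∑ a, p m a * Real.exp (-(η * f m a))
          ≤ 1 + (-η * (∑ a, p m a * f m a) + η ^ 2 * ∑ a, p m a * f m a ^ 2) := by
        calc _ ≤ ∑ a, p m a * (1 - η * f m a + (η * f m a) ^ 2) :=
              Finset.sum_le_sum fun a _ => mul_le_mul_of_nonneg_left
                (exp_neg_le_of_neg_one_le (hf m (by omega) a)) (hp0 a)
          _ = ∑ a, p m a + (-η * (∑ a, p m a * f m a) + η ^ 2 * ∑ a, p m a * f m a ^ 2) := by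
              rw [Finset.mul_sum, Finset.mul_sum, ← Finset.sum_add_distrib,
                ← Finset.sum_add_distrib]
              exact Finset.sum_congr rfl fun a _ => by ring
          _ = _ := by rw [hp1]
      have h3 : 0 < ∑ a, p m a * Real.exp (-(η * f m a)) :=
        pos_of_mul_pos_right (h1 ▸ hΦ0 (m + 1)) (hΦ0 m).le
      rw [h1, Real.log_mul (hΦ0 m).ne' h3.ne']
      refine add_le_add (ih (by omega)) ?_
      linarith [Real.log_le_sub_one_of_pos h3]
  have h4 : -η * S n c ≤ Real.log (Φ n) := by
    rw [Real.le_log_iff_exp_le (hΦ0 n)]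
    exact Finset.single_le_sum (f := fun b => Real.exp (-η * S n b))
      (fun b _ => (Real.exp_pos _).le) (Finset.mem_univ c)
  have h5 := h4.trans (hlog n le_rfl)
  rw [Finset.sum_add_distrib, ← Finset.mul_sum, ← Finset.mul_sum, hsum n le_rfl] at h5
  rw [← Finset.mul_sum, ← sub_le_iff_le_add, le_div_iff₀ hη]
  nlinarith

/-- Regret of exponential weights against a distribution. -/
theorem exp_weights_regret_le [Nonempty A] {η : ℝ} (hη : 0 < η) (S f p : ℕ → A → ℝ) (n : ℕ)
    (hS0 : ∀ a, S 0 a = 0) (hS : ∀ t < n, ∀ a, S (t + 1) a = S t a + f t a)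
    (hf : ∀ t < n, ∀ a, -1 ≤ η * f t a)
    (hp : ∀ t a, p t a = Real.exp (-η * S t a) / ∑ b, Real.exp (-η * S t b))
    (r : stdSimplex ℝ A) :
    ∑ t ∈ range n, ∑ a, (p t a - r a) * f t a
      ≤ Real.log (Fintype.card A) / η + ∑ t ∈ range n, η * ∑ a, p t a * f t a ^ 2 := by
  have hr0 : ∀ a, 0 ≤ r a := r.2.1
  have hr1 : ∑ a, r a = 1 := r.2.2
  set R := Real.log (Fintype.card A) / η + ∑ t ∈ range n, η * ∑ a, p t a * f t a ^ 2
  set U := ∑ t ∈ range n, ∑ a, p t a * f t a with hU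
  have h1 : ∑ a, r a * (U - ∑ t ∈ range n, f t a) ≤ ∑ a, r a * R :=
    Finset.sum_le_sum fun a _ => mul_le_mul_of_nonneg_left
      (exp_weights_le hη S f p n hS0 hS hf hp a) (hr0 a)
  rw [← Finset.sum_mul, hr1, one_mul] at h1
  refine le_trans (le_of_eq ?_) h1
  simp only [mul_sub, Finset.sum_sub_distrib, sub_mul]
  rw [← Finset.sum_mul, hr1, one_mul, hU]
  congr 1
  rw [Finset.sum_comm]
  exact Finset.sum_congr rfl fun a _ => by rw [Finset.mul_sum]

/-! ### The learning parameters -/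

section Parameters

variable [Nonempty A] [Nonempty X] {T : ℕ}

theorem card_pos' (Y : Type*) [Fintype Y] [Nonempty Y] : (0 : ℝ) < Fintype.card Y := by
  exact_mod_cast Fintype.card_pos

theorem eta_pos (hH : 1 ≤ H) (hT : 1 ≤ T) : 0 < eta X A H T := by
  have h1 : (0 : ℝ) < H := by exact_mod_cast hH
  have h2 : (0 : ℝ) < T := by exact_mod_cast hT
  have h3 := card_pos' X
  have h4 := card_pos' A
  exact lt_min (by positivity) (by positivity)

theorem gam_pos (hH : 1 ≤ H) (hT : 1 ≤ T) : 0 < gam X A H T := by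
  have h1 : (0 : ℝ) < H := by exact_mod_cast hH
  have := eta_pos (X := X) (A := A) hH hT
  unfold gam
  positivity

/-- The purpose of the cap 1/(24H³) on the learning rate: with `dilatedBonus_le` it gives ηB ≤
1/(2H), so ηB² is at most a 1/H-fraction of B, which the dilation pays for. -/
theorem eta_mul_le (hH : 1 ≤ H) : eta X A H T * (12 * (H : ℝ) ^ 2) ≤ 1 / (2 * H) := by
  have h1 : (0 : ℝ) < H := by exact_mod_cast hH
  calc _ ≤ 1 / (24 * (H : ℝ) ^ 3) * (12 * (H : ℝ) ^ 2) :=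
        mul_le_mul_of_nonneg_right (min_le_left _ _) (by positivity)
    _ = 1 / (2 * H) := by field_simp; norm_num

end Parameters

/-! ### Expectations of the loss estimators -/

section Estimator

variable {L : Layering X H} {P : Transition X A} {K : Set (Transition X A)} {γ : ℝ}
  {π π' : Policy X A} {ℓ : X → A → ℝ}

theorem expect_value {Ω : Type*} [Fintype Ω] (p : PMF Ω) (f : Ω → X → A → ℝ) :
    expect p (fun ω => L.value P π (f ω)) = L.value P π fun x a => expect p fun ω => f ω x a := by
  simp only [expect, Layering.value]
  rw [valueToGo_sum]
  exact Finset.sum_congr rfl fun ω _ => (valueToGo_const_mul _ _ _ _ _ _).symm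

/-- Conditional expectation of the loss estimator. -/
def Layering.qMean (L : Layering X H) (P : Transition X A) (γ : ℝ) (K : Set (Transition X A))
    (π : Policy X A) (ℓ : X → A → ℝ) (x : X) (a : A) : ℝ :=
  L.occ P π x a * L.qValue P π ℓ x a / (L.upperOcc K π x a + γ)

theorem expect_qHat {x : X} (hx : L.layer x < H) (a : A) :
    expect (trajectoryLaw P π L.init H) (fun τ => L.qHat γ K π (τ.observe ℓ) x a)
      = L.qMean P γ K π ℓ x a := by
  simp only [qHat_eq, div_eq_inv_mul]
  rw [expect_const_mul, expect_visit_mul_lossFrom hx, Layering.qMean, div_eq_inv_mul]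

theorem qHat_nonneg (hγ : 0 < γ) (hℓ : ∀ x a, 0 ≤ ℓ x a) (τ : Trajectory X A H) (x : X) (a : A) :
    0 ≤ L.qHat γ K π (τ.observe ℓ) x a := by
  rw [qHat_eq]
  exact div_nonneg (mul_nonneg (visit_nonneg _ _ _ _) (lossFrom_nonneg hℓ _ _))
    (upperOcc_add_pos hγ x a).le

theorem qHat_sq_le (hγ : 0 < γ) (hℓ : ∀ x a, ℓ x a ∈ Set.Icc (0 : ℝ) 1) (τ : Trajectory X A H)
    (x : X) (a : A) :
    L.qHat γ K π (τ.observe ℓ) x a ^ 2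
      ≤ (H : ℝ) ^ 2 / (L.upperOcc K π x a + γ) ^ 2 * τ.visit (L.layer x) x a := by
  have hq := upperOcc_add_pos (L := L) (K := K) (π := π) hγ x a
  have h1 := lossFrom_nonneg (fun x a => (hℓ x a).1) τ (L.layer x)
  have h2 := lossFrom_le (fun x a => (hℓ x a).2) τ (L.layer x)
  rw [qHat_eq, div_pow, div_mul_eq_mul_div]
  refine div_le_div_of_nonneg_right ?_ (by positivity)
  rcases visit_eq_zero_or_one τ (L.layer x) x a with h | h
  · simp [h]
  · rw [h, one_mul, mul_one]
    exact pow_le_pow_left₀ h1 h2 2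

theorem sq_sum_policy_le (π : Policy X A) (x : X) (f : A → ℝ) :
    (∑ a, π x a * f a) ^ 2 ≤ ∑ a, π x a * f a ^ 2 := by
  set m := ∑ a, π x a * f a with hm
  have h1 : 0 ≤ ∑ a, π x a * (f a - m) ^ 2 :=
    Finset.sum_nonneg fun a _ => mul_nonneg (policy_nonneg _ _ _) (sq_nonneg _)
  have h2 : ∀ c : ℝ, ∑ a, π x a * (f a - c) ^ 2
      = ∑ a, π x a * f a ^ 2 - 2 * c * (∑ a, π x a * f a) + c ^ 2 * ∑ a, π x a := by
    intro c
    rw [Finset.mul_sum, Finset.mul_sum, ← Finset.sum_sub_distrib, ← Finset.sum_add_distrib]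
    exact Finset.sum_congr rfl fun a _ => by ring
  rw [h2, ← hm, sum_policy] at h1
  linarith

/-- Cauchy-Schwarz over the steps costs `H`, Jensen over the actions nothing, the squared losses H².
The expected visit is at most the upper occupancy bound and cancels one of the two denominators. -/
theorem expect_value_qHat_sq_le (hH : 1 ≤ H) (hγ : 0 < γ) (hP : P ∈ K) (hresp : L.Respects P)
    (hℓ : ∀ x a, ℓ x a ∈ Set.Icc (0 : ℝ) 1) :
    expect (trajectoryLaw P π L.init H) (fun τ =>
      (L.value P π' fun x _ => ∑ a, π x a * L.qHat γ K π (τ.observe ℓ) x a) ^ 2)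
    ≤ (H : ℝ) ^ 3 * L.value P π' fun x _ => ∑ a, π x a * (1 / (L.upperOcc K π x a + γ)) := by
  have h1 : ∀ τ : Trajectory X A H,
      (L.value P π' fun x _ => ∑ a, π x a * L.qHat γ K π (τ.observe ℓ) x a) ^ 2
      ≤ H * L.value P π' fun x _ => ∑ a, π x a *
        ((H : ℝ) ^ 2 / (L.upperOcc K π x a + γ) ^ 2 * τ.visit (L.layer x) x a) := by
    intro τ
    refine (value_sq_le hresp hH _).trans (mul_le_mul_of_nonneg_left ?_ (Nat.cast_nonneg _))
    refine value_mono hresp fun x _ _ => ?_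
    refine (sq_sum_policy_le π x _).trans ?_
    exact sum_policy_mul_le _ _ fun a => qHat_sq_le hγ hℓ τ x a
  refine (expect_mono _ fun τ _ => h1 τ).trans ?_
  rw [expect_const_mul, expect_value]
  simp_rw [expect_sum, expect_const_mul]
  have h2 : (L.value P π' fun x _ => ∑ a, π x a * ((H : ℝ) ^ 2 / (L.upperOcc K π x a + γ) ^ 2 *
      expect (trajectoryLaw P π L.init H) fun τ : Trajectory X A H => τ.visit (L.layer x) x a))
      ≤ L.value P π' fun x a' => (H : ℝ) ^ 2 *
        (fun x _ => ∑ a, π x a * (1 / (L.upperOcc K π x a + γ))) x a' := by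
    refine value_mono hresp fun x _ hx => ?_
    rw [Finset.mul_sum]
    refine Finset.sum_le_sum fun a _ => ?_
    rw [expect_visit_eq_occ hx, mul_left_comm ((H : ℝ) ^ 2)]
    refine mul_le_mul_of_nonneg_left ?_ (policy_nonneg π x a)
    have hq := upperOcc_add_pos (L := L) (K := K) (π := π) hγ x a
    rw [div_mul_eq_mul_div, mul_one_div, div_le_div_iff₀ (by positivity) hq]
    have h3 := occ_le_upperOcc L hP π x a
    have h4 : L.occ P π x a * (L.upperOcc K π x a + γ) ≤ (L.upperOcc K π x a + γ) ^ 2 := by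
      rw [sq]
      exact mul_le_mul_of_nonneg_right (by linarith) hq.le
    have := mul_le_mul_of_nonneg_left h4 (sq_nonneg (H : ℝ))
    linarith
  refine (mul_le_mul_of_nonneg_left h2 (Nat.cast_nonneg H)).trans_eq ?_
  rw [Layering.value, valueToGo_const_mul]
  simp only [Layering.value]
  ring

/-- The average over the visits of the fixed policy `π'` is treated as one nonnegative variable, so
the deviation is paid for once and not at every state. Nonnegativity makes any `lam ≥ 0` admissible.
-/
theorem expect_exp_value_qHat_le (hH : 1 ≤ H) (hγ : 0 < γ) (hP : P ∈ K) (hresp : L.Respects P)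
    (hℓ : ∀ x a, ℓ x a ∈ Set.Icc (0 : ℝ) 1) {lam : ℝ} (hlam : 0 ≤ lam) :
    expect (trajectoryLaw P π L.init H) (fun τ => Real.exp (lam *
      ((L.value P π' fun x _ => ∑ a, π x a * L.qMean P γ K π ℓ x a)
        - L.value P π' fun x _ => ∑ a, π x a * L.qHat γ K π (τ.observe ℓ) x a)
      - lam ^ 2 / 2 * ((H : ℝ) ^ 3 *
        L.value P π' fun x _ => ∑ a, π x a * (1 / (L.upperOcc K π x a + γ))))) ≤ 1 := by
  have h1 : (L.value P π' fun x _ => ∑ a, π x a * L.qMean P γ K π ℓ x a)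
      = expect (trajectoryLaw P π L.init H) fun τ =>
        L.value P π' fun x _ => ∑ a, π x a * L.qHat γ K π (τ.observe ℓ) x a := by
    rw [expect_value]
    refine value_congr hresp fun x _ hx => ?_
    simp only [expect_sum, expect_const_mul, expect_qHat hx]
  rw [h1]
  refine expect_exp_lower_le _ (fun τ _ => ?_) hlam
    (expect_value_qHat_sq_le hH hγ hP hresp hℓ)
  exact value_nonneg hresp fun x _ _ => Finset.sum_nonneg fun a _ =>
    mul_nonneg (policy_nonneg _ _ _) (qHat_nonneg hγ (fun x a => (hℓ x a).1) τ x a)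

end Estimator

/-! ### Concentration along the run, and the regret -/

section Regret

variable [Nonempty A]

open Classical in
/-- Overestimation of the `Q`-function at `(x,a)`. -/
def Layering.overestimate (L : Layering X H) (T : ℕ) (P : Transition X A)
    (ℓ : ℕ → X → A → ℝ) (x : X) (a : A) (t : ℕ) (s : AlgState X A) (τ : Trajectory X A H) : ℝ :=
  if P ∈ s.conf ∧ L.layer x < H then
    2 * gam X A H T / H * (L.qHat (gam X A H T) s.conf (s.policy H T) (τ.observe (ℓ t)) x a
      - L.qValue P (s.policy H T) (ℓ t) x a) else 0

/-- Weights of the visits of `x` in the second moment of the loss estimator. -/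
def Layering.momentWeight (L : Layering X H) (T : ℕ) (s : AlgState X A) (x : X) (a : A) : ℝ :=
  s.policy H T x a * (gam X A H T / (L.upperOcc s.conf (s.policy H T) x a + gam X A H T))

open Classical in
/-- Fluctuation of the second moment of the loss estimator at `x`. -/
def Layering.momentExcess (L : Layering X H) (T : ℕ) (P : Transition X A)
    (x : X) (_t : ℕ) (s : AlgState X A) (τ : Trajectory X A H) : ℝ :=
  if P ∈ s.conf ∧ L.layer x < H then
    ∑ a, L.momentWeight T s x a * τ.visit (L.layer x) x a *
        (2 * gam X A H T / (L.upperOcc s.conf (s.policy H T) x a + gam X A H T))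
      - 2 * gam X A H T * ∑ a, L.momentWeight T s x a else 0

open Classical in
/-- Underestimation of the learner's `Q`-function, averaged over the comparator's visits. -/
def Layering.underestimate (L : Layering X H) (T : ℕ) (P : Transition X A)
    (ℓ : ℕ → X → A → ℝ) (π' : Policy X A) (t : ℕ) (s : AlgState X A)
    (τ : Trajectory X A H) : ℝ :=
  if P ∈ s.conf then
    2 * gam X A H T / H ^ 2 *
      ((L.value P π' fun x _ => ∑ a, s.policy H T x a *
          L.qMean P (gam X A H T) s.conf (s.policy H T) (ℓ t) x a)
        - L.value P π' fun x _ => ∑ a, s.policy H T x a *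
          L.qHat (gam X A H T) s.conf (s.policy H T) (τ.observe (ℓ t)) x a)
      - (2 * gam X A H T / H ^ 2) ^ 2 / 2 * ((H : ℝ) ^ 3 *
        L.value P π' fun x _ => ∑ a, s.policy H T x a *
          (1 / (L.upperOcc s.conf (s.policy H T) x a + gam X A H T))) else 0

variable {L : Layering X H} {T : ℕ} {δ : ℝ} {ℓ : ℕ → X → A → ℝ} {P : Transition X A}

theorem expect_exp_overestimate_le [Nonempty X] (hH : 1 ≤ H) (hT : 1 ≤ T)
    (hℓ : ∀ t x a, ℓ t x a ∈ Set.Icc (0 : ℝ) 1) (x : X) (a : A) (t : ℕ) (s : AlgState X A) :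
    expect (trajectoryLaw P (s.policy H T) L.init H)
      (fun τ => Real.exp (L.overestimate T P ℓ x a t s τ)) ≤ 1 := by
  unfold Layering.overestimate
  split_ifs with h
  · exact expect_exp_qHat_le hH (gam_pos hH hT) h.1 (hℓ t) h.2 a
  · rw [Real.exp_zero, expect_const]

theorem momentWeight_nonneg [Nonempty X] (hH : 1 ≤ H) (hT : 1 ≤ T) (s : AlgState X A) (x : X)
    (a : A) : 0 ≤ L.momentWeight T s x a :=
  mul_nonneg (policy_nonneg _ _ _)
    (div_nonneg (gam_pos hH hT).le (upperOcc_add_pos (gam_pos hH hT) x a).le)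

theorem expect_exp_momentExcess_le [Nonempty X] (hH : 1 ≤ H) (hT : 1 ≤ T) (x : X) (t : ℕ)
    (s : AlgState X A) :
    expect (trajectoryLaw P (s.policy H T) L.init H)
      (fun τ => Real.exp (L.momentExcess T P x t s τ)) ≤ 1 := by
  unfold Layering.momentExcess
  split_ifs with h
  · refine expect_exp_weighted_visits_le (gam_pos hH hT) h.1 h.2
      (fun a => momentWeight_nonneg hH hT s x a) fun a => ?_
    refine mul_le_one₀ (policy_le_one _ _ _) ?_ ?_
    · exact div_nonneg (gam_pos hH hT).le (upperOcc_add_pos (gam_pos hH hT) x a).le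
    · refine div_le_one_of_le₀ ?_ (upperOcc_add_pos (gam_pos hH hT) x a).le
      linarith [upperOcc_nonneg L s.conf (s.policy H T) x a]
  · rw [Real.exp_zero, expect_const]

theorem expect_exp_underestimate_le [Nonempty X] (hH : 1 ≤ H) (hT : 1 ≤ T) (hP : L.Respects P)
    (hℓ : ∀ t x a, ℓ t x a ∈ Set.Icc (0 : ℝ) 1) (π' : Policy X A) (t : ℕ) (s : AlgState X A) :
    expect (trajectoryLaw P (s.policy H T) L.init H)
      (fun τ => Real.exp (L.underestimate T P ℓ π' t s τ)) ≤ 1 := by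
  unfold Layering.underestimate
  split_ifs with h
  · refine expect_exp_value_qHat_le hH (gam_pos hH hT) h hP (hℓ t) ?_
    have := gam_pos (X := X) (A := A) hH hT
    positivity
  · rw [Real.exp_zero, expect_const]

theorem run_cumLoss_succ (τ : ℕ → Trajectory X A H) (n : ℕ) (x : X) (a : A) :
    (L.run T δ ℓ τ (n + 1)).cumLoss x a = (L.run T δ ℓ τ n).cumLoss x a +
      (L.qHat (gam X A H T) (L.run T δ ℓ τ n).conf ((L.run T δ ℓ τ n).policy H T)
          ((τ n).observe (ℓ n)) x a
        - L.dilatedBonus (gam X A H T) (L.run T δ ℓ τ n).conf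
          ((L.run T δ ℓ τ n).policy H T) x a) :=
  update_cumLoss _ _ _ _

/-- The exponential-weights part of the regret at a state. -/
theorem sum_policy_sub_mul_estimator_le [Nonempty X] (hH : 1 ≤ H) (hT : 1 ≤ T)
    (hℓ : ∀ t x a, ℓ t x a ∈ Set.Icc (0 : ℝ) 1) {τ : ℕ → Trajectory X A H}
    (hconf : ∀ t < T, P ∈ (L.run T δ ℓ τ t).conf) {ι : ℝ}
    {x : X} (hx : L.layer x < H) (hmom : L.runSum T δ ℓ (L.momentExcess T P x) τ T ≤ ι)
    (π' : Policy X A) :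
    ∑ t ∈ range T, ∑ a, ((L.run T δ ℓ τ t).policy H T x a - π' x a) *
      (L.qHat (gam X A H T) (L.run T δ ℓ τ t).conf ((L.run T δ ℓ τ t).policy H T)
          ((τ t).observe (ℓ t)) x a
        - L.dilatedBonus (gam X A H T) (L.run T δ ℓ τ t).conf
          ((L.run T δ ℓ τ t).policy H T) x a)
    ≤ Real.log (Fintype.card A) / eta X A H T + ι / (8 * eta X A H T) +
      ∑ t ∈ range T, (H * (∑ a, L.momentWeight T (L.run T δ ℓ τ t) x a) + 1 / H *
        ∑ a, (L.run T δ ℓ τ t).policy H T x a * L.dilatedBonus (gam X A H T)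
          (L.run T δ ℓ τ t).conf ((L.run T δ ℓ τ t).policy H T) x a) := by
  have hη : 0 < eta X A H T := eta_pos hH hT
  have hγ : 0 < gam X A H T := gam_pos hH hT
  have hγη : gam X A H T = 2 * eta X A H T * H := rfl
  have hηB := eta_mul_le (X := X) (A := A) (H := H) (T := T) hH
  have hH' : (0 : ℝ) < H := by exact_mod_cast hH
  set η := eta X A H T
  set γ := gam X A H T
  set s := L.run T δ ℓ τ with hs
  set Q : ℕ → A → ℝ := fun t a =>
    L.qHat γ (s t).conf ((s t).policy H T) ((τ t).observe (ℓ t)) x a with hQ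
  set B : ℕ → A → ℝ := fun t a => L.dilatedBonus γ (s t).conf ((s t).policy H T) x a with hB
  have hQ0 : ∀ t a, 0 ≤ Q t a := fun t a =>
    qHat_nonneg hγ (fun x a => (hℓ t x a).1) (τ t) x a
  have hB0 : ∀ t < T, ∀ a, 0 ≤ B t a := fun t ht a =>
    dilatedBonus_nonneg ⟨P, hconf t ht⟩ hγ x a
  have hB1 : ∀ t < T, ∀ a, η * B t a ≤ 1 / (2 * H) := fun t ht a =>
    (mul_le_mul_of_nonneg_left (dilatedBonus_le hH ⟨P, hconf t ht⟩ hγ x a) hη.le).trans hηB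
  have hhalf : 1 / (2 * (H : ℝ)) ≤ 1 := by
    rw [div_le_one (by positivity)]
    have : (1 : ℝ) ≤ H := by exact_mod_cast hH
    linarith
  have h1 := exp_weights_regret_le hη (fun t => (s t).cumLoss x) (fun t a => Q t a - B t a)
    (fun t a => (s t).policy H T x a) T (fun a => rfl)
    (fun t _ a => run_cumLoss_succ τ t x a)
    (fun t ht a => by nlinarith [hB1 t ht a, mul_nonneg hη.le (hQ0 t a)])
    (fun t a => rfl) (π' x)
  refine h1.trans ?_
  rw [add_assoc]
  refine add_le_add le_rfl ?_
  -- Since Q̂ and B are nonnegative, (Q̂ - B)² ≤ Q̂² + B². The choice of η gives ηB² ≤ B/H. The term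
  -- ηQ̂² is expressed through `momentExcess`; because γ = 2ηH its compensator becomes (H/2) times
  -- the sum of the weights, half of one F_t.
  have h2 : ∀ t < T, η * ∑ a, (s t).policy H T x a * (Q t a - B t a) ^ 2
      ≤ η * (H : ℝ) ^ 2 / (2 * γ ^ 2) * L.momentExcess T P x t (s t) (τ t) +
        (H * (∑ a, L.momentWeight T (s t) x a) +
          1 / H * ∑ a, (s t).policy H T x a * B t a) := by
    intro t ht
    have h3 : ∀ a, η * ((s t).policy H T x a * (Q t a - B t a) ^ 2)
        ≤ η * (H : ℝ) ^ 2 / (2 * γ ^ 2) * (L.momentWeight T (s t) x a *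
          (τ t).visit (L.layer x) x a *
          (2 * γ / (L.upperOcc (s t).conf ((s t).policy H T) x a + γ)))
          + 1 / H * ((s t).policy H T x a * B t a) := by
      intro a
      have hq := upperOcc_add_pos (L := L) (K := (s t).conf) (π := (s t).policy H T) hγ x a
      have h4 := qHat_sq_le (L := L) (K := (s t).conf) (π := (s t).policy H T) hγ (hℓ t) (τ t) x a
      have h5 : η * (H : ℝ) ^ 2 / (2 * γ ^ 2) * (L.momentWeight T (s t) x a *
          (τ t).visit (L.layer x) x a *
          (2 * γ / (L.upperOcc (s t).conf ((s t).policy H T) x a + γ)))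
          = (s t).policy H T x a * (η * ((H : ℝ) ^ 2 /
            (L.upperOcc (s t).conf ((s t).policy H T) x a + γ) ^ 2 *
            (τ t).visit (L.layer x) x a)) := by
        rw [Layering.momentWeight, show gam X A H T = γ from rfl]
        field_simp
      rw [h5, mul_left_comm, mul_left_comm (1 / (H : ℝ)), ← mul_add]
      refine mul_le_mul_of_nonneg_left ?_ (policy_nonneg _ _ _)
      have h6 : (Q t a - B t a) ^ 2 ≤ Q t a ^ 2 + B t a ^ 2 := by
        nlinarith [mul_nonneg (hQ0 t a) (hB0 t ht a)]
      have h7 : η * B t a ^ 2 ≤ 1 / H * B t a := by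
        rw [sq, ← mul_assoc]
        refine mul_le_mul_of_nonneg_right ((hB1 t ht a).trans ?_) (hB0 t ht a)
        exact one_div_le_one_div_of_le hH' (by linarith)
      have h8 := mul_le_mul_of_nonneg_left h4 hη.le
      have h9 := mul_le_mul_of_nonneg_left h6 hη.le
      have h10 : η * Q t a ^ 2 = η * (L.qHat γ (s t).conf ((s t).policy H T)
        ((τ t).observe (ℓ t)) x a) ^ 2 := rfl
      linarith
    rw [Finset.mul_sum]
    refine (Finset.sum_le_sum fun a _ => h3 a).trans ?_
    rw [Finset.sum_add_distrib, ← Finset.mul_sum, ← Finset.mul_sum, ← add_assoc]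
    refine add_le_add ?_ le_rfl
    rw [Layering.momentExcess, if_pos ⟨hconf t ht, hx⟩, mul_sub]
    have h11 : η * (H : ℝ) ^ 2 / (2 * γ ^ 2) * (2 * γ * ∑ a, L.momentWeight T (s t) x a)
        = H / 2 * ∑ a, L.momentWeight T (s t) x a := by
      rw [hγη]
      field_simp
    have h12 : 0 ≤ H / 2 * ∑ a, L.momentWeight T (s t) x a :=
      mul_nonneg (by positivity) (Finset.sum_nonneg fun a _ => momentWeight_nonneg hH hT _ x a)
    rw [h11]
    linarith
  refine (Finset.sum_le_sum fun t ht => h2 t (Finset.mem_range.1 ht)).trans ?_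
  rw [Finset.sum_add_distrib, ← Finset.mul_sum]
  refine add_le_add ?_ le_rfl
  have h13 : ι / (8 * η) = η * (H : ℝ) ^ 2 / (2 * γ ^ 2) * ι := by
    rw [hγη]
    field_simp
    norm_num
  rw [h13]
  exact mul_le_mul_of_nonneg_left hmom (by positivity)

/-- The bias is Q(q̄ + γ - q)/(q̄ + γ), where Q ≤ H and q is at least the lower bound. Compared with
the bonus it leaves 2Hγ/(q̄ + γ) unspent, the reserve for the second moment and the fluctuation. -/
theorem qValue_sub_qMean_le {K : Set (Transition X A)} {γ : ℝ} (hγ : 0 < γ) {π : Policy X A}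
    (hP : P ∈ K) {f : X → A → ℝ} (hf : ∀ x a, f x a ∈ Set.Icc (0 : ℝ) 1) {x : X}
    (hx : L.layer x < H) (a : A) :
    L.qValue P π f x a - L.qMean P γ K π f x a
      ≤ (3 * γ * H + H * (L.upperOcc K π x a - L.lowerOcc K π x a)) / (L.upperOcc K π x a + γ)
        - 2 * H * (γ / (L.upperOcc K π x a + γ)) := by
  have hq := upperOcc_add_pos (L := L) (K := K) (π := π) hγ x a
  have h1 := lowerOcc_le_occ L hP π x a
  have h2 := occ_le_upperOcc L hP π x a
  have h3 := qValue_nonneg L P π (fun x a => (hf x a).1) x a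
  have h4 := qValue_le (L := L) P π (fun x a => (hf x a).2) hx a
  have h5 : L.qValue P π f x a - L.qMean P γ K π f x a
      = L.qValue P π f x a * (L.upperOcc K π x a + γ - L.occ P π x a)
        / (L.upperOcc K π x a + γ) := by
    unfold Layering.qMean
    field_simp
  have h6 : (3 * γ * H + H * (L.upperOcc K π x a - L.lowerOcc K π x a)) / (L.upperOcc K π x a + γ)
        - 2 * H * (γ / (L.upperOcc K π x a + γ))
      = H * (L.upperOcc K π x a + γ - L.lowerOcc K π x a) / (L.upperOcc K π x a + γ) := by
    field_simp
    ring
  rw [h5, h6]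
  refine div_le_div_of_nonneg_right ?_ hq.le
  exact mul_le_mul h4 (by linarith) (by linarith) (Nat.cast_nonneg _)

/-- The regret against a fixed policy is controlled by the dilated bonuses. -/
theorem sum_value_sub_value_le [Nonempty X] (hH : 1 ≤ H) (hT : 1 ≤ T) (hP : L.Respects P)
    (hℓ : ∀ t x a, ℓ t x a ∈ Set.Icc (0 : ℝ) 1) {τ : ℕ → Trajectory X A H}
    (hconf : ∀ t < T, P ∈ (L.run T δ ℓ τ t).conf) {ι : ℝ} (hι : Real.log (Fintype.card A) ≤ ι)
    (π' : Policy X A)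
    (hover : ∀ x a, L.runSum T δ ℓ (L.overestimate T P ℓ x a) τ T ≤ ι)
    (hmom : ∀ x, L.runSum T δ ℓ (L.momentExcess T P x) τ T ≤ ι)
    (hunder : L.runSum T δ ℓ (L.underestimate T P ℓ π') τ T ≤ ι) :
    ∑ t ∈ range T, (L.value P ((L.run T δ ℓ τ t).policy H T) (ℓ t) - L.value P π' (ℓ t))
      ≤ 2 * H * ι / eta X A H T + ∑ t ∈ range T, (1 + 1 / (H : ℝ)) *
        ∑ a, (L.run T δ ℓ τ t).policy H T L.init a * L.dilatedBonus (gam X A H T)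
          (L.run T δ ℓ τ t).conf ((L.run T δ ℓ τ t).policy H T) L.init a := by
  have hη : 0 < eta X A H T := eta_pos hH hT
  have hγ : 0 < gam X A H T := gam_pos hH hT
  have hγη : gam X A H T = 2 * eta X A H T * H := rfl
  have hH' : (0 : ℝ) < H := by exact_mod_cast hH
  have hι0 : 0 ≤ ι := (Real.log_nonneg (by exact_mod_cast Fintype.card_pos)).trans hι
  have hew := fun x hx => sum_policy_sub_mul_estimator_le (L := L) (δ := δ) hH hT hℓ hconf
    (x := x) hx (hmom x) π'
  set η := eta X A H T
  set γ := gam X A H T with hγdef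
  set s := L.run T δ ℓ τ with hs
  set p : ℕ → Policy X A := fun t => (s t).policy H T with hp
  set Qv : ℕ → X → A → ℝ := fun t => L.qValue P (p t) (ℓ t) with hQv
  set Qm : ℕ → X → A → ℝ := fun t => L.qMean P γ (s t).conf (p t) (ℓ t) with hQm
  set Qh : ℕ → X → A → ℝ := fun t => L.qHat γ (s t).conf (p t) ((τ t).observe (ℓ t)) with hQh
  set B : ℕ → X → A → ℝ := fun t => L.dilatedBonus γ (s t).conf (p t) with hB
  set b : ℕ → X → ℝ := fun t => L.bonus γ (s t).conf (p t) with hb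
  set F : ℕ → X → ℝ := fun t x => H * ∑ a, L.momentWeight T (s t) x a with hF
  set W : ℕ → X → ℝ := fun t x => ∑ a, p t x a * B t x a with hW
  set W' : ℕ → X → ℝ := fun t x => ∑ a, π' x a * B t x a with hW'
  -- fluctuations of the estimators under the learner's policies
  have hT2 : ∑ t ∈ range T, ((L.value P π' fun x _ => ∑ a, p t x a * Qm t x a)
      - L.value P π' fun x _ => ∑ a, p t x a * Qh t x a)
      ≤ H * ι / (4 * η) + ∑ t ∈ range T, L.value P π' fun x _ => F t x := by
    -- With this parameter the variance term (λ²/2) H³ ∑ π/(q̄ + γ) is exactly λ F_t, and ι/λ =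
    -- Hι/(4η).
    set lam := 2 * γ / (H : ℝ) ^ 2 with hlam
    have hlam0 : 0 < lam := by positivity
    have h1 : ∀ t ∈ range T, L.underestimate T P ℓ π' t (s t) (τ t)
        = lam * ((L.value P π' fun x _ => ∑ a, p t x a * Qm t x a)
          - L.value P π' fun x _ => ∑ a, p t x a * Qh t x a)
          - lam * L.value P π' fun x _ => F t x := by
      intro t ht
      rw [Layering.underestimate, if_pos (hconf t (Finset.mem_range.1 ht))]
      congr 1
      have h2 : (fun x (_ : A) => F t x) = fun x _ => (H * γ) * ∑ a, (s t).policy H T x a *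
          (1 / (L.upperOcc (s t).conf ((s t).policy H T) x a + gam X A H T)) := by
        funext x _
        simp only [hF, Layering.momentWeight]
        rw [Finset.mul_sum, Finset.mul_sum]
        exact Finset.sum_congr rfl fun a _ => by rw [← hγdef]; ring
      rw [h2, Layering.value, Layering.value, valueToGo_const_mul, ← hγdef, ← hlam]
      rw [← mul_assoc, ← mul_assoc]
      congr 1
      rw [hlam]
      field_simp
    rw [Layering.runSum, Finset.sum_congr rfl h1, Finset.sum_sub_distrib, ← Finset.mul_sum,
      ← Finset.mul_sum] at hunder
    have h3 : ι = lam * (H * ι / (4 * η)) := by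
      rw [hlam, hγη]
      field_simp
      norm_num
    rw [h3] at hunder
    rw [← sub_le_iff_le_add]
    refine le_of_mul_le_mul_left ?_ hlam0
    rw [mul_sub]
    exact hunder
  -- overestimation under the comparator
  have hT3 : ∀ x, L.layer x < H →
      ∑ t ∈ range T, ∑ a, π' x a * (Qh t x a - Qv t x a) ≤ ι / (4 * η) := by
    intro x hx
    rw [Finset.sum_comm]
    have h1 : ∀ a, ∑ t ∈ range T, (Qh t x a - Qv t x a) ≤ ι / (4 * η) := by
      intro a
      have h2 := hover x a
      have h3 : ∀ t ∈ range T, L.overestimate T P ℓ x a t (s t) (τ t)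
          = 2 * γ / H * (Qh t x a - Qv t x a) := by
        intro t ht
        rw [Layering.overestimate, if_pos ⟨hconf t (Finset.mem_range.1 ht), hx⟩]
      rw [Layering.runSum, Finset.sum_congr rfl h3, ← Finset.mul_sum] at h2
      have h4 : ι = 2 * γ / H * (ι / (4 * η)) := by
        rw [hγη]
        field_simp
        norm_num
      rw [h4] at h2
      exact le_of_mul_le_mul_left h2 (by positivity)
    refine le_trans (Finset.sum_le_sum fun a _ => ?_) (sum_policy_mul_const π' x _).le
    rw [← Finset.mul_sum]
    exact mul_le_mul_of_nonneg_left (h1 a) (policy_nonneg _ _ _)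
  have hT1 : ∀ x, L.layer x < H → ∀ t < T,
      ∑ a, p t x a * (Qv t x a - Qm t x a) ≤ b t x - 2 * F t x := by
    intro x hx t ht
    refine (sum_policy_mul_le _ _ fun a =>
      qValue_sub_qMean_le hγ (hconf t ht) (hℓ t) hx a).trans_eq ?_
    simp only [mul_sub, Finset.sum_sub_distrib, hb, hF, Layering.bonus, Layering.momentWeight]
    congr 1
    rw [Finset.mul_sum, Finset.mul_sum]
    exact Finset.sum_congr rfl fun a _ => by ring
  -- pointwise combination
  have hpt : ∀ x, L.layer x < H → ∑ t ∈ range T, (∑ a, (p t x a - π' x a) * Qv t x a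
      - ∑ a, p t x a * (Qm t x a - Qh t x a))
      ≤ 7 / 4 * (ι / η) + ∑ t ∈ range T, (b t x + (1 + 1 / (H : ℝ)) * W t x - W' t x - F t x) := by
    intro x hx
    have h1 := hT3 x hx
    have h2 := hew x hx
    have h3 : ∑ t ∈ range T, ∑ a, p t x a * (Qv t x a - Qm t x a)
        ≤ ∑ t ∈ range T, (b t x - 2 * F t x) :=
      Finset.sum_le_sum fun t ht => hT1 x hx t (Finset.mem_range.1 ht)
    -- The fluctuation stays on the left, since it is controlled only after averaging over the
    -- visits of `π'`; the unspent -F_t on the right is reserved for it. The multiples of ι/η here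
    -- are 1 + 1/8 + 1/4 ≤ 7/4, and the fluctuation will add 1/4.
    have h4 : ∀ t, ∑ a, (p t x a - π' x a) * Qv t x a - ∑ a, p t x a * (Qm t x a - Qh t x a)
        = ∑ a, p t x a * (Qv t x a - Qm t x a) + ∑ a, π' x a * (Qh t x a - Qv t x a)
          + ∑ a, (p t x a - π' x a) * (Qh t x a - B t x a) + (W t x - W' t x) := by
      intro t
      simp only [hW, hW']
      rw [← Finset.sum_sub_distrib, ← Finset.sum_sub_distrib, ← Finset.sum_add_distrib,
        ← Finset.sum_add_distrib, ← Finset.sum_add_distrib]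
      exact Finset.sum_congr rfl fun a _ => by ring
    have h5 : Real.log (Fintype.card A) / η ≤ ι / η := div_le_div_of_nonneg_right hι hη.le
    have h6 : ι / (4 * η) = 1 / 4 * (ι / η) := by field_simp
    have h7 : ι / (8 * η) = 1 / 8 * (ι / η) := by field_simp
    have h8 : 0 ≤ ι / η := div_nonneg hι0 hη.le
    have h9 : ∑ t ∈ range T, (b t x + (1 + 1 / (H : ℝ)) * W t x - W' t x - F t x)
        = ∑ t ∈ range T, (b t x - 2 * F t x) + ∑ t ∈ range T, (F t x + 1 / H * W t x)
          + ∑ t ∈ range T, (W t x - W' t x) := by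
      rw [← Finset.sum_add_distrib, ← Finset.sum_add_distrib]
      exact Finset.sum_congr rfl fun t _ => by ring
    have h10 : ∑ t ∈ range T, ∑ a, (p t x a - π' x a) * (Qh t x a - B t x a)
        ≤ Real.log (Fintype.card A) / η + ι / (8 * η)
          + ∑ t ∈ range T, (F t x + 1 / H * W t x) := h2
    rw [Finset.sum_congr rfl fun t _ => h4 t, Finset.sum_add_distrib, Finset.sum_add_distrib,
      Finset.sum_add_distrib, h9]
    linarith
  have hv := value_mono (π := π') hP (f := fun x _ => ∑ t ∈ range T,
    (∑ a, (p t x a - π' x a) * Qv t x a - ∑ a, p t x a * (Qm t x a - Qh t x a)))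
    (g := fun x _ => 7 / 4 * (ι / η) * 1
      + ∑ t ∈ range T, ((b t x + (1 + 1 / (H : ℝ)) * W t x - W' t x) - F t x))
    fun x _ hx => by rw [mul_one]; exact hpt x hx
  have h1 : ∀ t, (L.value P π' fun x _ => ∑ a, p t x a * (Qm t x a - Qh t x a))
      = (L.value P π' fun x _ => ∑ a, p t x a * Qm t x a)
        - L.value P π' fun x _ => ∑ a, p t x a * Qh t x a := by
    intro t
    simp only [mul_sub, Finset.sum_sub_distrib]
    exact valueToGo_sub _ _ _ _ _ _
  have h2 : ∑ t ∈ range T, (L.value P π' fun x _ =>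
      b t x + (1 + 1 / (H : ℝ)) * W t x - W' t x)
      ≤ ∑ t ∈ range T, (1 + 1 / (H : ℝ)) * W t L.init :=
    Finset.sum_le_sum fun t ht => value_dilated_le hP (hconf t (Finset.mem_range.1 ht)) π'
  simp only [Layering.value] at hv h1 h2 hT2
  rw [valueToGo_sum, valueToGo_add, valueToGo_const_mul, valueToGo_one, valueToGo_sum] at hv
  simp only [valueToGo_sub, h1] at hv
  rw [Finset.sum_sub_distrib, Finset.sum_sub_distrib] at hv
  have h3 : ∀ t, L.value P (p t) (ℓ t) - L.value P π' (ℓ t)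
      = valueToGo P π' (fun x _ => ∑ a, (p t x a - π' x a) * Qv t x a) H L.init :=
    fun t => value_sub_value hP (p t) π' (ℓ t)
  have h4 : ∑ t ∈ range T, (L.value P (p t) (ℓ t) - L.value P π' (ℓ t))
      = ∑ t ∈ range T, valueToGo P π' (fun x _ => ∑ a, (p t x a - π' x a) * Qv t x a) H L.init :=
    Finset.sum_congr rfl fun t _ => h3 t
  have h5 : H * ι / (4 * η) = 1 / 4 * (ι / η) * H := by field_simp
  have h6 : 2 * H * ι / η = 2 * (ι / η) * H := by field_simp
  rw [h4, h6]
  rw [h5] at hT2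
  simp only [valueToGo_sub, Finset.sum_sub_distrib] at h2 hT2 hv
  change _ ≤ _ + ∑ t ∈ range T, (1 + 1 / (H : ℝ)) * W t L.init
  linarith

end Regret

/-! ### Visits and counters -/

section Visits

variable [Nonempty A]

open Classical in
/-- Deficit of the weighted visits of `(x,a)` with respect to their conditional means. -/
def Layering.visitDeficit (L : Layering X H) (T : ℕ) (P : Transition X A)
    (w : AlgState X A → X → A → ℝ) (x : X) (a : A) (_t : ℕ) (s : AlgState X A)
    (τ : Trajectory X A H) : ℝ :=
  if L.layer x < H then
    w s x a * L.occ P (s.policy H T) x a / 2 - w s x a * τ.visit (L.layer x) x a else 0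

/-- `1 / max(1, N(x,a))` with the counter at the start of the epoch. -/
def AlgState.invCount (s : AlgState X A) (x : X) (a : A) : ℝ := 1 / max 1 (s.prevCount x a : ℝ)

/-- `1 / √max(1, N(x,a))` with the counter at the start of the epoch. -/
def AlgState.invSqrtCount (s : AlgState X A) (x : X) (a : A) : ℝ :=
  1 / √(max 1 (s.prevCount x a : ℝ))

theorem invCount_mem (s : AlgState X A) (x : X) (a : A) :
    0 ≤ s.invCount x a ∧ s.invCount x a ≤ 1 := by
  have h : (1 : ℝ) ≤ max 1 (s.prevCount x a : ℝ) := le_max_left _ _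
  have h0 : (0 : ℝ) < max 1 (s.prevCount x a : ℝ) := zero_lt_one.trans_le h
  exact ⟨by unfold AlgState.invCount; positivity, by
    unfold AlgState.invCount; rwa [div_le_one h0]⟩

theorem invSqrtCount_mem (s : AlgState X A) (x : X) (a : A) :
    0 ≤ s.invSqrtCount x a ∧ s.invSqrtCount x a ≤ 1 := by
  have h : (1 : ℝ) ≤ √(max 1 (s.prevCount x a : ℝ)) := Real.one_le_sqrt.2 (le_max_left _ _)
  have h0 := zero_lt_one.trans_le h
  exact ⟨by unfold AlgState.invSqrtCount; positivity, by
    unfold AlgState.invSqrtCount; rwa [div_le_one h0]⟩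

variable {L : Layering X H} {T : ℕ} {δ : ℝ} {ℓ : ℕ → X → A → ℝ} {P : Transition X A}
  {τ : ℕ → Trajectory X A H}

theorem expect_exp_visitDeficit_le {w : AlgState X A → X → A → ℝ}
    (hw : ∀ s x a, 0 ≤ w s x a ∧ w s x a ≤ 1) (x : X) (a : A) (t : ℕ) (s : AlgState X A) :
    expect (trajectoryLaw P (s.policy H T) L.init H)
      (fun τ => Real.exp (L.visitDeficit T P w x a t s τ)) ≤ 1 := by
  unfold Layering.visitDeficit
  split_ifs with h
  · exact expect_exp_occ_sub_visit_le h a (hw s x a).1 (hw s x a).2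
  · rw [Real.exp_zero, expect_const]

theorem sum_occ_le_of_visitDeficit {w : AlgState X A → X → A → ℝ} {x : X} (hx : L.layer x < H)
    {a : A} {ι : ℝ} {n : ℕ} (h : L.runSum T δ ℓ (L.visitDeficit T P w x a) τ n ≤ ι) :
    ∑ t ∈ range n, L.occ P ((L.run T δ ℓ τ t).policy H T) x a * w (L.run T δ ℓ τ t) x a
      ≤ 2 * ((∑ t ∈ range n, w (L.run T δ ℓ τ t) x a * (τ t).visit (L.layer x) x a) + ι) := by
  simp only [Layering.runSum, Layering.visitDeficit, if_pos hx] at h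
  rw [Finset.sum_sub_distrib, ← Finset.sum_div] at h
  have h1 : ∑ t ∈ range n, L.occ P ((L.run T δ ℓ τ t).policy H T) x a * w (L.run T δ ℓ τ t) x a
      = ∑ t ∈ range n, w (L.run T δ ℓ τ t) x a * L.occ P ((L.run T δ ℓ τ t).policy H T) x a :=
    Finset.sum_congr rfl fun _ _ => mul_comm _ _
  rw [h1]
  linarith

/-- Doubling lets the counter frozen at the start of the epoch stand in for the current one, up to a
factor 2. -/
theorem max_count_le (n : ℕ) (x : X) (a : A) :
    max 1 ((L.run T δ ℓ τ n).count x a : ℝ)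
      ≤ 2 * max 1 ((L.run T δ ℓ τ n).prevCount x a : ℝ) := by
  have h := run_count_lt (L := L) (T := T) (δ := δ) (ℓ := ℓ) (τ := τ) n x a
  have h1 : max 1 ((L.run T δ ℓ τ n).count x a) ≤ 2 * max 1 ((L.run T δ ℓ τ n).prevCount x a) := by
    omega
  exact_mod_cast h1

/-- Telescoping: a visit raises the counter from c to c + 1 ≤ 4N, with N the frozen counter, so √(c
+ 1) - √c ≥ 1/(4√N). -/
theorem sum_invSqrtCount_le {n : ℕ} (hτ : ∀ t < n, L.Follows (τ t)) (x : X) (a : A) :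
    ∑ t ∈ range n, (L.run T δ ℓ τ t).invSqrtCount x a * (τ t).visit (L.layer x) x a
      ≤ 5 * √((L.run T δ ℓ τ n).count x a : ℝ) := by
  induction n with
  | zero => simp
  | succ n ih =>
    have ih := ih fun t ht => hτ t (by omega)
    have hc : ((L.run T δ ℓ τ (n + 1)).count x a : ℝ)
        = (L.run T δ ℓ τ n).count x a + (τ n).visit (L.layer x) x a := by
      rw [run_count hτ, Finset.sum_range_succ, ← run_count fun t ht => hτ t (by omega)]
    have hm := max_count_le (L := L) (T := T) (δ := δ) (ℓ := ℓ) (τ := τ) n x a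
    rw [Finset.sum_range_succ, hc]
    rcases visit_eq_zero_or_one (τ n) (L.layer x) x a with h | h
    · rw [h, mul_zero, add_zero, add_zero]
      exact ih
    rw [h, mul_one]
    refine (add_le_add ih le_rfl).trans ?_
    unfold AlgState.invSqrtCount
    set N : ℝ := max 1 ((L.run T δ ℓ τ n).prevCount x a : ℝ)
    have hN : 1 ≤ N := le_max_left _ _
    have hN1 : 1 ≤ √N := Real.one_le_sqrt.2 hN
    have hN2 := Real.sq_sqrt (zero_le_one.trans hN)
    set c : ℝ := ((L.run T δ ℓ τ n).count x a : ℝ)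
    have hc0 : 0 ≤ c := Nat.cast_nonneg _
    have hcN : c ≤ 2 * N := (le_max_right _ _).trans hm
    have h1 := Real.sq_sqrt hc0
    have h2 := Real.sq_sqrt (show 0 ≤ c + 1 by linarith)
    have h3 := Real.sqrt_nonneg c
    have h4 : √c ≤ √(c + 1) := Real.sqrt_le_sqrt (by linarith)
    have h5 : √(c + 1) ≤ 2 * √N := by
      refine Real.sqrt_le_iff.2 ⟨by linarith, ?_⟩
      rw [mul_pow, hN2]
      linarith
    rw [← le_sub_iff_add_le', div_le_iff₀ (by linarith)]
    have h6 : (√(c + 1) - √c) * (√(c + 1) + √c) = 1 := by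
      linear_combination h2 - h1
    have h7 : 1 ≤ (√(c + 1) - √c) * (4 * √N) :=
      h6.symm.trans_le (mul_le_mul_of_nonneg_left (by linarith) (by linarith))
    nlinarith [mul_nonneg (sub_nonneg.2 h4) (zero_le_one.trans hN1)]

/-- Telescoping of the logarithm: a visit raises it by at least 1/(c + 2), and c + 2 ≤ 6N. -/
theorem sum_invCount_le {n : ℕ} (hτ : ∀ t < n, L.Follows (τ t)) (x : X) (a : A) :
    ∑ t ∈ range n, (L.run T δ ℓ τ t).invCount x a * (τ t).visit (L.layer x) x a
      ≤ 6 * Real.log (1 + ((L.run T δ ℓ τ n).count x a : ℝ)) := by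
  induction n with
  | zero =>
    simp only [Finset.range_zero, Finset.sum_empty]
    exact mul_nonneg (by norm_num) (Real.log_nonneg (by simp))
  | succ n ih =>
    have ih := ih fun t ht => hτ t (by omega)
    have hc : ((L.run T δ ℓ τ (n + 1)).count x a : ℝ)
        = (L.run T δ ℓ τ n).count x a + (τ n).visit (L.layer x) x a := by
      rw [run_count hτ, Finset.sum_range_succ, ← run_count fun t ht => hτ t (by omega)]
    have hm := max_count_le (L := L) (T := T) (δ := δ) (ℓ := ℓ) (τ := τ) n x a
    rw [Finset.sum_range_succ, hc]
    rcases visit_eq_zero_or_one (τ n) (L.layer x) x a with h | h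
    · rw [h, mul_zero, add_zero, add_zero]
      exact ih
    rw [h, mul_one]
    refine (add_le_add ih le_rfl).trans ?_
    unfold AlgState.invCount
    set N : ℝ := max 1 ((L.run T δ ℓ τ n).prevCount x a : ℝ)
    have hN : 1 ≤ N := le_max_left _ _
    set c : ℝ := ((L.run T δ ℓ τ n).count x a : ℝ)
    have hc0 : 0 ≤ c := Nat.cast_nonneg _
    have hcN : c ≤ 2 * N := (le_max_right _ _).trans hm
    have h1 := Real.one_sub_inv_le_log_of_pos (x := (1 + (c + 1)) / (1 + c)) (by positivity)
    rw [Real.log_div (by positivity) (by positivity), inv_div] at h1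
    have h2 : 1 - (1 + c) / (1 + (c + 1)) = 1 / (c + 2) := by
      field_simp
      ring
    have h3 : 1 / N ≤ 6 * (1 / (c + 2)) := by
      rw [mul_one_div, div_le_div_iff₀ (by linarith) (by linarith)]
      linarith
    rw [h2] at h1
    linarith

/-- An episode visits at most one pair of each layer. -/
theorem sum_count_layer_le {n : ℕ} (hτ : ∀ t < n, L.Follows (τ t)) (m : ℕ) :
    ∑ x with L.layer x = m, ∑ a, ((L.run T δ ℓ τ n).count x a : ℝ) ≤ n := by
  classical
  have h1 : ∀ t < n, ∑ x with L.layer x = m, ∑ a, (τ t).visit (L.layer x) x a ≤ 1 := by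
    intro t _
    rw [← Finset.sum_product']
    by_cases h : ∀ q ∈ (univ.filter fun x => L.layer x = m) ×ˢ (univ : Finset A),
        (τ t).visit (L.layer q.1) q.1 q.2 = 0
    · rw [Finset.sum_eq_zero h]
      exact zero_le_one
    · push Not at h
      obtain ⟨q, hq, hq0⟩ := h
      rw [Finset.sum_eq_single_of_mem q hq]
      · exact visit_le_one _ _ _ _
      · intro q' hq' hne
        by_contra h0
        simp only [Finset.mem_product, Finset.mem_filter, Finset.mem_univ, true_and,
          and_true] at hq hq'
        obtain ⟨i, hi, h1, h2⟩ := exists_of_visit_ne_zero hq0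
        obtain ⟨j, hj, h3, h4⟩ := exists_of_visit_ne_zero h0
        have hij : i = j := Fin.ext (by omega)
        subst hij
        exact hne (Prod.ext (h3.symm.trans h1) (h4.symm.trans h2))
  have h2 : ∀ x a, ((L.run T δ ℓ τ n).count x a : ℝ)
      = ∑ t ∈ range n, (τ t).visit (L.layer x) x a := fun x a => run_count hτ x a
  simp only [h2]
  have h3 : ∑ x with L.layer x = m, ∑ a, ∑ t ∈ range n, (τ t).visit (L.layer x) x a
      = ∑ t ∈ range n, ∑ x with L.layer x = m, ∑ a, (τ t).visit (L.layer x) x a := by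
    exact (Finset.sum_congr rfl fun x _ => Finset.sum_comm).trans Finset.sum_comm
  rw [h3]
  refine (Finset.sum_le_sum fun t ht => h1 t (Finset.mem_range.1 ht)).trans ?_
  simp

theorem sum_width_le (L : Layering X H) (f : ℕ → ℕ) (hf : Function.Injective f) :
    ∑ m ∈ range H, (L.width (f m) : ℝ) ≤ Fintype.card X := by
  classical
  have h1 : ∑ m ∈ range H, L.width (f m) ≤ Fintype.card X := by
    have h2 : ∀ m, L.width (f m) = #{x | L.layer x = f m} := fun m => by
      unfold Layering.width
      congr
    simp only [h2]
    rw [← Finset.card_biUnion]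
    · exact Finset.card_le_univ _
    · intro i _ j _ hij
      refine Finset.disjoint_filter.2 fun x _ h h' => hij (hf (h.symm.trans h'))
  exact_mod_cast h1

/-- Cauchy-Schwarz inside layer `m` gives √(|X_m| |A| n). Together with the number of successors
this is √(|X_m| |X_{m+1}|), and a second Cauchy-Schwarz over the layers sums it to `|X|` without any
power of `H`. -/
theorem sum_sqrt_width_mul_count_le {n : ℕ} (hτ : ∀ t < n, L.Follows (τ t)) :
    ∑ y with L.layer y < H, ∑ a, √(L.width (L.layer y + 1)) *
      √((L.run T δ ℓ τ n).count y a : ℝ) ≤ Fintype.card X * √(Fintype.card A * n) := by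
  classical
  have h1 : ∑ y with L.layer y < H, ∑ a, √(L.width (L.layer y + 1) : ℝ) *
      √((L.run T δ ℓ τ n).count y a : ℝ)
      = ∑ m ∈ range H, √(L.width (m + 1) : ℝ) *
        ∑ y with L.layer y = m, ∑ a, √((L.run T δ ℓ τ n).count y a : ℝ) := by
    rw [← Finset.sum_fiberwise_of_maps_to (t := range H) (g := L.layer)
      fun y hy => by simpa using hy]
    refine Finset.sum_congr rfl fun m hm => ?_
    rw [Finset.mem_range] at hm
    have h2 : (univ.filter fun y => L.layer y < H).filter (fun y => L.layer y = m)
        = univ.filter fun y => L.layer y = m := by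
      ext y
      simp only [Finset.mem_filter, Finset.mem_univ, true_and]
      exact ⟨fun h => h.2, fun h => ⟨h ▸ hm, h⟩⟩
    rw [h2, Finset.mul_sum]
    refine Finset.sum_congr rfl fun y hy => ?_
    rw [(Finset.mem_filter.1 hy).2, Finset.mul_sum]
  have h2 : ∀ m, ∑ y with L.layer y = m, ∑ a, √((L.run T δ ℓ τ n).count y a : ℝ)
      ≤ √(L.width m : ℝ) * √(Fintype.card A * n) := by
    intro m
    have h3 := Real.sum_sqrt_mul_sqrt_le ((univ.filter fun y => L.layer y = m) ×ˢ
      (univ : Finset A)) (f := fun _ => 1) (g := fun q => ((L.run T δ ℓ τ n).count q.1 q.2 : ℝ))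
      (fun _ => zero_le_one) (fun _ => Nat.cast_nonneg _)
    simp only [Real.sqrt_one, one_mul, Finset.sum_const, nsmul_eq_mul, mul_one,
      Finset.card_product, Finset.card_univ] at h3
    rw [← Finset.sum_product', ← Real.sqrt_mul (Nat.cast_nonneg _)]
    refine h3.trans ?_
    rw [← Real.sqrt_mul (Nat.cast_nonneg _)]
    refine Real.sqrt_le_sqrt ?_
    rw [Finset.sum_product]
    have h4 := sum_count_layer_le (L := L) (T := T) (δ := δ) (ℓ := ℓ) hτ m
    have h5 : (L.width m : ℝ) * (Fintype.card A * n) = L.width m * Fintype.card A * n := by ring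
    have h6 : (#{y | L.layer y = m} : ℕ) = L.width m := by
      unfold Layering.width
      congr
    rw [h5, h6]
    push_cast
    exact mul_le_mul_of_nonneg_left h4 (by positivity)
  rw [h1]
  calc _ ≤ ∑ m ∈ range H, √(L.width (m + 1) : ℝ) * (√(L.width m : ℝ) * √(Fintype.card A * n)) :=
        Finset.sum_le_sum fun m _ => mul_le_mul_of_nonneg_left (h2 m) (Real.sqrt_nonneg _)
    _ = (∑ m ∈ range H, √(L.width (m + 1) : ℝ) * √(L.width m : ℝ)) * √(Fintype.card A * n) := by
        rw [Finset.sum_mul]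
        exact Finset.sum_congr rfl fun m _ => by ring
    _ ≤ Fintype.card X * √(Fintype.card A * n) := by
        refine mul_le_mul_of_nonneg_right ?_ (Real.sqrt_nonneg _)
        refine (Real.sum_sqrt_mul_sqrt_le (range H) (f := fun m => (L.width (m + 1) : ℝ))
          (g := fun m => (L.width m : ℝ)) (fun _ => Nat.cast_nonneg _)
          (fun _ => Nat.cast_nonneg _)).trans ?_
        have h3 := Real.sqrt_le_sqrt (sum_width_le L (fun m => m + 1) (add_left_injective 1))
        have h4 := Real.sqrt_le_sqrt (sum_width_le L (fun m => m) Function.injective_id)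
        exact (mul_le_mul h3 h4 (Real.sqrt_nonneg _) (Real.sqrt_nonneg _)).trans_eq
          (Real.mul_self_sqrt (Nat.cast_nonneg _))

/-- The total width of the occupancy bounds over the episodes. -/
theorem sum_upperOcc_sub_lowerOcc_run_le (hH : 1 ≤ H)
    (hι : 1 / 2 ≤ logTerm X A T δ) (hτ : ∀ t < T, L.Follows (τ t))
    (hlog : Real.log (1 + (T : ℝ)) ≤ logTerm X A T δ)
    (hconf : ∀ t < T, P ∈ (L.run T δ ℓ τ t).conf)
    (hv1 : ∀ x a, L.runSum T δ ℓ (L.visitDeficit T P AlgState.invSqrtCount x a) τ T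
      ≤ logTerm X A T δ)
    (hv2 : ∀ x a, L.runSum T δ ℓ (L.visitDeficit T P AlgState.invCount x a) τ T
      ≤ logTerm X A T δ) :
    ∑ t ∈ range T, ∑ x with L.layer x < H, ∑ a,
      (L.upperOcc (L.run T δ ℓ τ t).conf ((L.run T δ ℓ τ t).policy H T) x a
        - L.lowerOcc (L.run T δ ℓ τ t).conf ((L.run T δ ℓ τ t).policy H T) x a)
    ≤ 960 * H * logTerm X A T δ * (Fintype.card X * √(Fintype.card A * T))
      + 13296 * H * logTerm X A T δ ^ 2 * ((Fintype.card X : ℝ) ^ 3 * Fintype.card A) := by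
  set ι := logTerm X A T δ with hιdef
  have hι0 : 0 ≤ ι := by linarith
  set s := L.run T δ ℓ τ with hs
  have hX1 : (1 : ℝ) ≤ Fintype.card X := by exact_mod_cast Fintype.card_pos_iff.2 ⟨L.init⟩
  have hA0 : (0 : ℝ) < Fintype.card A := card_pos' A
  have h1 : ∀ t ∈ range T, ∑ x with L.layer x < H, ∑ a,
      (L.upperOcc (s t).conf ((s t).policy H T) x a
        - L.lowerOcc (s t).conf ((s t).policy H T) x a)
      ≤ ∑ y with L.layer y < H, ∑ a,
        (48 * H * √(L.width (L.layer y + 1) * ι) *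
            (L.occ P ((s t).policy H T) y a * (s t).invSqrtCount y a)
          + 936 * (Fintype.card X) ^ 2 * H * ι *
            (L.occ P ((s t).policy H T) y a * (s t).invCount y a)) := by
    intro t ht
    obtain ⟨m, -, hm1, hm2⟩ := run_conf (L := L) (T := T) (δ := δ) (ℓ := ℓ) (τ := τ)
      (by linarith) t
    have h2 := hconf t (Finset.mem_range.1 ht)
    rw [hm2] at h2
    have h3 := sum_upperOcc_sub_lowerOcc_le (π := (s t).policy H T) hι0 hH h2
    rw [← hm2] at h3
    refine h3.trans_eq (Finset.sum_congr rfl fun y _ => Finset.sum_congr rfl fun a _ => ?_)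
    rw [← hm1, AlgState.invSqrtCount, AlgState.invCount, ← mul_div_assoc, Real.sqrt_div (by positivity)]
    ring
  refine (Finset.sum_le_sum h1).trans ?_
  -- Here 480 = 48 · 10. The additive 2ι from the visits contributes 96 · 2 through √ι ≤ 2ι, and the
  -- inverse counters 936 · 14; together 13296.
  have h2 : ∀ y, L.layer y < H → ∀ a, ∑ t ∈ range T,
        (48 * H * √(L.width (L.layer y + 1) * ι) *
            (L.occ P ((s t).policy H T) y a * (s t).invSqrtCount y a)
          + 936 * (Fintype.card X) ^ 2 * H * ι *
            (L.occ P ((s t).policy H T) y a * (s t).invCount y a))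
      ≤ 480 * H * √ι * (√(L.width (L.layer y + 1)) * √((s T).count y a : ℝ))
        + 13296 * H * ι ^ 2 * (Fintype.card X : ℝ) ^ 2 := by
    intro y hy a
    rw [Finset.sum_add_distrib, ← Finset.mul_sum, ← Finset.mul_sum]
    have h3 := sum_occ_le_of_visitDeficit hy (hv1 y a)
    have h4 := sum_occ_le_of_visitDeficit hy (hv2 y a)
    have h5 := sum_invSqrtCount_le (L := L) (T := T) (δ := δ) (ℓ := ℓ) hτ y a
    have h6 := sum_invCount_le (L := L) (T := T) (δ := δ) (ℓ := ℓ) hτ y a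
    have h7 : Real.log (1 + ((s T).count y a : ℝ)) ≤ ι := by
      refine (Real.log_le_log (by positivity) ?_).trans hlog
      have : ((s T).count y a : ℝ) ≤ T := by exact_mod_cast run_count_le hτ y a
      linarith
    have h8 : ∑ t ∈ range T, L.occ P ((s t).policy H T) y a * (s t).invSqrtCount y a
        ≤ 10 * √((s T).count y a : ℝ) + 2 * ι := by linarith
    have h9 : ∑ t ∈ range T, L.occ P ((s t).policy H T) y a * (s t).invCount y a
        ≤ 14 * ι := by linarith
    have h10 : √(L.width (L.layer y + 1) * ι) = √(L.width (L.layer y + 1)) * √ι :=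
      Real.sqrt_mul (Nat.cast_nonneg _) _
    have h11 : √ι ≤ 2 * ι := by
      rw [Real.sqrt_le_iff]
      exact ⟨by linarith, by nlinarith⟩
    have h12 : √(L.width (L.layer y + 1) : ℝ) ≤ (Fintype.card X : ℝ) ^ 2 := by
      rw [Real.sqrt_le_iff]
      refine ⟨by positivity, ?_⟩
      have h13 : (L.width (L.layer y + 1) : ℝ) ≤ Fintype.card X := by
        unfold Layering.width
        exact_mod_cast Finset.card_le_univ _
      refine h13.trans ?_
      rw [← pow_mul]
      exact le_self_pow₀ hX1 (by norm_num)
    have h14 := mul_le_mul_of_nonneg_left h8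
      (show 0 ≤ 48 * H * √(L.width (L.layer y + 1) * ι) by positivity)
    have h15 := mul_le_mul_of_nonneg_left h9
      (show 0 ≤ 936 * (Fintype.card X : ℝ) ^ 2 * H * ι by positivity)
    have h16 : √(L.width (L.layer y + 1) : ℝ) * √ι ≤ (Fintype.card X : ℝ) ^ 2 * (2 * ι) :=
      mul_le_mul h12 h11 (Real.sqrt_nonneg _) (by positivity)
    have h17 := mul_le_mul_of_nonneg_left h16 (show 0 ≤ 96 * H * ι by positivity)
    rw [h10] at h14 ⊢
    linarith
  have h3 : ∑ t ∈ range T, ∑ y with L.layer y < H, ∑ a,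
        (48 * H * √(L.width (L.layer y + 1) * ι) *
            (L.occ P ((s t).policy H T) y a * (s t).invSqrtCount y a)
          + 936 * (Fintype.card X) ^ 2 * H * ι *
            (L.occ P ((s t).policy H T) y a * (s t).invCount y a))
      ≤ ∑ y with L.layer y < H, ∑ a,
        (480 * H * √ι * (√(L.width (L.layer y + 1)) * √((s T).count y a : ℝ))
        + 13296 * H * ι ^ 2 * (Fintype.card X : ℝ) ^ 2) := by
    rw [Finset.sum_comm]
    refine Finset.sum_le_sum fun y hy => ?_
    rw [Finset.sum_comm]
    exact Finset.sum_le_sum fun a _ => h2 y (Finset.mem_filter.1 hy).2 a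
  refine h3.trans ?_
  simp only [Finset.sum_add_distrib, ← Finset.mul_sum]
  refine add_le_add ?_ ?_
  · have h4 := sum_sqrt_width_mul_count_le (L := L) (T := T) (δ := δ) (ℓ := ℓ) hτ
    have h11 : √ι ≤ 2 * ι := by
      rw [Real.sqrt_le_iff]
      exact ⟨by linarith, by nlinarith⟩
    simp only [← Finset.mul_sum] at h4
    calc _ ≤ 480 * H * √ι * (Fintype.card X * √(Fintype.card A * T)) :=
          mul_le_mul_of_nonneg_left h4 (by positivity)
      _ ≤ 480 * H * (2 * ι) * (Fintype.card X * √(Fintype.card A * T)) := by gcongr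
      _ = _ := by ring
  · rw [Finset.sum_const, Finset.sum_const, nsmul_eq_mul, nsmul_eq_mul, Finset.card_univ]
    have h4 : ((#{x | L.layer x < H} : ℕ) : ℝ) ≤ Fintype.card X := by
      exact_mod_cast Finset.card_le_univ _
    calc _ ≤ 13296 * H * ι ^ 2 *
          ((Fintype.card X : ℝ) * (Fintype.card A * (Fintype.card X : ℝ) ^ 2)) :=
          mul_le_mul_of_nonneg_left (mul_le_mul_of_nonneg_right h4 (by positivity))
            (by positivity)
      _ = _ := by ring

end Visits

/-! ### The true transition function lies in the confidence sets -/

section Transition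

variable [Nonempty A]

open Classical in
/-- Compensated deviation of the transition counters in the first `n` episodes. -/
def Layering.transitionExcess (L : Layering X H) (P : Transition X A) (lam c : ℝ) (n : ℕ) (x : X)
    (a : A) (x' : X) (t : ℕ) (_s : AlgState X A) (τ : Trajectory X A H) : ℝ :=
  if t < n ∧ L.layer x < H then τ.visit (L.layer x) x a *
    (lam * ((if τ.stateAt (L.layer x + 1) = x' then 1 else 0) - P x a x') - c * P x a x') else 0

/-- Parameter for the upper tail of the number of transitions in `m` visits. -/
def upperParam (p r : ℝ) : ℝ := if p ≤ 2 * r then 1 else √(2 * r / p)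

/-- Parameter for the lower tail of the number of transitions in `m` visits. -/
def lowerParam (p r : ℝ) : ℝ := √(4 * r / p)

variable {L : Layering X H} {T : ℕ} {δ : ℝ} {ℓ : ℕ → X → A → ℝ} {P : Transition X A}
  {τ : ℕ → Trajectory X A H}

theorem expect_exp_transitionExcess_le {lam c : ℝ} (hc : Real.exp lam - 1 - lam ≤ c) (n : ℕ)
    (x : X) (a : A) (x' : X) (t : ℕ) (s : AlgState X A) :
    expect (trajectoryLaw P (s.policy H T) L.init H)
      (fun τ => Real.exp (L.transitionExcess P lam c n x a x' t s τ)) ≤ 1 := by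
  classical
  unfold Layering.transitionExcess
  split_ifs with h
  · convert expect_exp_transition_le (P := P) (π := s.policy H T) h.2 a x' hc
  · rw [Real.exp_zero, expect_const]

theorem runSum_transitionExcess {lam c : ℝ} {n : ℕ} (hn : n ≤ T)
    (hτ : ∀ t < n, L.Follows (τ t)) {x : X} (hx : L.layer x < H) (a : A) (x' : X) :
    L.runSum T δ ℓ (L.transitionExcess P lam c n x a x') τ T
      = lam * ((L.run T δ ℓ τ n).count₃ x a x' - (L.run T δ ℓ τ n).count x a * P x a x')
        - c * P x a x' * (L.run T δ ℓ τ n).count x a := by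
  classical
  have h1 : L.runSum T δ ℓ (L.transitionExcess P lam c n x a x') τ T
      = ∑ t ∈ range n, ((τ t).visit (L.layer x) x a *
        (lam * ((if (τ t).stateAt (L.layer x + 1) = x' then 1 else 0) - P x a x')
          - c * P x a x')) := by
    rw [Layering.runSum, ← Finset.sum_subset (Finset.range_mono hn)]
    · refine Finset.sum_congr rfl fun t ht => ?_
      rw [Layering.transitionExcess, if_pos ⟨Finset.mem_range.1 ht, hx⟩]
    · intro t _ ht
      rw [Layering.transitionExcess, if_neg fun h => ht (Finset.mem_range.2 h.1)]
  rw [h1, run_count hτ, run_count₃ hτ, Finset.sum_mul, ← Finset.sum_sub_distrib, Finset.mul_sum,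
    Finset.mul_sum, ← Finset.sum_sub_distrib]
  exact Finset.sum_congr rfl fun t _ => by ring

/-- The quadratic bound on the exponential needs a parameter of size at most 1; this is why
`upperParam` is clipped. -/
theorem exp_upperParam_le {p r : ℝ} (hr : 0 < r) :
    Real.exp (upperParam p r) - 1 - upperParam p r ≤ upperParam p r ^ 2 := by
  have h : |upperParam p r| ≤ 1 := by
    unfold upperParam
    split_ifs with h
    · simp
    · rw [not_le] at h
      rw [abs_of_nonneg (Real.sqrt_nonneg _), Real.sqrt_le_one]
      exact div_le_one_of_le₀ h.le (by linarith)
  exact (le_abs_self _).trans (Real.abs_exp_sub_one_sub_id_le h)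

theorem exp_neg_lowerParam_le (p r : ℝ) :
    Real.exp (-lowerParam p r) - 1 - -lowerParam p r ≤ lowerParam p r ^ 2 / 2 := by
  have := exp_neg_le_quadratic (y := lowerParam p r) (Real.sqrt_nonneg _)
  linarith

/-- The optimal Bernstein parameter depends on the random number of visits. The exponential bounds
are therefore assumed for every possible value `m`, each with its own deterministic parameter, and
used at the realized one. For an unvisited pair the width exceeds 1. -/
theorem mem_confSet_of_transitionExcess_le (hP : L.Respects P) (hι : 1 / 2 ≤ logTerm X A T δ)
    {n : ℕ} (hn : n ≤ T) (hτ : ∀ t < n, L.Follows (τ t))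
    (hup : ∀ m, 1 ≤ m → m ≤ n → ∀ x a x', L.runSum T δ ℓ (L.transitionExcess P
      (upperParam (P x a x') (logTerm X A T δ / m))
      (upperParam (P x a x') (logTerm X A T δ / m) ^ 2) n x a x') τ T ≤ 2 * logTerm X A T δ)
    (hlow : ∀ m, 1 ≤ m → m ≤ n → ∀ x a x', L.runSum T δ ℓ (L.transitionExcess P
      (-lowerParam (P x a x') (logTerm X A T δ / m))
      (lowerParam (P x a x') (logTerm X A T δ / m) ^ 2 / 2) n x a x') τ T ≤ 2 * logTerm X A T δ) :
    P ∈ L.confSet (logTerm X A T δ) (L.run T δ ℓ τ n).count (L.run T δ ℓ τ n).count₃ := by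
  refine ⟨hP, fun x a x' hx _ => ?_⟩
  have hc := run_count_le (L := L) (T := T) (δ := δ) (ℓ := ℓ) hτ x a
  have hup' := fun m h1 h2 => hup m h1 h2 x a x'
  have hlow' := fun m h1 h2 => hlow m h1 h2 x a x'
  simp only [runSum_transitionExcess hn hτ hx] at hup' hlow'
  have hp := transition_nonneg P x a x'
  have hp1 := transition_le_one P x a x'
  have h3 := run_count₃ (L := L) (T := T) (δ := δ) (ℓ := ℓ) hτ x a x'
  have h2 := run_count (L := L) (T := T) (δ := δ) (ℓ := ℓ) hτ x a
  set ι := logTerm X A T δ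
  set m := (L.run T δ ℓ τ n).count x a with hm
  set k : ℝ := ((L.run T δ ℓ τ n).count₃ x a x' : ℝ) with hk
  have hk0 : 0 ≤ k := Nat.cast_nonneg _
  have hι0 : 0 < ι := by linarith
  unfold confWidth empirical
  rw [← hm, ← hk]
  rcases Nat.eq_zero_or_pos m with h0 | hpos
  · have hk' : k = 0 := by
      refine le_antisymm ?_ hk0
      have h4 : (0 : ℝ) = ∑ t ∈ range n, (τ t).visit (L.layer x) x a := by
        rw [← h2, h0, Nat.cast_zero]
      rw [h3]
      refine (Finset.sum_le_sum fun t _ => ?_).trans_eq h4.symm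
      refine mul_le_of_le_one_right (visit_nonneg _ _ _ _) ?_
      split_ifs <;> simp
    rw [hk', h0]
    simp only [Nat.cast_zero, zero_div, sub_zero, zero_mul, Real.sqrt_zero, mul_zero, zero_add]
    rw [abs_of_nonneg hp, max_eq_left zero_le_one]
    linarith
  · have hm1 : (1 : ℝ) ≤ m := by exact_mod_cast hpos
    have hm0 : (0 : ℝ) < m := by linarith
    rw [max_eq_right hm1]
    have hb := abs_sub_le_of_bernstein (p := P x a x') (e := k / m) (r := ι / m) hp (by positivity)
      (by positivity) ?_ ?_
    · have e1 : k / m * ι / m = k / m * (ι / m) := by ring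
      have e2 : 28 * ι / (3 * m) = 28 / 3 * (ι / m) := by field_simp
      rwa [e1, e2]
    · rintro lam rfl
      change upperParam (P x a x') (ι / m) * _ - upperParam (P x a x') (ι / m) ^ 2 * _ ≤ _
      have h5 := hup' m hpos hc
      set lam := upperParam (P x a x') (ι / m)
      rw [← mul_le_mul_iff_of_pos_right hm0]
      have h6 : (lam * (k / m - P x a x') - lam ^ 2 * P x a x') * m
          = lam * (k - m * P x a x') - lam ^ 2 * P x a x' * m := by
        field_simp
      have h7 : 2 * (ι / m) * m = 2 * ι := by field_simp
      rw [h6, h7]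
      exact h5
    · rintro lam rfl
      change lowerParam (P x a x') (ι / m) * _ - lowerParam (P x a x') (ι / m) ^ 2 / 2 * _ ≤ _
      have h5 := hlow' m hpos hc
      set lam := lowerParam (P x a x') (ι / m)
      rw [← mul_le_mul_iff_of_pos_right hm0]
      have h6 : (lam * (P x a x' - k / m) - lam ^ 2 / 2 * P x a x') * m
          = -lam * (k - m * P x a x') - lam ^ 2 / 2 * P x a x' * m := by
        field_simp
        ring
      have h7 : 2 * (ι / m) * m = 2 * ι := by field_simp
      rw [h6, h7]
      exact h5

end Transition

/-! ### The logarithmic term -/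

section LogTerm

variable [Nonempty A] {L : Layering X H} {T : ℕ} {δ : ℝ}

theorem two_le_card_of_layering (L : Layering X H) (hH : 1 ≤ H) : 2 ≤ Fintype.card X := by
  have h : L.init ≠ L.term := fun h => by
    have h1 := (L.layer_eq_zero_iff L.init).2 rfl
    have h2 := (L.layer_eq_top_iff L.init).2 h
    omega
  exact Fintype.one_lt_card_iff.2 ⟨_, _, h⟩

theorem le_logTerm (hX : 2 ≤ Fintype.card X) (hT : 1 ≤ T) (hδ : 0 < δ) (hδ1 : δ < 1) :
    1 / 2 ≤ logTerm X A T δ ∧ Real.log (1 + (T : ℝ)) ≤ logTerm X A T δ ∧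
      Real.log (Fintype.card A) ≤ logTerm X A T δ := by
  have hT' : (1 : ℝ) ≤ T := by exact_mod_cast hT
  have hX' : (2 : ℝ) ≤ Fintype.card X := by exact_mod_cast hX
  have hA' : (1 : ℝ) ≤ Fintype.card A := by exact_mod_cast Fintype.card_pos (α := A)
  have h1 : (2 : ℝ) * T ≤ T * Fintype.card X := by nlinarith
  have h2 : (T * Fintype.card X : ℝ) ≤ T * Fintype.card X * Fintype.card A :=
    le_mul_of_one_le_right (by positivity) hA'
  have h3 : (T * Fintype.card X * Fintype.card A : ℝ)
      ≤ T * Fintype.card X * Fintype.card A / δ := by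
    rw [le_div_iff₀ hδ]
    exact mul_le_of_le_one_right (by positivity) hδ1.le
  have h4 : (Fintype.card A : ℝ) ≤ T * Fintype.card X * Fintype.card A :=
    le_mul_of_one_le_left (by positivity) (by linarith)
  refine ⟨?_, Real.log_le_log (by positivity) (by linarith),
    Real.log_le_log (by positivity) (h4.trans h3)⟩
  refine le_trans ?_ (Real.log_le_log two_pos (by linarith : (2 : ℝ) ≤ _))
  linarith [Real.log_two_gt_d9]

theorem exp_neg_logTerm (hX : 2 ≤ Fintype.card X) (hT : 1 ≤ T) (hδ : 0 < δ) :
    Real.exp (-logTerm X A T δ) = δ / (T * Fintype.card X * Fintype.card A) := by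
  have hT' : (0 : ℝ) < T := by exact_mod_cast hT
  have hX' : (0 : ℝ) < Fintype.card X := by exact_mod_cast (by omega : 0 < Fintype.card X)
  have hA' : (0 : ℝ) < Fintype.card A := by exact_mod_cast Fintype.card_pos (α := A)
  rw [Real.exp_neg, logTerm, Real.exp_log (by positivity), inv_div]

end LogTerm

/-! ### The regret -/

section Bound

variable [Nonempty A] {L : Layering X H} {T : ℕ} {δ : ℝ} {ℓ : ℕ → X → A → ℝ}
  {P : Transition X A}

theorem prob_exists_runSum_gt_le {ι : Type*} [Fintype ι]
    {Z : ι → ℕ → AlgState X A → Trajectory X A H → ℝ}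
    (hZ : ∀ i t s, expect (trajectoryLaw P (s.policy H T) L.init H)
      (fun τ => Real.exp (Z i t s τ)) ≤ 1) (n : ℕ) (c : ℝ) :
    prob (L.interactionLaw P ℓ (L.dilatedBonusPO T δ) n)
      {ω | ∃ i, c < L.runSum T δ ℓ (Z i) (L.extendSeq ω) n}
      ≤ Fintype.card ι * Real.exp (-c) := by
  refine (prob_le_sum Finset.univ _ _
    (fun i => {ω | c < L.runSum T δ ℓ (Z i) (L.extendSeq ω) n}) ?_).trans ?_
  · rintro ω - ⟨i, hi⟩
    exact ⟨i, Finset.mem_univ _, hi⟩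
  · refine (Finset.sum_le_sum fun i _ => prob_runSum_gt_le (hZ i) n c).trans_eq ?_
    rw [Finset.sum_const, nsmul_eq_mul, Finset.card_univ]

theorem regret_eq (ω : Fin T → Trajectory X A H) :
    L.regret P ℓ (L.dilatedBonusPO T δ) T ω
      = (∑ t ∈ range T, L.value P ((L.run T δ ℓ (L.extendSeq ω) t).policy H T) (ℓ t))
        - ⨅ π : Policy X A, ∑ t ∈ range T, L.value P π (ℓ t) := by
  rw [Layering.regret, Finset.sum_range]
  simp only [Finset.sum_range]
  congr 1
  refine Finset.sum_congr rfl fun t _ => ?_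
  rw [policyAfter_eq (L.extendSeq ω)]
  intro i
  exact (extendSeq_val L ω (Fin.castLE t.is_lt.le i)).symm

theorem regret_le_mul (hP : L.Respects P) (hℓ : ∀ t x a, ℓ t x a ∈ Set.Icc (0 : ℝ) 1)
    (ω : Fin T → Trajectory X A H) :
    L.regret P ℓ (L.dilatedBonusPO T δ) T ω ≤ H * T := by
  rw [regret_eq]
  have h1 : ∑ t ∈ range T, L.value P ((L.run T δ ℓ (L.extendSeq ω) t).policy H T) (ℓ t)
      ≤ ∑ _t ∈ range T, (H : ℝ) * 1 :=
    Finset.sum_le_sum fun t _ => value_le_mul hP fun x a _ => (hℓ t x a).2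
  have h2 : (0 : ℝ) ≤ ⨅ π : Policy X A, ∑ t ∈ range T, L.value P π (ℓ t) :=
    Real.iInf_nonneg fun π => Finset.sum_nonneg fun t _ =>
      value_nonneg hP fun x a _ => (hℓ t x a).1
  rw [Finset.sum_const, Finset.card_range, nsmul_eq_mul] at h1
  linarith

/-- A near-minimizer suffices, since the slack 1 is absorbed by the bound. The losses being
oblivious, it is fixed in advance, and no union bound over policies is needed. -/
theorem exists_comparator (L : Layering X H) (P : Transition X A) (ℓ : ℕ → X → A → ℝ) (T : ℕ) :
    ∃ π' : Policy X A, ∑ t ∈ range T, L.value P π' (ℓ t)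
      < (⨅ π : Policy X A, ∑ t ∈ range T, L.value P π (ℓ t)) + 1 := by
  have : Nonempty (Policy X A) := ⟨expPolicy 0 fun _ _ => 0⟩
  exact exists_lt_of_ciInf_lt (lt_add_one _)

/-- The factor 6 is 1 + 1/H ≤ 2 at the initial state times 3 from unrolling the dilated recursion
along the greedy transition function. -/
theorem sum_dilated_le (hH : 1 ≤ H) (hT : 1 ≤ T) [Nonempty X] {τ : ℕ → Trajectory X A H}
    (hι : 1 / 2 ≤ logTerm X A T δ) (hconf : ∀ t < T, P ∈ (L.run T δ ℓ τ t).conf) :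
    ∑ t ∈ range T, (1 + 1 / (H : ℝ)) * ∑ a, (L.run T δ ℓ τ t).policy H T L.init a *
        L.dilatedBonus (gam X A H T) (L.run T δ ℓ τ t).conf ((L.run T δ ℓ τ t).policy H T) L.init a
      ≤ 6 * (T * (Fintype.card X * (Fintype.card A * (3 * gam X A H T * H)))
        + H * ∑ t ∈ range T, ∑ x with L.layer x < H, ∑ a,
          (L.upperOcc (L.run T δ ℓ τ t).conf ((L.run T δ ℓ τ t).policy H T) x a
            - L.lowerOcc (L.run T δ ℓ τ t).conf ((L.run T δ ℓ τ t).policy H T) x a)) := by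
  have hγ := gam_pos (X := X) (A := A) hH hT
  have hH' : (1 : ℝ) ≤ H := by exact_mod_cast hH
  have h1 : ∀ t ∈ range T, (1 + 1 / (H : ℝ)) * ∑ a, (L.run T δ ℓ τ t).policy H T L.init a *
        L.dilatedBonus (gam X A H T) (L.run T δ ℓ τ t).conf ((L.run T δ ℓ τ t).policy H T) L.init a
      ≤ 6 * (Fintype.card X * (Fintype.card A * (3 * gam X A H T * H))
        + H * ∑ x with L.layer x < H, ∑ a,
          (L.upperOcc (L.run T δ ℓ τ t).conf ((L.run T δ ℓ τ t).policy H T) x a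
            - L.lowerOcc (L.run T δ ℓ τ t).conf ((L.run T δ ℓ τ t).policy H T) x a)) := by
    intro t ht
    have hmem := hconf t (Finset.mem_range.1 ht)
    obtain ⟨m, -, -, hK⟩ := run_conf (L := L) (ℓ := ℓ) (τ := τ)
      (show 3 / 28 ≤ logTerm X A T δ by linarith) t
    set K := (L.run T δ ℓ τ t).conf
    set π := (L.run T δ ℓ τ t).policy H T
    have hresp : ∀ P' ∈ K, L.Respects P' := fun P' hP' => by rw [hK] at hP'; exact hP'.1
    obtain ⟨P', hP', hB⟩ := exists_dilated_le_value (π := π) hH hγ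
      (hK ▸ isCompact_confSet L _ _ _) ⟨P, hmem⟩ hresp
      (by rw [hK]; exact fun F hF => confSet_rectangular F hF)
    have h2 := value_bonus_le (π := π) hγ hP' (hresp P' hP')
    have h3 : 0 ≤ L.value P' π fun x _ => L.bonus (gam X A H T) K π x :=
      value_nonneg (hresp P' hP') fun x _ _ => Finset.sum_nonneg fun a _ =>
        mul_nonneg (policy_nonneg _ _ _) (div_nonneg (bonus_numerator_nonneg ⟨P', hP'⟩ hγ x a)
          (upperOcc_add_pos hγ x a).le)
    have h4 : 1 / (H : ℝ) ≤ 1 := by rw [div_le_one (by linarith)]; exact hH'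
    have h5 : ((#{x | L.layer x < H} : ℕ) : ℝ) ≤ Fintype.card X := by
      exact_mod_cast Finset.card_le_univ _
    have h6 := mul_le_mul_of_nonneg_right h5
      (show 0 ≤ (Fintype.card A : ℝ) * (3 * gam X A H T * H) by positivity)
    simp only [Finset.sum_add_distrib, ← Finset.mul_sum, Finset.sum_const, nsmul_eq_mul,
      Finset.card_univ] at h2
    have h7 : (0 : ℝ) ≤ 1 + 1 / (H : ℝ) := by positivity
    calc _ ≤ (1 + 1 / (H : ℝ)) * (3 * L.value P' π fun x _ => L.bonus (gam X A H T) K π x) :=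
          mul_le_mul_of_nonneg_left hB h7
      _ ≤ 2 * (3 * L.value P' π fun x _ => L.bonus (gam X A H T) K π x) :=
          mul_le_mul_of_nonneg_right (by linarith) (by positivity)
      _ ≤ _ := by linarith
  refine (Finset.sum_le_sum h1).trans_eq ?_
  rw [← Finset.mul_sum, Finset.sum_add_distrib, Finset.sum_const, Finset.card_range,
    nsmul_eq_mul, ← Finset.mul_sum]

/-- Arithmetic of the regret bound. -/
theorem regret_terms_le [Nonempty X] (hH : 1 ≤ H) (hT : 1 ≤ T) {ι : ℝ} (hι : 1 / 2 ≤ ι) :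
    1 + 2 * H * ι / eta X A H T
      + 6 * (T * (Fintype.card X * (Fintype.card A * (3 * gam X A H T * H)))
        + H * (960 * H * ι * (Fintype.card X * √(Fintype.card A * T))
          + 13296 * H * ι ^ 2 * ((Fintype.card X : ℝ) ^ 3 * Fintype.card A)))
    ≤ 80000 * (Fintype.card X * (H : ℝ) ^ 2 * √(Fintype.card A * T) + (H : ℝ) ^ 4
        + (H : ℝ) ^ 2 * (Fintype.card X : ℝ) ^ 3 * Fintype.card A) * ι ^ 2 := by
  have hH' : (1 : ℝ) ≤ H := by exact_mod_cast hH
  have hT' : (1 : ℝ) ≤ T := by exact_mod_cast hT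
  have hX' : (1 : ℝ) ≤ Fintype.card X := by exact_mod_cast Fintype.card_pos (α := X)
  have hA' : (1 : ℝ) ≤ Fintype.card A := by exact_mod_cast Fintype.card_pos (α := A)
  have hη := eta_pos (X := X) (A := A) hH hT
  unfold gam
  have hη1 : eta X A H T * √(Fintype.card X * Fintype.card A * H * T) ≤ 1 := by
    rw [← le_div_iff₀ (by positivity)]
    exact min_le_right _ _
  have hη2 : 1 / eta X A H T
      ≤ 24 * (H : ℝ) ^ 3 + √(Fintype.card X * Fintype.card A * H * T) := by
    unfold eta
    rcases min_cases (1 / (24 * (H : ℝ) ^ 3)) (1 / √(Fintype.card X * Fintype.card A * H * T))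
      with h | h
    · rw [h.1, one_div_one_div]
      linarith [Real.sqrt_nonneg ((Fintype.card X : ℝ) * Fintype.card A * H * T)]
    · rw [h.1, one_div_one_div]
      have : (0 : ℝ) ≤ 24 * (H : ℝ) ^ 3 := by positivity
      linarith
  set η := eta X A H T
  set x := (Fintype.card X : ℝ)
  set a := (Fintype.card A : ℝ)
  set h := (H : ℝ)
  set t := (T : ℝ)
  have hs : √(x * a * h * t) = √(x * h) * √(a * t) := by
    rw [← Real.sqrt_mul (by positivity)]
    ring_nf
  rw [hs] at hη1 hη2
  set s := √(a * t)
  have hss : s * s = a * t := Real.mul_self_sqrt (by positivity)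
  have hs1 : 1 ≤ s := Real.one_le_sqrt.2 (one_le_mul_of_one_le_of_one_le hA' hT')
  have hr1 : 1 ≤ √(x * h) := Real.one_le_sqrt.2 (one_le_mul_of_one_le_of_one_le hX' hH')
  have hr2 : √(x * h) ≤ x * h := by
    have := Real.mul_self_sqrt (show 0 ≤ x * h by positivity)
    nlinarith
  have hM : 1 ≤ x * h ^ 2 * s := by
    have : 1 ≤ h ^ 2 := one_le_pow₀ hH'
    exact one_le_mul_of_one_le_of_one_le (one_le_mul_of_one_le_of_one_le hX' this) hs1
  set M := x * h ^ 2 * s with hMdef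
  have hι2 : 1 ≤ 4 * ι ^ 2 := by nlinarith
  have hιι : ι ≤ 4 * ι ^ 2 := by nlinarith
  have e1 : 1 ≤ 4 * M * ι ^ 2 := by nlinarith
  -- The reciprocal of a minimum is at most the sum of the reciprocals; the cap 1/(24H³) yields the
  -- H⁴ term.
  have e2 : 2 * h * ι / η ≤ 200 * h ^ 4 * ι ^ 2 + 8 * M * ι ^ 2 := by
    have f1 : 2 * h * ι / η = 2 * h * ι * (1 / η) := by ring
    have f2 : h * (24 * h ^ 3 + √(x * h) * s) ≤ 24 * h ^ 4 + M := by
      have : h * (√(x * h) * s) ≤ h * (x * h * s) := by gcongr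
      rw [hMdef]
      linarith
    calc 2 * h * ι / η = 2 * ι * (h * (1 / η)) := by ring
      _ ≤ 2 * ι * (h * (24 * h ^ 3 + √(x * h) * s)) := by gcongr
      _ ≤ 2 * ι * (24 * h ^ 4 + M) := by gcongr
      _ ≤ 2 * (4 * ι ^ 2) * (24 * h ^ 4 + M) := by gcongr
      _ ≤ _ := by
        have : 0 ≤ h ^ 4 * ι ^ 2 := by positivity
        linarith
  -- One factor √(|A|T) of |A|T is cancelled by η, the other one remains in `M`.
  have e3 : 6 * (t * (x * (a * (3 * (2 * η * h) * h)))) ≤ 144 * M * ι ^ 2 := by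
    have f1 : η * s ≤ 1 := by
      refine le_trans ?_ hη1
      exact mul_le_mul_of_nonneg_left (le_mul_of_one_le_left (by positivity) hr1) hη.le
    calc 6 * (t * (x * (a * (3 * (2 * η * h) * h)))) = 36 * (η * (a * t) * x * h ^ 2) := by ring
      _ = 36 * (η * s * M) := by rw [← hss, hMdef]; ring
      _ ≤ 36 * (1 * M) := by gcongr
      _ ≤ 36 * (4 * ι ^ 2 * M) := by gcongr
      _ = _ := by ring
  have e4 : 6 * (h * (960 * h * ι * (x * s))) ≤ 23040 * M * ι ^ 2 := by
    calc 6 * (h * (960 * h * ι * (x * s))) = 5760 * (ι * M) := by rw [hMdef]; ring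
      _ ≤ 5760 * (4 * ι ^ 2 * M) := by gcongr
      _ = _ := by ring
  have e5 : 6 * (h * (13296 * h * ι ^ 2 * (x ^ 3 * a))) = 79776 * (h ^ 2 * x ^ 3 * a) * ι ^ 2 := by
    ring
  have p1 : 0 ≤ M * ι ^ 2 := by positivity
  have p2 : 0 ≤ h ^ 4 * ι ^ 2 := by positivity
  have p3 : 0 ≤ (h ^ 2 * x ^ 3 * a) * ι ^ 2 := by positivity
  linarith

/-- The deterministic core: all probabilistic input is in the bounds on `runSum`, of which the last
two put `P` into every confidence set. -/
theorem regret_le_of_runSum_le [Nonempty X] (hH : 1 ≤ H) (hT : 1 ≤ T) (hP : L.Respects P)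
    (hℓ : ∀ t x a, ℓ t x a ∈ Set.Icc (0 : ℝ) 1) (hι : 1 / 2 ≤ logTerm X A T δ)
    (hlogT : Real.log (1 + (T : ℝ)) ≤ logTerm X A T δ)
    (hlogA : Real.log (Fintype.card A) ≤ logTerm X A T δ) {π' : Policy X A}
    (hπ' : ∑ t ∈ range T, L.value P π' (ℓ t)
      < (⨅ π : Policy X A, ∑ t ∈ range T, L.value P π (ℓ t)) + 1)
    {ω : Fin T → Trajectory X A H}
    (hω : ω ∈ (L.interactionLaw P ℓ (L.dilatedBonusPO T δ) T).support)
    (hover : ∀ x a, L.runSum T δ ℓ (L.overestimate T P ℓ x a) (L.extendSeq ω) T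
      ≤ logTerm X A T δ)
    (hmom : ∀ x, L.runSum T δ ℓ (L.momentExcess T P x) (L.extendSeq ω) T ≤ logTerm X A T δ)
    (hunder : L.runSum T δ ℓ (L.underestimate T P ℓ π') (L.extendSeq ω) T ≤ logTerm X A T δ)
    (hv1 : ∀ x a, L.runSum T δ ℓ (L.visitDeficit T P AlgState.invSqrtCount x a) (L.extendSeq ω) T
      ≤ logTerm X A T δ)
    (hv2 : ∀ x a, L.runSum T δ ℓ (L.visitDeficit T P AlgState.invCount x a) (L.extendSeq ω) T
      ≤ logTerm X A T δ)
    (hup : ∀ n m, n ≤ T → 1 ≤ m → m ≤ n → ∀ x a x', L.runSum T δ ℓ (L.transitionExcess P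
      (upperParam (P x a x') (logTerm X A T δ / m))
      (upperParam (P x a x') (logTerm X A T δ / m) ^ 2) n x a x') (L.extendSeq ω) T
      ≤ 2 * logTerm X A T δ)
    (hlow : ∀ n m, n ≤ T → 1 ≤ m → m ≤ n → ∀ x a x', L.runSum T δ ℓ (L.transitionExcess P
      (-lowerParam (P x a x') (logTerm X A T δ / m))
      (lowerParam (P x a x') (logTerm X A T δ / m) ^ 2 / 2) n x a x') (L.extendSeq ω) T
      ≤ 2 * logTerm X A T δ) :
    L.regret P ℓ (L.dilatedBonusPO T δ) T ω
      ≤ 80000 * (Fintype.card X * (H : ℝ) ^ 2 * √(Fintype.card A * T) + (H : ℝ) ^ 4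
        + (H : ℝ) ^ 2 * (Fintype.card X : ℝ) ^ 3 * Fintype.card A) * logTerm X A T δ ^ 2 := by
  have hτ : ∀ t < T, L.Follows (L.extendSeq ω t) := fun t ht => by
    have := follows_of_mem_support_interactionLaw hP hω ⟨t, ht⟩
    rwa [← extendSeq_val L ω ⟨t, ht⟩] at this
  have hconf : ∀ t < T, P ∈ (L.run T δ ℓ (L.extendSeq ω) t).conf := fun t ht => by
    obtain ⟨n, hn, -, hK⟩ := run_conf (L := L) (ℓ := ℓ) (τ := L.extendSeq ω)
      (show 3 / 28 ≤ logTerm X A T δ by linarith) t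
    have hnT : n ≤ T := hn.trans ht.le
    rw [hK]
    exact mem_confSet_of_transitionExcess_le hP hι hnT (fun t ht => hτ t (ht.trans_le hnT))
      (fun m => hup n m hnT) (fun m => hlow n m hnT)
  have h1 := sum_value_sub_value_le hH hT hP hℓ hconf hlogA π' hover hmom hunder
  have h2 := sum_dilated_le hH hT hι hconf
  have h3 := sum_upperOcc_sub_lowerOcc_run_le hH hι hτ hlogT hconf hv1 hv2
  have h4 := regret_terms_le (X := X) (A := A) hH hT hι
  have h5 := mul_le_mul_of_nonneg_left h3 (Nat.cast_nonneg (α := ℝ) H)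
  rw [Finset.sum_sub_distrib] at h1
  rw [regret_eq]
  linarith

theorem prob_regret_gt_le (hH : 1 ≤ H) (hT : 1 ≤ T) (hP : L.Respects P)
    (hℓ : ∀ t x a, ℓ t x a ∈ Set.Icc (0 : ℝ) 1) (hδ : 0 < δ) (hδ1 : δ < 1) :
    prob (L.interactionLaw P ℓ (L.dilatedBonusPO T δ) T)
      {ω | 80000 * (Fintype.card X * (H : ℝ) ^ 2 * √(Fintype.card A * T) + (H : ℝ) ^ 4
        + (H : ℝ) ^ 2 * (Fintype.card X : ℝ) ^ 3 * Fintype.card A) * logTerm X A T δ ^ 2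
          < L.regret P ℓ (L.dilatedBonusPO T δ) T ω} ≤ 7 * δ := by
  have hX := two_le_card_of_layering L hH
  have : Nonempty X := ⟨L.init⟩
  obtain ⟨hι, hlogT, hlogA⟩ := le_logTerm (A := A) hX hT hδ hδ1
  have hexp := exp_neg_logTerm (A := A) hX hT hδ
  have hN1 : (1 : ℝ) ≤ T * Fintype.card X * Fintype.card A := by
    exact_mod_cast Nat.mul_pos (Nat.mul_pos hT Fintype.card_pos) Fintype.card_pos
  have hone : ∀ k : ℕ, k ≤ T * Fintype.card X * Fintype.card A →
      (k : ℝ) * Real.exp (-logTerm X A T δ) ≤ δ := fun k hk => by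
    have hk' : (k : ℝ) ≤ T * Fintype.card X * Fintype.card A := by exact_mod_cast hk
    rw [hexp, mul_div_assoc', div_le_iff₀ (by linarith), mul_comm]
    gcongr
  have htwo : ∀ k : ℕ, k ≤ (T * Fintype.card X * Fintype.card A) ^ 2 →
      (k : ℝ) * Real.exp (-(2 * logTerm X A T δ)) ≤ δ := fun k hk => by
    have hk' : (k : ℝ) ≤ (T * Fintype.card X * Fintype.card A) ^ 2 := by exact_mod_cast hk
    rw [show -(2 * logTerm X A T δ) = -logTerm X A T δ + -logTerm X A T δ by ring, Real.exp_add,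
      hexp]
    set N : ℝ := T * Fintype.card X * Fintype.card A
    calc (k : ℝ) * (δ / N * (δ / N)) ≤ N ^ 2 * (δ / N * (δ / N)) := by gcongr
      _ = δ * δ := by field_simp
      _ ≤ δ := mul_le_of_le_one_right hδ.le hδ1.le
  obtain ⟨π', hπ'⟩ := exists_comparator L P ℓ T
  have hXA : Fintype.card (X × A) ≤ T * Fintype.card X * Fintype.card A := by
    rw [Fintype.card_prod, mul_assoc]
    exact Nat.le_mul_of_pos_left _ hT
  have hXX : Fintype.card X ≤ T * Fintype.card X * Fintype.card A := by
    rw [mul_right_comm]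
    exact Nat.le_mul_of_pos_left _ (Nat.mul_pos hT Fintype.card_pos)
  -- The transition events are indexed also by episode, counter value and successor. There are too
  -- many of them for level ι, but at most (T|X||A|)², which level 2ι can afford.
  have hTT : Fintype.card (Fin T × Fin T × X × A × X)
      ≤ (T * Fintype.card X * Fintype.card A) ^ 2 := by
    simp only [Fintype.card_prod, Fintype.card_fin]
    calc _ = (T * Fintype.card X) ^ 2 * Fintype.card A := by ring
      _ ≤ (T * Fintype.card X) ^ 2 * Fintype.card A ^ 2 :=
        Nat.mul_le_mul_left _ (Nat.le_self_pow two_ne_zero _)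
      _ = _ := by ring
  have hpos : ∀ m : ℕ, 0 < logTerm X A T δ / ((m + 1 : ℕ) : ℝ) := fun m =>
    div_pos (by linarith) (by positivity)
  have p1 := (prob_exists_runSum_gt_le (L := L) (ℓ := ℓ) (δ := δ) (ι := X × A)
    (fun i => expect_exp_overestimate_le (P := P) hH hT hℓ i.1 i.2) T
    (logTerm X A T δ)).trans (hone _ hXA)
  have p2 := (prob_exists_runSum_gt_le (L := L) (ℓ := ℓ) (δ := δ)
    (fun x => expect_exp_momentExcess_le (P := P) hH hT x) T
    (logTerm X A T δ)).trans (hone _ hXX)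
  have p3 := (prob_runSum_gt_le (L := L) (ℓ := ℓ) (δ := δ)
    (expect_exp_underestimate_le hH hT hP hℓ π') T (logTerm X A T δ)).trans
    ((one_mul _).symm.trans_le (by simpa using hone 1 (by exact_mod_cast hN1)))
  have p4 := (prob_exists_runSum_gt_le (L := L) (ℓ := ℓ) (δ := δ) (ι := X × A)
    (fun i => expect_exp_visitDeficit_le (P := P) (T := T) invSqrtCount_mem i.1 i.2) T
    (logTerm X A T δ)).trans (hone _ hXA)
  have p5 := (prob_exists_runSum_gt_le (L := L) (ℓ := ℓ) (δ := δ) (ι := X × A)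
    (fun i => expect_exp_visitDeficit_le (P := P) (T := T) invCount_mem i.1 i.2) T
    (logTerm X A T δ)).trans (hone _ hXA)
  have p6 := (prob_exists_runSum_gt_le (L := L) (ℓ := ℓ) (δ := δ)
    (ι := Fin T × Fin T × X × A × X)
    (fun i => expect_exp_transitionExcess_le (L := L) (P := P) (T := T)
      (exp_upperParam_le (p := P i.2.2.1 i.2.2.2.1 i.2.2.2.2) (hpos i.2.1)) (i.1 + 1)
      i.2.2.1 i.2.2.2.1 i.2.2.2.2) T (2 * logTerm X A T δ)).trans (htwo _ hTT)
  have p7 := (prob_exists_runSum_gt_le (L := L) (ℓ := ℓ) (δ := δ)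
    (ι := Fin T × Fin T × X × A × X)
    (fun i => expect_exp_transitionExcess_le (L := L) (P := P) (T := T)
      (exp_neg_lowerParam_le (P i.2.2.1 i.2.2.2.1 i.2.2.2.2)
        (logTerm X A T δ / ((i.2.1 + 1 : ℕ) : ℝ))) (i.1 + 1)
      i.2.2.1 i.2.2.2.1 i.2.2.2.2) T (2 * logTerm X A T δ)).trans (htwo _ hTT)
  refine (prob_le_sum Finset.univ _ _ ![_, _, _, _, _, _, _] ?_).trans
    ((Fin.sum_univ_seven _).trans_le
      ((add_le_add (add_le_add (add_le_add (add_le_add (add_le_add (add_le_add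
        p1 p2) p3) p4) p5) p6) p7).trans_eq (by ring)))
  intro ω hω hlt
  by_contra! hbad
  refine absurd (regret_le_of_runSum_le hH hT hP hℓ hι hlogT hlogA hπ' hω ?_ ?_ ?_ ?_ ?_ ?_ ?_)
    (not_le.2 hlt)
  · exact fun x a => not_lt.1 fun h => hbad 0 (Finset.mem_univ _) ⟨(x, a), h⟩
  · exact fun x => not_lt.1 fun h => hbad 1 (Finset.mem_univ _) ⟨x, h⟩
  · exact not_lt.1 fun h => hbad 2 (Finset.mem_univ _) h
  · exact fun x a => not_lt.1 fun h => hbad 3 (Finset.mem_univ _) ⟨(x, a), h⟩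
  · exact fun x a => not_lt.1 fun h => hbad 4 (Finset.mem_univ _) ⟨(x, a), h⟩
  · intro n m hn hm hmn x a x'
    -- Both indices are positive, and an element `i` of `Fin T` encodes the number `i + 1`.
    obtain ⟨n, rfl⟩ := Nat.exists_eq_succ_of_ne_zero (by omega : n ≠ 0)
    obtain ⟨m, rfl⟩ := Nat.exists_eq_succ_of_ne_zero (by omega : m ≠ 0)
    exact not_lt.1 fun h => hbad 5 (Finset.mem_univ _)
      ⟨(⟨n, by omega⟩, ⟨m, by omega⟩, x, a, x'), h⟩
  · intro n m hn hm hmn x a x'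
    obtain ⟨n, rfl⟩ := Nat.exists_eq_succ_of_ne_zero (by omega : n ≠ 0)
    obtain ⟨m, rfl⟩ := Nat.exists_eq_succ_of_ne_zero (by omega : m ≠ 0)
    exact not_lt.1 fun h => hbad 6 (Finset.mem_univ _)
      ⟨(⟨n, by omega⟩, ⟨m, by omega⟩, x, a, x'), h⟩

end Bound

end TabularMDP

end

/-! ### The theorem: absorbing the lower-order term for large and for small T -/

theorem mainTheorem2 :
    ∃ (C c : ℝ) (p : ℕ), 0 < C ∧ 0 < c ∧
      ∀ (X A : Type*) [Fintype X] [Fintype A] [Nonempty A] (H T : ℕ)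
        (L : TabularMDP.Layering X H) (P : TabularMDP.Transition X A)
        (ℓ : ℕ → X → A → ℝ) (δ : ℝ),
        1 ≤ H → 1 ≤ T → L.Respects P → (∀ t x a, ℓ t x a ∈ Set.Icc (0 : ℝ) 1) →
        0 < δ → δ < 1 →
        1 - c * δ ≤ TabularMDP.prob (L.interactionLaw P ℓ (L.dilatedBonusPO T δ) T)
          {ω |
            (((T : ℝ) ≤ (H : ℝ) ^ 2 * (Fintype.card X : ℝ) ^ 2 * Fintype.card A ∨
                (Fintype.card X : ℝ) ^ 4 * Fintype.card A ≤ T) →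
              L.regret P ℓ (L.dilatedBonusPO T δ) T ω ≤
                C * ((Fintype.card X : ℝ) * (H : ℝ) ^ 2 * √(Fintype.card A * T) + (H : ℝ) ^ 4)
                  * TabularMDP.logTerm X A T δ ^ p) ∧
            L.regret P ℓ (L.dilatedBonusPO T δ) T ω ≤
              C * ((Fintype.card X : ℝ) * (H : ℝ) ^ 2 * √(Fintype.card A * T) + (H : ℝ) ^ 4
                  + (H : ℝ) ^ 2 * (Fintype.card X : ℝ) ^ 3 * Fintype.card A)
                * TabularMDP.logTerm X A T δ ^ p} := by
  -- Seven failure events, and 160000 = 2 · 80000, since for large T the lower-order term is merged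
  -- with the leading one.
  refine ⟨160000, 7, 2, by norm_num, by norm_num, ?_⟩
  intro X A _ _ _ H T L P ℓ δ hH hT hP hℓ hδ hδ1
  have hX := TabularMDP.two_le_card_of_layering L hH
  obtain ⟨hι, -, -⟩ := TabularMDP.le_logTerm (A := A) hX hT hδ hδ1
  have hprob := TabularMDP.prob_regret_gt_le (P := P) hH hT hP hℓ hδ hδ1
  rw [TabularMDP.one_sub_prob_compl]
  refine sub_le_sub_left (le_trans (TabularMDP.prob_mono _ fun ω _ hω => ?_) hprob) 1
  by_contra hreg
  refine hω ?_
  rw [Set.mem_ofPred_eq, not_lt] at hreg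
  have hle := TabularMDP.regret_le_mul (δ := δ) hP hℓ ω
  have hH' : (1 : ℝ) ≤ H := by exact_mod_cast hH
  have hX' : (2 : ℝ) ≤ Fintype.card X := by exact_mod_cast hX
  have hA' : (0 : ℝ) < Fintype.card A := by exact_mod_cast Fintype.card_pos
  set ι := TabularMDP.logTerm X A T δ
  set x := (Fintype.card X : ℝ)
  set a := (Fintype.card A : ℝ)
  set h := (H : ℝ)
  set t := (T : ℝ)
  set r := L.regret P ℓ (L.dilatedBonusPO T δ) T ω
  have ht : 0 ≤ t := Nat.cast_nonneg _
  have hι2 : 0 ≤ ι ^ 2 := sq_nonneg ι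
  have hss : √(a * t) * √(a * t) = a * t := Real.mul_self_sqrt (by positivity)
  have q1 : 0 ≤ x * h ^ 2 * √(a * t) * ι ^ 2 := by positivity
  have q2 : 0 ≤ h ^ 4 * ι ^ 2 := by positivity
  have q3 : 0 ≤ h ^ 2 * x ^ 3 * a * ι ^ 2 := by positivity
  refine ⟨?_, by linarith⟩
  rintro (h1 | h1)
  -- Small T: the trivial bound HT = H√T√T suffices once one factor √T is replaced by H|X|√|A|; the
  -- factor 4ι² ≥ 1 is then inserted.
  · have h2 : √t ≤ h * x * √a := by
      rw [Real.sqrt_le_iff]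
      refine ⟨by positivity, h1.trans_eq ?_⟩
      rw [mul_pow, mul_pow, Real.sq_sqrt hA'.le]
    have h3 : h * t ≤ x * h ^ 2 * √(a * t) := by
      calc h * t = h * √t * √t := by rw [mul_assoc, Real.mul_self_sqrt ht]
        _ ≤ h * (h * x * √a) * √t := by gcongr
        _ = _ := by rw [Real.sqrt_mul hA'.le]; ring
    have h4 : x * h ^ 2 * √(a * t) * 1 ≤ x * h ^ 2 * √(a * t) * (4 * ι ^ 2) :=
      mul_le_mul_of_nonneg_left (by nlinarith) (by positivity)
    linarith
  -- Large T: this makes H²|X|³|A| at most the leading term.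
  · have h2 : x ^ 2 * a ≤ √(a * t) := by
      refine Real.le_sqrt_of_sq_le ?_
      calc (x ^ 2 * a) ^ 2 = a * (x ^ 4 * a) := by ring
        _ ≤ a * t := by gcongr
    have h3 : h ^ 2 * x ^ 3 * a * ι ^ 2 ≤ x * h ^ 2 * √(a * t) * ι ^ 2 := by
      calc h ^ 2 * x ^ 3 * a * ι ^ 2 = x * h ^ 2 * (x ^ 2 * a) * ι ^ 2 := by ring
        _ ≤ _ := by gcongr
    linarith
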